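/- **Theorem (Spectral gap and classification).** *Setting.* A computational problem $\{\Xi,\Omega,\mathcal M,\Lambda\}$ consists of a set $\Omega$, a problem function $\Xi:\Omega\to\mathcal M$ into a totally ordered discrete space, and a countable set $\Lambda=\{f_0,f_1,\dots\}$ of functions $\Omega\to\mathbb C$ separating the points of $\Omega$. A *general algorithm* is a map $\Gamma:\Omega\to\mathcal M$ such that for each $A\in\Omega$ there is a non-empty finite set $\Lambda_\Gamma(A)\subset\Lambda$ with the property that $f(B)=f(A)$ for all $f\in\Lambda_\Gamma(A)$ implies $\Gamma(B)=\Gamma(A)$ and $\Lambda_\Gamma(B)=\Lambda_\Gamma(A)$. A *tower of height $k$* is a family of functions $\Gamma_{n_k},\Gamma_{n_k,n_{k-1}},\dots,\Gamma_{n_k,\dots,n_1}:\Omega\to\mathcal M$, the last ones general algorithms, with $\Xi(A)=\lim_{n_k\to\infty}\Gamma_{n_k}(A)$ and $\Gamma_{n_k,\dots,n_{j+1}}(A)=\lim_{n_j\to\infty}\Gamma_{n_k,\dots,n_j}(A)$ for all $A\in\Omega$. It is *arithmetic* if one Blum–Shub–Smale machine over $\mathbb R$ (with rational constants) with an oracle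 for the real and imaginary parts of the numbers $f_i(A)$ computes $\Gamma_{n_k,\dots,n_1}(A)$ from $(n_k,\dots,n_1)$, for all $A\in\Omega$. For $\alpha=G$ (all towers) or $\alpha=A$ (arithmetic towers), $\Delta^\alpha_{m+1}$ ($m\ge1$) is the class of problems that have a tower of type $\alpha$ of some height $k$ with $1\le k\le m$. $\Sigma^\alpha_m$ (respectively $\Pi^\alpha_m$) is the class of problems in $\Delta^\alpha_{m+1}$ that have a tower of type $\alpha$ of height $m$ with $\Gamma_{n_m}(A)\le\Xi(A)$ (respectively $\Gamma_{n_m}(A)\ge\Xi(A)$) for all $n_m$ and $A$. Consider (possibly unbounded) self-adjoint operators $A$ on $l^2(\mathbb N)$ that are bounded below and for which the linear span of the canonical basis $(e_j)$ is a core; put $a(A)=\inf \mathrm{Sp}(A)$. *Spectral gap.* Let $\widehat\Omega_{\mathrm{SA}}$ be the set of those $A$ that are either gapped ($a(A)$ is an isolated point of the spectrum and an eigenvalue of multiplicity one) or gapless ($[a(A),a(A)+\epsilon]\subset\mathrm{Sp}(A)$ for some $\epsilon>0$), and let $\widehat\Omega_{\mathrm D}$ be the set of the operators in $\widehat\Omega_{\mathrm{SA}}$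 with diagonal matrix. Let $\Xi_{\mathrm{gap}}(A)\in\{0<1\}$ be $1$ if and only if $A$ is gapped, and let $\Lambda$ consist of the matrix entries $A\mapsto\langle Ae_j,e_i\rangle$. Then $$\Delta_2^G\not\ni\{\Xi_{\mathrm{gap}},\widehat\Omega_{\mathrm{SA}}\}\in\Sigma_2^A,\qquad \Delta_2^G\not\ni\{\Xi_{\mathrm{gap}},\widehat\Omega_{\mathrm D}\}\in\Sigma_2^A .$$ *Classification.* Let $f:\mathbb N\to\mathbb N$ with $f(n)\ge n$, let $P_n$ be the orthogonal projection onto the span of the first $n$ basis vectors, and put $D_{f,n}(A)=\max\{\|(I-P_{f(n)})AP_n\|,\|(I-P_{f(n)})A^*P_n\|\}$. Let $\mathcal C$ be a non-empty set of null sequences of non-negative rational numbers, the dispersion bounds that may be supplied (for example all of them, or a single one). Let $\widetilde\Omega_{\mathrm{SA}}^f$ be the set of pairs $(A,c)$ where $A$ is as above, $c\in\mathcal C$ and $D_{f,n}(A)\le c_n$ for all $n$, and let $\widetilde\Omega_{\mathrm D}$ be the set of the pairs in it with $A$ diagonal. Let $\Lambda$ consist of the matrix entries of $A$, the numbers $c_n$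 and the numbers $f(n)$. Let $\Xi_{\mathrm{class}}(A,c)\in\{1<2<3<4\}$ be $1$ if $a(A)$ lies in the discrete spectrum and has multiplicity $1$; $2$ if it lies in the discrete spectrum and has multiplicity $>1$; $3$ if it lies in the essential spectrum but is an isolated point of the spectrum; $4$ if it is a cluster point of the spectrum. Then $$\Delta_2^G\not\ni\{\Xi_{\mathrm{class}},\widetilde\Omega_{\mathrm{SA}}^f\}\in\Pi_2^A,\qquad \Delta_2^G\not\ni\{\Xi_{\mathrm{class}},\widetilde\Omega_{\mathrm D}\}\in\Pi_2^A .$$ -/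

import Mathlib

noncomputable section

/-! ## Computational problems and machines -/

namespace SCI

open Filter Topology

/-- A computational problem `{Ξ, Ω, M, Λ}` with a countable evaluation set, enumerated as
`Λ = {eval 0, eval 1, …}`.  `code` is the identification of an element of `M` with a number that
a machine can output. -/
structure ComputationalProblem (Ω M : Type) where
  /-- the problem function `Ξ` -/
  problem : Ω → M
  /-- the evaluation functions -/
  eval : ℕ → Ω → ℂ
  /-- the evaluations determine the object -/
  eval_separates : ∀ A B : Ω, (∀ k, eval k A = eval k B) → A = B
  /-- numerical code of an output -/
  code : M → ℝ
  code_injective : Function.Injective code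

/-- The instruction at a node of a Blum–Shub–Smale machine with node set `Q`.  The memory is a
sequence `x₀, x₁, …` of real numbers.  A successor `none` means: halt.  Constants are rational, so
that on rational data every instruction can be carried out by a Turing machine. -/
inductive Instr (Q : Type) : Type
  /-- `x_r := c` -/
  | const (r : ℕ) (c : ℚ) (next : Option Q)
  /-- `x_r := x_a + x_b` -/
  | add (r a b : ℕ) (next : Option Q)
  /-- `x_r := x_a - x_b` -/
  | sub (r a b : ℕ) (next : Option Q)
  /-- `x_r := x_a * x_b` -/
  | mul (r a b : ℕ) (next : Option Q)
  /-- `x_r := x_a / x_b` (with value `0` if `x_b = 0`) -/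
  | div (r a b : ℕ) (next : Option Q)
  /-- if `x_a ≤ x_b` go to `yes`, otherwise to `no` -/
  | branch (a b : ℕ) (yes no : Option Q)
  /-- `x_r := x_i`, where `i` is the address stored in `x_a` -/
  | load (r a : ℕ) (next : Option Q)
  /-- `x_i := x_a`, where `i` is the address stored in `x_r` -/
  | store (r a : ℕ) (next : Option Q)
  /-- `x_r :=` real part of the oracle's value at the index stored in `x_a` -/
  | queryRe (r a : ℕ) (next : Option Q)
  /-- `x_r :=` imaginary part of the oracle's value at the index stored in `x_a` -/
  | queryIm (r a : ℕ) (next : Option Q)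

/-- A Blum–Shub–Smale machine over the reals with access to an oracle: a finite flowchart. -/
structure Machine where
  /-- the nodes -/
  Q : Type
  finite_Q : Finite Q
  /-- the initial node -/
  start : Q
  /-- the instruction at each node -/
  instr : Q → Instr Q

namespace Machine

/-- A configuration: current node (`none` = halted) and memory. -/
abbrev Config (T : Machine) : Type := Option T.Q × (ℕ → ℝ)

/-- The address (or oracle index) stored in a memory cell with content `x`. -/
def addr (x : ℝ) : ℕ := ⌊x⌋₊

/-- One step of the machine with oracle `o`. -/
def step (T : Machine) (o : ℕ → ℂ) : T.Config → T.Config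
  | (none, x) => (none, x)
  | (some q, x) =>
    match T.instr q with
    | .const r c next => (next, Function.update x r (c : ℝ))
    | .add r a b next => (next, Function.update x r (x a + x b))
    | .sub r a b next => (next, Function.update x r (x a - x b))
    | .mul r a b next => (next, Function.update x r (x a * x b))
    | .div r a b next => (next, Function.update x r (x a / x b))
    | .branch a b yes no => (open Classical in if x a ≤ x b then yes else no, x)
    | .load r a next => (next, Function.update x r (x (addr (x a))))
    | .store r a next => (next, Function.update x (addr (x r)) (x a))
    | .queryRe r a next => (next, Function.update x r (o (addr (x a))).re)
    | .queryIm r a next => (next, Function.update x r (o (addr (x a))).im)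

/-- The initial configuration on input `l`: the entries of `l` in the first memory cells. -/
def init (T : Machine) (l : List ℕ) : T.Config :=
  (some T.start, fun i => ((l.getD i 0 : ℕ) : ℝ))

/-- With oracle `o` and input `l`, the machine halts after finitely many steps with output `y` in
memory cell `0`. -/
def Outputs (T : Machine) (o : ℕ → ℂ) (l : List ℕ) (y : ℝ) : Prop :=
  ∃ t : ℕ, ((T.step o)^[t] (T.init l)).1 = none ∧ ((T.step o)^[t] (T.init l)).2 0 = y

end Machine

/-! ## Towers of algorithms and the hierarchy -/

/-- The type of a tower: general (`G`) or arithmetic (`A`). -/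
inductive Model
  | G
  | A

namespace ComputationalProblem

variable {Ω M : Type} (P : ComputationalProblem Ω M)

/-- `Γ` is a general algorithm: it reads, adaptively and consistently, a finite non-empty set `L A`
of evaluations of the input `A`, and its output depends on these only. -/
def IsGeneralAlgorithm (Γ : Ω → M) : Prop :=
  ∃ L : Ω → Finset ℕ, (∀ A, (L A).Nonempty) ∧
    ∀ A B, (∀ k ∈ L A, P.eval k B = P.eval k A) → Γ B = Γ A ∧ L B = L A

/-- One oracle machine computes all `Γ_{n_k,…,n_1}(A)` from `(n_k,…,n_1)` and the evaluations
of `A`. -/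
def IsRecursive (k : ℕ) (Γ : List ℕ → Ω → M) : Prop :=
  ∃ T : Machine, ∀ l : List ℕ, l.length = k → ∀ A : Ω,
    T.Outputs (fun i => P.eval i A) l (P.code (Γ l A))

/-- `Γ` is a tower of algorithms of height `k` of the given type.  The function
`Γ_{n_k,…,n_j}` is `Γ [n_k,…,n_j]`, and `Γ [] = Ξ`. -/
structure IsTower [TopologicalSpace M] (α : Model) (k : ℕ) (Γ : List ℕ → Ω → M) : Prop where
  top : Γ [] = P.problem
  limit : ∀ l : List ℕ, l.length < k → ∀ A : Ω,
    Tendsto (fun n : ℕ => Γ (l ++ [n]) A) atTop (𝓝 (Γ l A))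
  general : ∀ l : List ℕ, l.length = k → P.IsGeneralAlgorithm (Γ l)
  arithmetic : α = Model.A → P.IsRecursive k Γ

/-- The class `Δ_m^α` for `m ≥ 2`: the solvability complexity index is at most `m - 1`, that is,
there is a tower of type `α` of some height `k` with `1 ≤ k ≤ m - 1`. -/
def InDelta [TopologicalSpace M] (α : Model) (m : ℕ) : Prop :=
  ∃ k : ℕ, 1 ≤ k ∧ k < m ∧ ∃ Γ : List ℕ → Ω → M, P.IsTower α k Γ

/-- The class `Σ_m^α` for `m ≥ 1` and totally ordered `M`: the outermost limit converges from
below. -/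
def InSigma [TopologicalSpace M] [LinearOrder M] (α : Model) (m : ℕ) : Prop :=
  P.InDelta α (m + 1) ∧
    ∃ Γ : List ℕ → Ω → M, P.IsTower α m Γ ∧ ∀ (n : ℕ) (A : Ω), Γ [n] A ≤ P.problem A

/-- The class `Π_m^α` for `m ≥ 1` and totally ordered `M`: the outermost limit converges from
above. -/
def InPi [TopologicalSpace M] [LinearOrder M] (α : Model) (m : ℕ) : Prop :=
  P.InDelta α (m + 1) ∧
    ∃ Γ : List ℕ → Ω → M, P.IsTower α m Γ ∧ ∀ (n : ℕ) (A : Ω), P.problem A ≤ Γ [n] A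

end ComputationalProblem

/-! ## Unbounded operators on `ℓ²(ℕ)` -/

/-- The Hilbert space `ℓ²(ℕ)`. -/
abbrev Hilb : Type := lp (fun _ : ℕ => ℂ) 2

/-- Possibly unbounded linear operators in `ℓ²(ℕ)`. -/
abbrev Op : Type := Hilb →ₗ.[ℂ] Hilb

/-- The canonical basis. -/
def e (n : ℕ) : Hilb := lp.single 2 n 1

namespace Op

/-- Self-adjoint, bounded below, and such that the linear span of the canonical basis is a core. -/
structure IsAdmissible (A : Op) : Prop where
  selfAdjoint : IsSelfAdjoint A
  boundedBelow : ∃ m : ℝ, ∀ x : A.domain, m * ‖(x : Hilb)‖ ^ 2 ≤ (inner ℂ (x : Hilb) (A x)).re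
  core : A.HasCore (Submodule.span ℂ (Set.range e))

open Classical in
/-- `A e_j` (and `0` if `e_j` is not in the domain). -/
def applyBasis (A : Op) (j : ℕ) : Hilb :=
  if h : e j ∈ A.domain then A ⟨e j, h⟩ else 0

/-- The matrix entry `⟨A e_j, e_i⟩` (Mathlib's inner product is linear in the second variable). -/
def entry (A : Op) (i j : ℕ) : ℂ := inner ℂ (e i) (A.applyBasis j)

/-- The matrix of `A` is diagonal. -/
def IsDiagonal (A : Op) : Prop := ∀ i j : ℕ, i ≠ j → A.entry i j = 0

/-- The spectrum: the complement of the set of `z` for which `A - z` is a bijection from the domain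
onto the space with bounded inverse. -/
def spectrum (A : Op) : Set ℂ :=
  {z | ∃ R : Hilb →L[ℂ] Hilb,
    (∀ y : Hilb, ∃ h : R y ∈ A.domain, A ⟨R y, h⟩ - z • R y = y) ∧
    ∀ x : A.domain, R (A x - z • (x : Hilb)) = x}ᶜ

/-- `A - z` as a linear map on the domain of `A`. -/
def subScalar (A : Op) (z : ℂ) : A.domain →ₗ[ℂ] Hilb := A.toFun - z • A.domain.subtype

/-- The eigenspace `ker (A - z)`. -/
def eigenspace (A : Op) (z : ℂ) : Submodule ℂ A.domain := LinearMap.ker (A.subScalar z)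

/-- `z` is an isolated point of the spectrum. -/
def IsIsolated (A : Op) (z : ℂ) : Prop :=
  z ∈ A.spectrum ∧ ∃ ε > 0, ∀ w ∈ A.spectrum, dist w z < ε → w = z

/-- The discrete spectrum: isolated points of the spectrum that are eigenvalues of finite
multiplicity. -/
def discreteSpectrum (A : Op) : Set ℂ :=
  {z | A.IsIsolated z ∧ A.eigenspace z ≠ ⊥ ∧ FiniteDimensional ℂ (A.eigenspace z)}

/-- `A - z` is Fredholm. -/
def IsFredholmAt (A : Op) (z : ℂ) : Prop :=
  FiniteDimensional ℂ (A.eigenspace z) ∧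
  IsClosed ((LinearMap.range (A.subScalar z) : Submodule ℂ Hilb) : Set Hilb) ∧
  FiniteDimensional ℂ (Hilb ⧸ LinearMap.range (A.subScalar z))

/-- The essential spectrum. -/
def essentialSpectrum (A : Op) : Set ℂ := {z | ¬ A.IsFredholmAt z}

/-- The bottom `a(A)` of the spectrum. -/
def bottom (A : Op) : ℝ := sInf {x : ℝ | (x : ℂ) ∈ A.spectrum}

/-- The bottom of the spectrum is an isolated eigenvalue of multiplicity one. -/
def IsGapped (A : Op) : Prop :=
  A.IsIsolated (A.bottom : ℂ) ∧ Module.finrank ℂ (A.eigenspace (A.bottom : ℂ)) = 1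

/-- The spectrum contains an interval `[a(A), a(A) + ε]` with `ε > 0`. -/
def IsGapless (A : Op) : Prop :=
  ∃ ε > (0 : ℝ), ∀ x ∈ Set.Icc A.bottom (A.bottom + ε), (x : ℂ) ∈ A.spectrum

open Classical in
/-- The kind of the bottom `a` of the spectrum:
`1` if `a` is in the discrete spectrum with multiplicity one,
`2` if `a` is in the discrete spectrum with multiplicity greater than one,
`3` if `a` is in the essential spectrum and an isolated point of the spectrum,
`4` in the remaining case; for a self-adjoint operator this is the case that `a` is a cluster point
of the spectrum. -/
def bottomKind (A : Op) : Set.Icc (1 : ℕ) 4 :=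
  if (A.bottom : ℂ) ∈ A.discreteSpectrum ∧
      Module.finrank ℂ (A.eigenspace (A.bottom : ℂ)) = 1 then ⟨1, by simp⟩
  else if (A.bottom : ℂ) ∈ A.discreteSpectrum ∧
      1 < Module.finrank ℂ (A.eigenspace (A.bottom : ℂ)) then ⟨2, by simp⟩
  else if (A.bottom : ℂ) ∈ A.essentialSpectrum ∧ A.IsIsolated (A.bottom : ℂ) then ⟨3, by simp⟩
  else ⟨4, by simp⟩

/-- The orthogonal projection `P_n` onto the span of the first `n` basis vectors. -/
def proj (n : ℕ) : Hilb →L[ℂ] Hilb :=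
  ∑ j ∈ Finset.range n, (innerSL ℂ (e j)).smulRight (e j)

/-- The bounded operator `A P_n`. -/
def mulProj (A : Op) (n : ℕ) : Hilb →L[ℂ] Hilb :=
  ∑ j ∈ Finset.range n, (innerSL ℂ (e j)).smulRight (A.applyBasis j)

/-- The dispersion `D_{f,n}(A) = max {‖(I - P_{f(n)}) A P_n‖, ‖(I - P_{f(n)}) A* P_n‖}`. -/
def dispersion (f : ℕ → ℕ) (n : ℕ) (A : Op) : ℝ :=
  max ‖(ContinuousLinearMap.id ℂ Hilb - proj (f n)) ∘L A.mulProj n‖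
    ‖(ContinuousLinearMap.id ℂ Hilb - proj (f n)) ∘L mulProj A.adjoint n‖

/-- An admissible operator is determined by its matrix. -/
theorem IsAdmissible.eq_of_entry_eq {A B : Op} (hA : A.IsAdmissible) (hB : B.IsAdmissible)
    (h : ∀ i j, A.entry i j = B.entry i j) : A = B := by
  have key : ∀ j, A.applyBasis j = B.applyBasis j := by
    intro j
    ext i
    have := h i j
    simpa [entry, e, lp.inner_single_left] using this
  have heA : ∀ j, e j ∈ A.domain := fun j => hA.core.le_domain (Submodule.subset_span ⟨j, rfl⟩)
  have heB : ∀ j, e j ∈ B.domain := fun j => hB.core.le_domain (Submodule.subset_span ⟨j, rfl⟩)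
  have hspan : ∀ x ∈ Submodule.span ℂ (Set.range e), ∀ (h1 : x ∈ A.domain) (h2 : x ∈ B.domain),
      A ⟨x, h1⟩ = B ⟨x, h2⟩ := by
    intro x hx
    induction hx using Submodule.span_induction with
    | mem x hx =>
      obtain ⟨j, rfl⟩ := hx
      intro h1 h2
      simpa [applyBasis, h1, h2] using key j
    | zero =>
      intro h1 h2
      have e1 : (⟨0, h1⟩ : A.domain) = 0 := rfl
      have e2 : (⟨0, h2⟩ : B.domain) = 0 := rfl
      rw [e1, e2, LinearPMap.map_zero, LinearPMap.map_zero]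
    | add x y hx hy ihx ihy =>
      intro h1 h2
      have hxA := hA.core.le_domain hx
      have hyA := hA.core.le_domain hy
      have hxB := hB.core.le_domain hx
      have hyB := hB.core.le_domain hy
      have e1 : (⟨x + y, h1⟩ : A.domain) = ⟨x, hxA⟩ + ⟨y, hyA⟩ := rfl
      have e2 : (⟨x + y, h2⟩ : B.domain) = ⟨x, hxB⟩ + ⟨y, hyB⟩ := rfl
      rw [e1, e2, LinearPMap.map_add, LinearPMap.map_add, ihx hxA hxB, ihy hyA hyB]
    | smul c x hx ih =>
      intro h1 h2
      have hxA := hA.core.le_domain hx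
      have hxB := hB.core.le_domain hx
      have e1 : (⟨c • x, h1⟩ : A.domain) = c • ⟨x, hxA⟩ := rfl
      have e2 : (⟨c • x, h2⟩ : B.domain) = c • ⟨x, hxB⟩ := rfl
      rw [e1, e2, LinearPMap.map_smul, LinearPMap.map_smul, ih hxA hxB]
  have hres : A.domRestrict (Submodule.span ℂ (Set.range e)) =
      B.domRestrict (Submodule.span ℂ (Set.range e)) := by
    refine LinearPMap.ext ?_ ?_
    · rw [LinearPMap.domRestrict_domain, LinearPMap.domRestrict_domain,
        inf_eq_left.mpr hA.core.le_domain, inf_eq_left.mpr hB.core.le_domain]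
    · intro x hx hx'
      exact hspan x hx.1 hx.2 hx'.2
  rw [← hA.core.closure_eq, ← hB.core.closure_eq, hres]

end Op

/-! ## The two problems -/

/-- The class of admissible operators that are gapped or gapless. -/
def gapClass : Set Op := {A | A.IsAdmissible ∧ (A.IsGapped ∨ A.IsGapless)}

/-- The diagonal operators in `gapClass`. -/
def gapClassDiag : Set Op := {A | A ∈ gapClass ∧ A.IsDiagonal}

open Classical in
/-- The spectral gap problem on a class `S` of admissible operators; an algorithm can read the
matrix entries.  The answers are `false` (gapless) `<` `true` (gapped). -/
def gapProblem (S : Set Op) (hS : ∀ A ∈ S, A.IsAdmissible) : ComputationalProblem S Bool where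
  problem A := decide A.1.IsGapped
  eval k A := A.1.entry k.unpair.1 k.unpair.2
  eval_separates A B h := Subtype.ext <|
    (hS A.1 A.2).eq_of_entry_eq (hS B.1 B.2) fun i j => by simpa using h (Nat.pair i j)
  code b := if b then 1 else 0
  code_injective := by
    intro a b h
    cases a <;> cases b <;> simp_all

/-- The class of admissible operators with known bounded dispersion with respect to `f`: an object
is an operator `A` together with a null sequence `c` of rationals with `D_{f,n}(A) ≤ c_n`, which is
known to an algorithm.  Here `C` is the set of sequences that may be supplied. -/
def dispersionClass (f : ℕ → ℕ) (C : Set (ℕ → ℚ)) : Set (Op × (ℕ → ℚ)) :=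
  {p | p.1.IsAdmissible ∧ p.2 ∈ C ∧ Tendsto (fun n => (p.2 n : ℝ)) atTop (𝓝 0) ∧
    ∀ n, p.1.dispersion f n ≤ (p.2 n : ℝ)}

/-- The objects of `dispersionClass f C` whose operator is diagonal. -/
def dispersionClassDiag (f : ℕ → ℕ) (C : Set (ℕ → ℚ)) : Set (Op × (ℕ → ℚ)) :=
  {p | p ∈ dispersionClass f C ∧ p.1.IsDiagonal}

/-- The classification problem for the bottom of the spectrum on a class `S` of pairs `(A, c)` with
`A` admissible; an algorithm can read the matrix entries of `A`, the dispersion bounds `c_n` and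
the numbers `f(n)`. -/
def classProblem (f : ℕ → ℕ) (S : Set (Op × (ℕ → ℚ))) (hS : ∀ p ∈ S, p.1.IsAdmissible) :
    ComputationalProblem S (Set.Icc (1 : ℕ) 4) where
  problem p := p.1.1.bottomKind
  eval k p :=
    if k % 3 = 0 then p.1.1.entry (k / 3).unpair.1 (k / 3).unpair.2
    else if k % 3 = 1 then (p.1.2 (k / 3) : ℂ)
    else (f (k / 3) : ℂ)
  eval_separates p q h := Subtype.ext <| Prod.ext
    ((hS p.1 p.2).eq_of_entry_eq (hS q.1 q.2) fun i j => by
      simpa using h (3 * Nat.pair i j))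
    (funext fun n => by
      have h1 : (3 * n + 1) % 3 = 1 := by omega
      have h2 : (3 * n + 1) / 3 = n := by omega
      simpa [h1, h2] using h (3 * n + 1))
  code m := ((m : ℕ) : ℝ)
  code_injective := fun a b h => Subtype.ext (Nat.cast_injective (R := ℝ) h)

end SCI

end

/-! Upper bounds. The answers depend on three thresholds for the bottom `a` of the spectrum: kind `≤
1` (gapped), kind `≤ 2` (isolated with finite-dimensional eigenspace), kind `≤ 3` (isolated). Each
is equivalent to a statement `∃ m, ∀ k, R m k`, where `R` is a finite computation with the
evaluations. Bounding `k` by `n` and `m` by the outer index gives a tower of height two. Truncating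
the existential quantifier can only lose witnesses, so gappedness is approached from below and the
kind from above (`exists_tower`, `kindOf_anti`).

The tests rest on form inequalities. If `a` is isolated with finite multiplicity, then `A ≥ q - (q -
a) P` as forms, where `P` projects onto the eigenspace and `a < q` (`le_form_of_gap`,
`le_form_add_projection`). Conversely, if `a < q` and `A ≥ q - K F*F` with `F` of finite rank, then
a Weyl sequence argument shows that `a` is isolated (`isIsolated_of_finiteRank`), and `F` is
injective on the eigenspace. Rank one detects gappedness; the first `n` coordinates detect finite
multiplicity. Lowering `q` slightly leaves room for rational data, and the core hypothesis reduces
"for all `x`" to finite vectors with Gaussian integer coordinates. For mere isolation no finite-rank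
form is available. Instead, there is no spectrum strictly between `r` and `q`, for any `r` with `a <
r < q`, exactly if `‖(A - (q + r)/2) x‖ ≥ (q - r)/2 ‖x‖` always; here norms of `A x` are needed, and
the dispersion bound controls their unread part. In place of the spectral theorem, the spectral
facts use that the norm of a self-adjoint bounded resolvent is its spectral radius
(`le_norm_map_sub`).

Computability. Arithmetical expressions with bounded sums compile to machines (`Expr.compiles`),
witnesses are coded by Gödel's beta function, and the tests are written as expressions.

Lower bounds. To a set `K` of naturals belongs a diagonal operator that is gapped for finite `K` and
gapless for infinite `K`, each entry depending on finitely many bits of `K`. One limit cannot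
separate finite from infinite sets: against any sequence of general algorithms an infinite `K` is
built on which they give the answer for finite sets infinitely often (`not_inDelta_two`). -/

noncomputable section

/-! ### Composing machines and compiling arithmetical expressions -/

namespace SCI

open Filter Topology

/-- Replace the successors of an instruction. -/
def Instr.map {Q Q' : Type} (φ : Option Q → Option Q') : Instr Q → Instr Q'
  | .const r c n => .const r c (φ n)
  | .add r a b n => .add r a b (φ n)
  | .sub r a b n => .sub r a b (φ n)
  | .mul r a b n => .mul r a b (φ n)
  | .div r a b n => .div r a b (φ n)
  | .branch a b y n => .branch a b (φ y) (φ n)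
  | .load r a n => .load r a (φ n)
  | .store r a n => .store r a (φ n)
  | .queryRe r a n => .queryRe r a (φ n)
  | .queryIm r a n => .queryIm r a (φ n)

namespace Machine

/-- The configuration `c'` is reached from `c` after finitely many steps. -/
def Reaches (T : Machine) (o : ℕ → ℂ) (c c' : T.Config) : Prop := ∃ t, (T.step o)^[t] c = c'

/-- Started with memory `x`, the machine halts with memory `y`. -/
def Runs (T : Machine) (o : ℕ → ℂ) (x y : ℕ → ℝ) : Prop := T.Reaches o (some T.start, x) (none, y)

theorem Reaches.trans {T : Machine} {o : ℕ → ℂ} {c c' c'' : T.Config} (h : T.Reaches o c c')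
    (h' : T.Reaches o c' c'') : T.Reaches o c c'' := by
  obtain ⟨t, rfl⟩ := h
  obtain ⟨s, rfl⟩ := h'
  exact ⟨s + t, Function.iterate_add_apply _ _ _ _⟩

/-- The effect of an instruction on the memory does not involve the names of the nodes, so
relabelling successors commutes with a step. -/
theorem step_map {T T' : Machine} (o : ℕ → ℂ) (φ : Option T.Q → Option T'.Q) {q : T.Q} {q' : T'.Q}
    (h : φ (some q) = some q') (hi : T'.instr q' = (T.instr q).map φ) (x : ℕ → ℝ) :
    T'.step o (φ (some q), x) = (φ (T.step o (some q, x)).1, (T.step o (some q, x)).2) := by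
  rw [h]
  simp only [step, hi]
  cases T.instr q <;> simp only [Instr.map]
  split_ifs <;> rfl

/-- Embeds a machine as a part of a larger flowchart. Since `φ` also acts on `none`, halting of the
part becomes a jump to `φ none`. -/
theorem reaches_map {T T' : Machine} (o : ℕ → ℂ) (φ : Option T.Q → Option T'.Q)
    (h : ∀ q, ∃ q', φ (some q) = some q' ∧ T'.instr q' = (T.instr q).map φ)
    {c : T.Config} {y : ℕ → ℝ} (hc : T.Reaches o c (none, y)) :
    T'.Reaches o (φ c.1, c.2) (φ none, y) := by
  obtain ⟨t, ht⟩ := hc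
  induction t generalizing c with
  | zero =>
    obtain rfl : c = (none, y) := ht
    exact ⟨0, rfl⟩
  | succ t ih =>
    rw [Function.iterate_succ_apply] at ht
    obtain ⟨_ | q, x⟩ := c
    · exact ih (c := (none, x)) ht
    · obtain ⟨q', h1, h2⟩ := h q
      have := step_map o φ h1 h2 x
      refine Reaches.trans ⟨1, this⟩ (ih ht)

/-- The machine with a single instruction. -/
def ofInstr (i : Instr Unit) : Machine := ⟨Unit, inferInstance, (), fun _ => i⟩

/-- First `T`, then `T'`. -/
def seq (T T' : Machine) : Machine where
  Q := T.Q ⊕ T'.Q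
  finite_Q := by have := T.finite_Q; have := T'.finite_Q; infer_instance
  start := Sum.inl T.start
  instr q := q.elim (fun q => (T.instr q).map fun n => some (n.elim (Sum.inr T'.start) Sum.inl))
    fun q => (T'.instr q).map (Option.map Sum.inr)

/-- While `x_a ≤ x_b`, execute `T`. -/
def loop (a b : ℕ) (T : Machine) : Machine where
  Q := Option T.Q
  finite_Q := by have := T.finite_Q; infer_instance
  start := none
  instr q := q.elim (.branch a b (some (some T.start)) none) fun q => (T.instr q).map some

/-- Set `x_r` to `1` if `x_a ≤ x_b` and to `0` otherwise. -/
def leTest (r a b : ℕ) : Machine where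
  Q := Fin 3
  finite_Q := inferInstance
  start := 0
  instr := ![.branch a b (some 1) (some 2), .const r 1 none, .const r 0 none]

theorem Runs.seq {T T' : Machine} {o : ℕ → ℂ} {x y z : ℕ → ℝ} (h : T.Runs o x y)
    (h' : T'.Runs o y z) : (T.seq T').Runs o x z := by
  have h1 := reaches_map (T' := T.seq T') o
    (fun n => some (n.elim (Sum.inr T'.start) Sum.inl)) (fun q => ⟨Sum.inl q, rfl, rfl⟩) h
  have h2 := reaches_map (T' := T.seq T') o (Option.map Sum.inr) (fun q => ⟨Sum.inr q, rfl, rfl⟩) h'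
  exact h1.trans h2

theorem loop_runs_of_not {T : Machine} {o : ℕ → ℂ} {a b : ℕ} {x : ℕ → ℝ} (h : ¬ x a ≤ x b) :
    (loop a b T).Runs o x x := by
  refine ⟨1, ?_⟩
  simp [step, loop, h]

theorem loop_runs_of_le {T : Machine} {o : ℕ → ℂ} {a b : ℕ} {x y z : ℕ → ℝ} (h : x a ≤ x b)
    (hT : T.Runs o x y) (hz : (loop a b T).Runs o y z) : (loop a b T).Runs o x z := by
  have h0 : (loop a b T).Reaches o (some none, x) (some (some T.start), x) := by
    refine ⟨1, ?_⟩
    simp [step, loop, h]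
  have h1 := reaches_map (T' := loop a b T) o some (fun q => ⟨some q, rfl, rfl⟩) hT
  exact h0.trans (h1.trans hz)

/-- `P k` is the loop invariant after `k` passes; the induction is on the number of remaining
passes. -/
theorem loop_runs {T : Machine} {o : ℕ → ℂ} {a b : ℕ} (P : ℕ → (ℕ → ℝ) → Prop) {n : ℕ}
    (hstep : ∀ k < n, ∀ x, P k x → x a ≤ x b ∧ ∃ y, T.Runs o x y ∧ P (k + 1) y)
    (hend : ∀ x, P n x → ¬ x a ≤ x b) {x : ℕ → ℝ} (h0 : P 0 x) :
    ∃ y, (loop a b T).Runs o x y ∧ P n y := by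
  have key : ∀ m k, k + m = n → ∀ x, P k x → ∃ y, (loop a b T).Runs o x y ∧ P n y := by
    intro m
    induction m with
    | zero =>
      rintro k hk x hx
      obtain rfl : k = n := by omega
      exact ⟨x, loop_runs_of_not (hend x hx), hx⟩
    | succ m ih =>
      intro k hk x hx
      obtain ⟨hle, y, hy, hP⟩ := hstep k (by omega) x hx
      obtain ⟨z, hz, hPz⟩ := ih (k + 1) (by omega) y hP
      exact ⟨z, loop_runs_of_le hle hy hz, hPz⟩
  exact key n 0 (by omega) x h0

theorem ofInstr_const (o : ℕ → ℂ) (r : ℕ) (c : ℚ) (x : ℕ → ℝ) :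
    (ofInstr (.const r c none)).Runs o x (Function.update x r c) := ⟨1, rfl⟩

theorem ofInstr_add (o : ℕ → ℂ) (r a b : ℕ) (x : ℕ → ℝ) :
    (ofInstr (.add r a b none)).Runs o x (Function.update x r (x a + x b)) := ⟨1, rfl⟩

theorem leTest_runs (o : ℕ → ℂ) (r a b : ℕ) (x : ℕ → ℝ) :
    (leTest r a b).Runs o x (Function.update x r (open Classical in if x a ≤ x b then 1 else 0)) := by
  refine ⟨2, ?_⟩
  by_cases h : x a ≤ x b <;> simp [step, leTest, h]

end Machine

/-- Arithmetical expressions in variables `v₀, v₁, …` with access to an oracle, closed under bounded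
summation. -/
inductive Expr : Type
  | var (i : ℕ)
  | const (c : ℚ)
  | add (a b : Expr)
  | sub (a b : Expr)
  | mul (a b : Expr)
  | div (a b : Expr)
  /-- the truth value of `a ≤ b` -/
  | le (a b : Expr)
  | re (a : Expr)
  | im (a : Expr)
  /-- the sum of the `a` for `v_i < ⌊b⌋₊` -/
  | sum (i : ℕ) (b a : Expr)

namespace Expr

open Machine

open Classical in
/-- The value of an expression. -/
def eval (o : ℕ → ℂ) : Expr → (ℕ → ℝ) → ℝ
  | var i, v => v i
  | const c, _ => c
  | add a b, v => a.eval o v + b.eval o v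
  | sub a b, v => a.eval o v - b.eval o v
  | mul a b, v => a.eval o v * b.eval o v
  | div a b, v => a.eval o v / b.eval o v
  | le a b, v => if a.eval o v ≤ b.eval o v then 1 else 0
  | re a, v => (o (addr (a.eval o v))).re
  | im a, v => (o (addr (a.eval o v))).im
  | sum i b a, v => ∑ k ∈ Finset.range (addr (b.eval o v)), a.eval o (Function.update v i k)

/-- An expression can be evaluated by a machine that keeps the first `r` memory cells. -/
def Compiles (e : Expr) : Prop :=
  ∀ (ρ : ℕ → ℕ) (r : ℕ), (∀ i, ρ i < r) → ∃ T : Machine, ∀ (o : ℕ → ℂ) (x : ℕ → ℝ),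
    ∃ y, T.Runs o x y ∧ y r = e.eval o (fun i => x (ρ i)) ∧ ∀ i < r, y i = x i

theorem compiles_of_machine (a : Expr) (e : Expr) (ha : a.Compiles) (T : ℕ → Machine)
    (hT : ∀ r o x v, x r = a.eval o v →
      (T r).Runs o x (Function.update x r (e.eval o v))) : e.Compiles := by
  intro ρ r hρ
  obtain ⟨T₁, h₁⟩ := ha ρ r hρ
  refine ⟨T₁.seq (T r), fun o x => ?_⟩
  obtain ⟨y, hy, hyr, hyx⟩ := h₁ o x
  refine ⟨_, hy.seq (hT r o y _ hyr), by simp, fun i hi => ?_⟩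
  rw [Function.update_of_ne hi.ne, hyx i hi]

/-- The second operand is compiled with the bound `r + 1`, so its evaluation keeps the first
operand, stored in cell `r`. -/
theorem compiles_of_machine₂ (a b : Expr) (e : Expr) (ha : a.Compiles) (hb : b.Compiles)
    (T : ℕ → Machine)
    (hT : ∀ r o x v, x r = a.eval o v → x (r + 1) = b.eval o v →
      (T r).Runs o x (Function.update x r (e.eval o v))) : e.Compiles := by
  intro ρ r hρ
  obtain ⟨T₁, h₁⟩ := ha ρ r hρ
  obtain ⟨T₂, h₂⟩ := hb ρ (r + 1) fun i => (hρ i).trans (Nat.lt_succ_self r)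
  refine ⟨T₁.seq (T₂.seq (T r)), fun o x => ?_⟩
  obtain ⟨y, hy, hyr, hyx⟩ := h₁ o x
  obtain ⟨z, hz, hzr, hzy⟩ := h₂ o y
  have e1 : (fun i => y (ρ i)) = fun i => x (ρ i) := funext fun i => hyx _ (hρ i)
  rw [e1] at hzr
  refine ⟨_, hy.seq (hz.seq (hT r o z _ ((hzy r (Nat.lt_succ_self r)).trans hyr) hzr)), by simp,
    fun i hi => ?_⟩
  rw [Function.update_of_ne hi.ne, hzy i (by omega), hyx i hi]

/-- Cell `r` holds the bound `B`, `r + 1` the number `k + 1`, `r + 2` the summation variable `k`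
(where `ρ` is redirected), `r + 3` the partial sum, `r + 4` the constant `1`; the summand is
computed in `r + 5`. The loop condition `k + 1 ≤ B` says `k < ⌊B⌋₊`, also for negative `B`. At the
end, adding `0` serves to copy the sum to cell `r`. -/
theorem compiles_sum (i : ℕ) (b a : Expr) (hb : b.Compiles) (ha : a.Compiles) :
    (sum i b a).Compiles := by
  intro ρ r hρ
  obtain ⟨T₁, h₁⟩ := hb ρ r hρ
  obtain ⟨T₂, h₂⟩ := ha (Function.update ρ i (r + 2)) (r + 5) fun j => by
    by_cases hj : j = i
    · subst hj; simp
    · rw [Function.update_of_ne hj]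
      have := hρ j
      omega
  refine ⟨T₁.seq <| (ofInstr (.const (r + 1) 1 none)).seq <|
    (ofInstr (.const (r + 2) 0 none)).seq <| (ofInstr (.const (r + 3) 0 none)).seq <|
    (ofInstr (.const (r + 4) 1 none)).seq <|
    (loop (r + 1) r <| T₂.seq <| (ofInstr (.add (r + 3) (r + 3) (r + 5) none)).seq <|
      (ofInstr (.add (r + 2) (r + 2) (r + 4) none)).seq <|
      (ofInstr (.add (r + 1) (r + 1) (r + 4) none))).seq <|
    (ofInstr (.const (r + 4) 0 none)).seq <| ofInstr (.add r (r + 3) (r + 4) none), fun o x => ?_⟩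
  obtain ⟨y, hy, hyr, hyx⟩ := h₁ o x
  set v : ℕ → ℝ := fun i => x (ρ i) with hv
  set B := b.eval o v
  let P : ℕ → (ℕ → ℝ) → Prop := fun k m =>
    (∀ j < r, m j = x j) ∧ m r = B ∧ m (r + 1) = k + 1 ∧ m (r + 2) = k ∧
    m (r + 3) = ∑ l ∈ Finset.range k, a.eval o (Function.update v i l) ∧ m (r + 4) = 1
  have hloop := loop_runs (o := o) (a := r + 1) (b := r) (T := T₂.seq <|
    (ofInstr (.add (r + 3) (r + 3) (r + 5) none)).seq <|
      (ofInstr (.add (r + 2) (r + 2) (r + 4) none)).seq <|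
      (ofInstr (.add (r + 1) (r + 1) (r + 4) none))) P (n := addr B) (by
      rintro k hk m ⟨h0, hr, hr1, hr2, hr3, hr4⟩
      constructor
      · rw [hr, hr1]
        have := (Nat.le_floor_iff' (a := B) (Nat.succ_ne_zero k)).1 hk
        simpa using this
      · obtain ⟨z, hz, hzr, hzm⟩ := h₂ o m
        refine ⟨_, hz.seq ((ofInstr_add _ _ _ _ _).seq ((ofInstr_add _ _ _ _ _).seq
          (ofInstr_add _ _ _ _ _))), ?_⟩
        have e1 : (fun j => m (Function.update ρ i (r + 2) j)) = Function.update v i k := by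
          funext j
          by_cases hj : j = i
          · subst hj; simp [hr2]
          · simp [Function.update_of_ne hj, hv, h0 _ (hρ j)]
        rw [e1] at hzr
        have z0 : ∀ j < r, z j = x j := fun j hj => (hzm j (by omega)).trans (h0 j hj)
        have zr := (hzm r (by omega)).trans hr
        have zr1 := (hzm (r + 1) (by omega)).trans hr1
        have zr2 := (hzm (r + 2) (by omega)).trans hr2
        have zr3 := (hzm (r + 3) (by omega)).trans hr3
        have zr4 := (hzm (r + 4) (by omega)).trans hr4
        refine ⟨fun j hj => ?_, ?_, ?_, ?_, ?_, ?_⟩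
        · rw [Function.update_of_ne (by omega), Function.update_of_ne (by omega),
            Function.update_of_ne (by omega), z0 j hj]
        all_goals simp [*, Finset.sum_range_succ])
    (by
      rintro m ⟨h0, hr, hr1, -⟩
      rw [hr, hr1, not_le]
      exact Nat.lt_floor_add_one B)
    (x := Function.update (Function.update (Function.update (Function.update y (r + 1) (1 : ℚ))
      (r + 2) (0 : ℚ)) (r + 3) (0 : ℚ)) (r + 4) (1 : ℚ))
    (by
      refine ⟨fun j hj => ?_, ?_, ?_, ?_, ?_, ?_⟩
      · rw [Function.update_of_ne (by omega), Function.update_of_ne (by omega),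
          Function.update_of_ne (by omega), Function.update_of_ne (by omega), hyx j hj]
      all_goals simp [hyr])
  obtain ⟨m, hm, m0, mr, mr1, mr2, mr3, mr4⟩ := hloop
  refine ⟨_, hy.seq <| (ofInstr_const _ _ _ _).seq <| (ofInstr_const _ _ _ _).seq <|
    (ofInstr_const _ _ _ _).seq <| (ofInstr_const _ _ _ _).seq <| hm.seq <|
    (ofInstr_const _ _ _ _).seq <| ofInstr_add _ _ _ _ _, ?_, fun j hj => ?_⟩
  · simp [mr3, eval, B]
  · rw [Function.update_of_ne (by omega), Function.update_of_ne (by omega), m0 j hj]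

theorem compiles : ∀ e : Expr, e.Compiles
  | var i => fun ρ r hρ => by
    refine ⟨(ofInstr (.const r 0 none)).seq (ofInstr (.add r r (ρ i) none)), fun o x =>
      ⟨_, (ofInstr_const _ _ _ _).seq (ofInstr_add _ _ _ _ _), ?_, fun j hj => ?_⟩⟩
    · simp [eval, (hρ i).ne]
    · simp [Function.update_of_ne hj.ne]
  | const c => fun ρ r hρ => by
    refine ⟨ofInstr (.const r c none), fun o x =>
      ⟨_, ofInstr_const _ _ _ _, ?_, fun j hj => ?_⟩⟩
    · simp [eval]
    · simp [Function.update_of_ne hj.ne]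
  | add a b => compiles_of_machine₂ a b _ a.compiles b.compiles
      (fun r => ofInstr (.add r r (r + 1) none)) fun r o x v h h' => ⟨1, by
        simp [step, ofInstr, eval, h, h']⟩
  | sub a b => compiles_of_machine₂ a b _ a.compiles b.compiles
      (fun r => ofInstr (.sub r r (r + 1) none)) fun r o x v h h' => ⟨1, by
        simp [step, ofInstr, eval, h, h']⟩
  | mul a b => compiles_of_machine₂ a b _ a.compiles b.compiles
      (fun r => ofInstr (.mul r r (r + 1) none)) fun r o x v h h' => ⟨1, by
        simp [step, ofInstr, eval, h, h']⟩
  | div a b => compiles_of_machine₂ a b _ a.compiles b.compiles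
      (fun r => ofInstr (.div r r (r + 1) none)) fun r o x v h h' => ⟨1, by
        simp [step, ofInstr, eval, h, h']⟩
  | le a b => compiles_of_machine₂ a b _ a.compiles b.compiles
      (fun r => leTest r r (r + 1)) fun r o x v h h' => by
        have := leTest_runs o r r (r + 1) x
        rwa [h, h'] at this
  | re a => compiles_of_machine a _ a.compiles
      (fun r => ofInstr (.queryRe r r none)) fun r o x v h => ⟨1, by
        simp [step, ofInstr, eval, h]⟩
  | im a => compiles_of_machine a _ a.compiles
      (fun r => ofInstr (.queryIm r r none)) fun r o x v h => ⟨1, by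
        simp [step, ofInstr, eval, h]⟩
  | sum i b a => compiles_sum i b a b.compiles a.compiles

/-- There is a machine that computes the values of an expression in two variables from natural
numbers. -/
theorem exists_machine (e : Expr) : ∃ T : Machine, ∀ (o : ℕ → ℂ) (m n : ℕ),
    T.Outputs o [m, n] (e.eval o fun i => (([m, n].getD i 0 : ℕ) : ℝ)) := by
  -- Variables `0` and `1` sit in the input cells; all others share cell `2`, which initially
  -- contains `0`. Scratch space starts at cell `3`.
  obtain ⟨T, hT⟩ := e.compiles (fun i => if i < 2 then i else 2) 3 fun i => by split_ifs <;> omega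
  refine ⟨T.seq ((ofInstr (.const 0 0 none)).seq (ofInstr (.add 0 0 3 none))), fun o m n => ?_⟩
  obtain ⟨y, hy, hy3, -⟩ := hT o fun i => (([m, n].getD i 0 : ℕ) : ℝ)
  obtain ⟨t, ht⟩ := hy.seq ((ofInstr_const o 0 0 y).seq (ofInstr_add _ _ _ _ _))
  refine ⟨t, ?_, ?_⟩
  · exact congrArg Prod.fst ht
  · refine (congrFun (congrArg Prod.snd ht) 0).trans ?_
    simp only [Rat.cast_zero, Function.update_self, zero_add]
    rw [Function.update_of_ne (by norm_num), hy3]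
    congr 1
    funext i
    rcases i with _ | _ | i <;> simp

end Expr

end SCI

end

/-! ### Machines as general algorithms, and towers from bounded quantifiers -/

noncomputable section

namespace SCI

open Filter Topology

namespace Machine

/-- The oracle indices that are queried in the next step. -/
def queried (T : Machine) (c : T.Config) : Finset ℕ :=
  match c with
  | (none, _) => ∅
  | (some q, x) =>
    match T.instr q with
    | .queryRe _ a _ => {addr (x a)}
    | .queryIm _ a _ => {addr (x a)}
    | _ => ∅

theorem step_congr (T : Machine) {o o' : ℕ → ℂ} (c : T.Config) (h : ∀ k ∈ T.queried c, o' k = o k) :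
    T.step o' c = T.step o c := by
  obtain ⟨_ | q, x⟩ := c
  · rfl
  · simp only [queried] at h
    simp only [step]
    cases hq : T.instr q <;> simp_all

/-- Agreement is needed only on the indices queried in the run with `o`: inductively, the run with
`o'` asks the same questions. -/
theorem iterate_congr (T : Machine) {o o' : ℕ → ℂ} (c : T.Config) {t : ℕ}
    (h : ∀ s < t, ∀ k ∈ T.queried ((T.step o)^[s] c), o' k = o k) :
    ∀ s ≤ t, (T.step o')^[s] c = (T.step o)^[s] c := by
  intro s
  induction s with
  | zero => exact fun _ => rfl
  | succ s ih =>
    intro hs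
    rw [Function.iterate_succ_apply', Function.iterate_succ_apply', ih (by omega)]
    exact step_congr T _ (h s (by omega))

theorem iterate_of_halted (T : Machine) (o : ℕ → ℂ) {c : T.Config} (h : c.1 = none) (s : ℕ) :
    (T.step o)^[s] c = c := by
  obtain ⟨_, x⟩ := c
  obtain rfl := h
  exact Function.iterate_fixed rfl s

theorem Outputs.unique {T : Machine} {o : ℕ → ℂ} {l : List ℕ} {y z : ℝ} (hy : T.Outputs o l y)
    (hz : T.Outputs o l z) : y = z := by
  obtain ⟨t, ht, rfl⟩ := hy
  obtain ⟨s, hs, rfl⟩ := hz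
  rcases le_total t s with h | h
  · obtain ⟨d, rfl⟩ := Nat.exists_eq_add_of_le' h
    rw [Function.iterate_add_apply, iterate_of_halted T o ht]
  · obtain ⟨d, rfl⟩ := Nat.exists_eq_add_of_le' h
    rw [Function.iterate_add_apply, iterate_of_halted T o hs]

end Machine

/-- What a machine computes is a general algorithm: the evaluations that it reads are those that are
queried before it halts. -/
theorem ComputationalProblem.IsRecursive.isGeneralAlgorithm {Ω M : Type}
    {P : ComputationalProblem Ω M} {k : ℕ} {Γ : List ℕ → Ω → M} (h : P.IsRecursive k Γ) (l : List ℕ)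
    (hl : l.length = k) : P.IsGeneralAlgorithm (Γ l) := by
  classical
  obtain ⟨T, hT⟩ := h
  replace hT := hT l hl
  have hhalt : ∀ A, ∃ t, ((T.step fun i => P.eval i A)^[t] (T.init l)).1 = none :=
    fun A => (hT A).imp fun t ht => ht.1
  let τ : Ω → ℕ := fun A => Nat.find (hhalt A)
  -- Inserting `0` only makes the set non-empty, for machines that query nothing.
  refine ⟨fun A => insert 0 ((Finset.range (τ A)).biUnion fun s =>
    T.queried ((T.step fun i => P.eval i A)^[s] (T.init l))), fun A => Finset.insert_nonempty _ _,
    fun A B hAB => ?_⟩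
  have hit : ∀ s ≤ τ A, (T.step fun i => P.eval i B)^[s] (T.init l) =
      (T.step fun i => P.eval i A)^[s] (T.init l) :=
    T.iterate_congr _ fun s hs k hk => hAB k (Finset.mem_insert_of_mem
      (Finset.mem_biUnion.2 ⟨s, Finset.mem_range.2 hs, hk⟩))
  have hτ : τ B = τ A := by
    refine (Nat.find_eq_iff _).2 ⟨?_, fun s hs => ?_⟩
    · rw [hit _ le_rfl]
      exact Nat.find_spec (hhalt A)
    · rw [hit _ hs.le]
      exact Nat.find_min (hhalt A) hs
  constructor
  · have hA := hT A
    have hB : T.Outputs (fun i => P.eval i B) l (P.code (Γ l A)) := by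
      have h1 : T.Outputs (fun i => P.eval i A) l
          (((T.step fun i => P.eval i A)^[τ A] (T.init l)).2 0) :=
        ⟨τ A, Nat.find_spec (hhalt A), rfl⟩
      rw [hA.unique h1]
      refine ⟨τ A, ?_, ?_⟩
      · rw [hit _ le_rfl]
        exact Nat.find_spec (hhalt A)
      · rw [hit _ le_rfl]
    exact P.code_injective ((hT B).unique hB)
  · beta_reduce
    rw [hτ]
    congr 1
    refine Finset.biUnion_congr rfl fun s hs => ?_
    rw [hit s (Finset.mem_range.1 hs).le]

section Tower

variable {Ω M : Type}

/-- If the universal statement fails, a fixed counterexample is seen by every sufficiently large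
bound. -/
theorem eventually_forall_le_iff (p : ℕ → ℕ → Prop) :
    ∀ᶠ n in atTop, (∀ k₁ ≤ n, ∀ k₂ ≤ n, p k₁ k₂) ↔ ∀ k₁ k₂, p k₁ k₂ := by
  by_cases h : ∀ k₁ k₂, p k₁ k₂
  · exact Eventually.of_forall fun n => ⟨fun _ => h, fun _ k₁ _ k₂ _ => h k₁ k₂⟩
  · have h' := h
    push Not at h'
    obtain ⟨k₁, k₂, hk⟩ := h'
    filter_upwards [eventually_ge_atTop k₁, eventually_ge_atTop k₂] with n h1 h2
    exact ⟨fun hn => absurd (hn k₁ h1 k₂ h2) hk, fun h' => absurd h' h⟩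

theorem eventually_exists_le_iff (p : ℕ → ℕ → Prop) :
    ∀ᶠ n in atTop, (∃ k₁ ≤ n, ∃ k₂ ≤ n, p k₁ k₂) ↔ ∃ k₁ k₂, p k₁ k₂ := by
  filter_upwards [eventually_forall_le_iff fun k₁ k₂ => ¬ p k₁ k₂] with n hn
  rw [← not_iff_not]
  push Not
  simpa using hn

/-- A problem whose answer is a function of finitely many properties of the form
`∃ m₁ m₂, ∀ k₁ k₂, R m₁ m₂ k₁ k₂` with mechanically decidable `R` has an arithmetic tower of height
two, obtained by bounding the quantifiers. -/
theorem ComputationalProblem.exists_tower [TopologicalSpace M] (P : ComputationalProblem Ω M)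
    {ι : Type} [Finite ι] (val : (ι → Prop) → M) (R : ι → Ω → ℕ → ℕ → ℕ → ℕ → Prop)
    (hP : ∀ A, P.problem A = val fun j => ∃ m₁ m₂, ∀ k₁ k₂, R j A m₁ m₂ k₁ k₂) (E : Expr)
    (hE : ∀ A m n, E.eval (fun i => P.eval i A) (fun i => (([m, n].getD i 0 : ℕ) : ℝ)) =
      P.code (val fun j => ∃ m₁ ≤ m, ∃ m₂ ≤ m, ∀ k₁ ≤ n, ∀ k₂ ≤ n, R j A m₁ m₂ k₁ k₂)) :
    ∃ Γ : List ℕ → Ω → M, P.IsTower .A 2 Γ ∧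
      ∀ m A, Γ [m] A = val fun j => ∃ m₁ ≤ m, ∃ m₂ ≤ m, ∀ k₁ k₂, R j A m₁ m₂ k₁ k₂ := by
  let Γ : List ℕ → Ω → M := fun l A => match l with
    | [] => P.problem A
    | [m] => val fun j => ∃ m₁ ≤ m, ∃ m₂ ≤ m, ∀ k₁ k₂, R j A m₁ m₂ k₁ k₂
    | m :: n :: _ => val fun j => ∃ m₁ ≤ m, ∃ m₂ ≤ m, ∀ k₁ ≤ n, ∀ k₂ ≤ n, R j A m₁ m₂ k₁ k₂
  have hrec : P.IsRecursive 2 Γ := by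
    obtain ⟨T, hT⟩ := E.exists_machine
    refine ⟨T, fun l hl A => ?_⟩
    obtain ⟨m, n, rfl⟩ := List.length_eq_two.1 hl
    have := hT (fun i => P.eval i A) m n
    rwa [hE] at this
  refine ⟨Γ, ⟨rfl, fun l hl A => ?_, fun l hl => hrec.isGeneralAlgorithm l hl, fun _ => hrec⟩,
    fun m A => rfl⟩
  match l, hl with
  | [], _ =>
    refine tendsto_const_nhds.congr' ?_
    filter_upwards [eventually_all.2 fun j => eventually_exists_le_iff
      fun m₁ m₂ => ∀ k₁ k₂, R j A m₁ m₂ k₁ k₂] with m hm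
    change P.problem A = val _
    rw [hP]
    congr 1
    funext j
    exact propext (hm j).symm
  | [m], _ =>
    refine tendsto_const_nhds.congr' ?_
    have h1 : ∀ j, ∀ m₁ ∈ Set.Iic m, ∀ m₂ ∈ Set.Iic m, ∀ᶠ n in atTop,
        (∀ k₁ ≤ n, ∀ k₂ ≤ n, R j A m₁ m₂ k₁ k₂) ↔ ∀ k₁ k₂, R j A m₁ m₂ k₁ k₂ :=
      fun j m₁ _ m₂ _ => eventually_forall_le_iff _
    -- Only finitely many `j` and `m₁, m₂ ≤ m` occur, so one threshold for `n` serves all of them;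
    -- this needs the outer quantifiers to be bounded already.
    have h2 : ∀ᶠ n in atTop, ∀ j, ∀ m₁ ∈ Set.Iic m, ∀ m₂ ∈ Set.Iic m,
        (∀ k₁ ≤ n, ∀ k₂ ≤ n, R j A m₁ m₂ k₁ k₂) ↔ ∀ k₁ k₂, R j A m₁ m₂ k₁ k₂ :=
      eventually_all.2 fun j => (eventually_all_finite (Set.finite_Iic m)).2 fun m₁ hm₁ =>
        (eventually_all_finite (Set.finite_Iic m)).2 fun m₂ hm₂ => h1 j m₁ hm₁ m₂ hm₂
    filter_upwards [h2] with n hn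
    change val _ = val _
    congr 1
    funext j
    refine propext ⟨?_, ?_⟩
    · rintro ⟨m₁, h₁, m₂, h₂, h⟩
      exact ⟨m₁, h₁, m₂, h₂, (hn j m₁ h₁ m₂ h₂).2 h⟩
    · rintro ⟨m₁, h₁, m₂, h₂, h⟩
      exact ⟨m₁, h₁, m₂, h₂, (hn j m₁ h₁ m₂ h₂).1 h⟩

end Tower

/-! ### Logic inside expressions -/

namespace Expr

instance : Add Expr := ⟨Expr.add⟩
instance : Sub Expr := ⟨Expr.sub⟩
instance : Mul Expr := ⟨Expr.mul⟩
instance : Div Expr := ⟨Expr.div⟩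
instance (n : ℕ) : OfNat Expr n := ⟨Expr.const n⟩

section

variable (o : ℕ → ℂ) (v : ℕ → ℝ)

@[simp] theorem eval_var (i : ℕ) : (var i).eval o v = v i := rfl
@[simp] theorem eval_add (a b : Expr) : (a + b).eval o v = a.eval o v + b.eval o v := rfl
@[simp] theorem eval_sub (a b : Expr) : (a - b).eval o v = a.eval o v - b.eval o v := rfl
@[simp] theorem eval_mul (a b : Expr) : (a * b).eval o v = a.eval o v * b.eval o v := rfl
@[simp] theorem eval_div (a b : Expr) : (a / b).eval o v = a.eval o v / b.eval o v := rfl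

@[simp] theorem eval_ofNat (n : ℕ) [n.AtLeastTwo] :
    (no_index (OfNat.ofNat n : Expr)).eval o v = OfNat.ofNat n := by
  change ((n : ℚ) : ℝ) = _
  rw [Rat.cast_natCast]
  exact Nat.cast_ofNat

@[simp] theorem eval_zero : (0 : Expr).eval o v = 0 := by
  change ((0 : ℕ) : ℚ) = (0 : ℝ)
  simp

@[simp] theorem eval_one : (1 : Expr).eval o v = 1 := by
  change ((1 : ℕ) : ℚ) = (1 : ℝ)
  simp

theorem eval_sum (i : ℕ) (b a : Expr) {n : ℕ} (hb : b.eval o v = n) :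
    (sum i b a).eval o v = ∑ k ∈ Finset.range n, a.eval o (Function.update v i k) := by
  simp [eval, hb, Machine.addr]

/-- Integer part. -/
def floor (a : Expr) : Expr := sum 0 a 1

@[simp] theorem eval_floor (a : Expr) : (floor a).eval o v = ⌊a.eval o v⌋₊ := by
  simp [floor, eval, Machine.addr]

open Classical in
/-- The expression `a` gives the truth value of `p`. -/
def Decides (a : Expr) (p : Prop) : Prop := a.eval o v = if p then 1 else 0

/-- Negation. -/
def not (a : Expr) : Expr := 1 - a

/-- Bounded existential quantification. -/
def ex (i : ℕ) (b a : Expr) : Expr := le 1 (sum i b a)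

/-- Bounded universal quantification. -/
def all (i : ℕ) (b a : Expr) : Expr := not (ex i b (not a))

variable {o v}

theorem Decides.not {a : Expr} {p : Prop} (h : a.Decides o v p) : a.not.Decides o v (¬ p) := by
  unfold Decides Expr.not at *
  by_cases hp : p <;> simp [h, hp]

theorem Decides.and {a b : Expr} {p q : Prop} (h : a.Decides o v p) (h' : b.Decides o v q) :
    (a * b).Decides o v (p ∧ q) := by
  unfold Decides at *
  by_cases hp : p <;> by_cases hq : q <;> simp [h, h', hp, hq]

theorem decides_le (a b : Expr) : (le a b).Decides o v (a.eval o v ≤ b.eval o v) := rfl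

theorem decides_lt (a b : Expr) : (not (le b a)).Decides o v (a.eval o v < b.eval o v) := by
  have := (decides_le (o := o) (v := v) b a).not
  rwa [not_le] at this

/-- A sum of values `0` and `1` is at least `1` exactly if one of them is `1`. -/
theorem Decides.ex {i : ℕ} {b a : Expr} {n : ℕ} {p : ℕ → Prop} (hb : b.eval o v = n)
    (h : ∀ k : ℕ, a.Decides o (Function.update v i k) (p k)) :
    (ex i b a).Decides o v (∃ k < n, p k) := by
  classical
  unfold Decides Expr.ex at *
  have h1 : (le 1 (sum i b a)).eval o v = if (1 : Expr).eval o v ≤ (sum i b a).eval o v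
    then 1 else 0 := rfl
  rw [h1, eval_one, eval_sum o v i b a hb]
  simp only [h]
  have key : (1 : ℝ) ≤ ∑ k ∈ Finset.range n, (if p k then 1 else 0) ↔ ∃ k < n, p k := by
    constructor
    · intro h
      by_contra! hn
      rw [Finset.sum_eq_zero fun k hk => if_neg (hn k (Finset.mem_range.1 hk))] at h
      norm_num at h
    · rintro ⟨k, hk, hp⟩
      refine le_trans (by simp [hp]) (Finset.single_le_sum
        (f := fun k => if p k then (1 : ℝ) else 0)
        (fun j _ => by split_ifs <;> norm_num) (Finset.mem_range.2 hk))
  by_cases hp : ∃ k < n, p k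
  · rw [if_pos (key.2 hp), if_pos hp]
  · rw [if_neg (fun h => hp (key.1 h)), if_neg hp]

theorem Decides.all {i : ℕ} {b a : Expr} {n : ℕ} {p : ℕ → Prop} (hb : b.eval o v = n)
    (h : ∀ k : ℕ, a.Decides o (Function.update v i k) (p k)) :
    (all i b a).Decides o v (∀ k < n, p k) := by
  have := (Decides.ex hb fun k => (h k).not).not
  push Not at this
  exact this

/-- `∃ v₂, v₃ ≤ v₀, ∀ v₄, v₅ ≤ v₁, a`. -/
def bounded (a : Expr) : Expr :=
  ex 2 (var 0 + 1) (ex 3 (var 0 + 1) (all 4 (var 1 + 1) (all 5 (var 1 + 1) a)))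

theorem Decides.bounded {a : Expr} {p : ℕ → ℕ → ℕ → ℕ → Prop}
    (h : ∀ v : ℕ → ℝ, ∀ m₁ m₂ k₁ k₂ : ℕ, v 2 = m₁ → v 3 = m₂ → v 4 = k₁ → v 5 = k₂ →
      a.Decides o v (p m₁ m₂ k₁ k₂)) {m n : ℕ} (hm : v 0 = m) (hn : v 1 = n) :
    a.bounded.Decides o v (∃ m₁ ≤ m, ∃ m₂ ≤ m, ∀ k₁ ≤ n, ∀ k₂ ≤ n, p m₁ m₂ k₁ k₂) := by
  have : a.bounded.Decides o v (∃ m₁ < m + 1, ∃ m₂ < m + 1, ∀ k₁ < n + 1, ∀ k₂ < n + 1,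
      p m₁ m₂ k₁ k₂) := by
    refine Decides.ex (by simp [hm]) fun m₁ => Decides.ex (by simp [hm]) fun m₂ =>
      Decides.all (by simp [hn]) fun k₁ => Decides.all (by simp [hn]) fun k₂ => ?_
    refine h _ _ _ _ _ ?_ ?_ ?_ ?_ <;> simp
  simpa only [Nat.lt_succ_iff] using this

end

end Expr

end SCI

end

/-! ### Spectrum and quadratic form of self-adjoint operators -/

noncomputable section

namespace SCI

open Filter Topology

namespace Op

open ComplexConjugate

variable {A : Op}

/-- The quadratic form `⟨A x, x⟩`. -/
def form (A : Op) (x : A.domain) : ℝ := (inner ℂ (x : Hilb) (A x)).re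

theorem inner_map_eq (hA : IsSelfAdjoint A) (x y : A.domain) :
    inner ℂ (A x) (y : Hilb) = inner ℂ (x : Hilb) (A y) := by
  have h := LinearPMap.adjoint_isFormalAdjoint hA.dense_domain
  rw [LinearPMap.isSelfAdjoint_def.1 hA] at h
  exact h x y

/-- The domain of the adjoint contains every vector that satisfies the formal relation, and
self-adjointness identifies it with the domain of `A`. Vectors orthogonal to a range are recognised
as eigenvectors in this way. -/
theorem exists_map_eq (hA : IsSelfAdjoint A) {v w : Hilb}
    (h : ∀ x : A.domain, inner ℂ w (x : Hilb) = inner ℂ v (A x)) :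
    ∃ x : A.domain, (x : Hilb) = v ∧ A x = w := by
  have h1 : ∃ x : A.adjoint.domain, (x : Hilb) = v ∧ A.adjoint x = w :=
    ⟨⟨v, LinearPMap.mem_adjoint_domain_of_exists v ⟨w, h⟩⟩, rfl,
      LinearPMap.adjoint_apply_eq hA.dense_domain _ h⟩
  rwa [LinearPMap.isSelfAdjoint_def.1 hA] at h1

theorem exists_map_eq_of_tendsto (hA : IsSelfAdjoint A) {x : ℕ → A.domain} {v w : Hilb}
    (hv : Tendsto (fun n => (x n : Hilb)) atTop (𝓝 v)) (hw : Tendsto (fun n => A (x n)) atTop (𝓝 w)) :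
    ∃ x : A.domain, (x : Hilb) = v ∧ A x = w := by
  have h : (v, w) ∈ (A.graph : Set (Hilb × Hilb)) :=
    IsClosed.mem_of_tendsto hA.isClosed (hv.prodMk_nhds hw)
      (Eventually.of_forall fun n => LinearPMap.mem_graph A (x n))
  obtain ⟨y, h1, h2⟩ := (LinearPMap.mem_graph_iff A).1 h
  exact ⟨y, h1, h2⟩

theorem inner_map_self_im (hA : IsSelfAdjoint A) (x : A.domain) :
    (inner ℂ (x : Hilb) (A x)).im = 0 := by
  have h := inner_map_eq hA x x
  rw [← inner_conj_symm] at h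
  exact Complex.conj_eq_iff_im.1 h

theorem inner_map_self (hA : IsSelfAdjoint A) (x : A.domain) :
    inner ℂ (x : Hilb) (A x) = (A.form x : ℂ) :=
  Complex.ext rfl (inner_map_self_im hA x)

theorem normSq_map_sub (A : Op) (x : A.domain) (c : ℝ) :
    ‖A x - (c : ℂ) • (x : Hilb)‖ ^ 2 = ‖A x‖ ^ 2 - 2 * c * A.form x + c ^ 2 * ‖(x : Hilb)‖ ^ 2 := by
  rw [norm_sub_sq (𝕜 := ℂ), inner_smul_right, ← inner_conj_symm, norm_smul, form]
  simp only [RCLike.re_to_complex, Complex.re_ofReal_mul, Complex.conj_re, Complex.norm_real,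
    Real.norm_eq_abs, mul_pow, sq_abs]
  ring

/-- The lower bound makes `A - z` injective and, the graph being closed, its range closed. A vector
orthogonal to the range is an eigenvector for `conj z`, which `h'` excludes. So `A - z` is bijective
with inverse bounded by `ε⁻¹`. -/
theorem notMem_spectrum_of_le {z : ℂ} (hA : IsSelfAdjoint A) {ε : ℝ} (hε : 0 < ε)
    (h : ∀ x : A.domain, ε * ‖(x : Hilb)‖ ≤ ‖A x - z • (x : Hilb)‖)
    (h' : ∀ x : A.domain, A x = conj z • (x : Hilb) → (x : Hilb) = 0) : z ∉ A.spectrum := by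
  have hsub : ∀ x, A.subScalar z x = A x - z • (x : Hilb) := fun x => rfl
  have hperp : (LinearMap.range (A.subScalar z))ᗮ = ⊥ := by
    rw [Submodule.eq_bot_iff]
    intro v hv
    obtain ⟨x, rfl, hx⟩ := exists_map_eq hA (v := v) (w := conj z • v) fun x => by
      have := Submodule.inner_left_of_mem_orthogonal (LinearMap.mem_range_self (A.subScalar z) x) hv
      rw [hsub, inner_sub_right, inner_smul_right, sub_eq_zero] at this
      rw [inner_smul_left, this]
      simp
    exact h' x hx
  have hclosed : IsClosed ((LinearMap.range (A.subScalar z) : Submodule ℂ Hilb) : Set Hilb) := by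
    refine IsSeqClosed.isClosed fun y y₀ hy hy₀ => ?_
    choose x hx using hy
    have hdist : ∀ m n, ε * dist (x m : Hilb) (x n) ≤ dist (y m) (y n) := by
      intro m n
      rw [dist_eq_norm, dist_eq_norm, ← hx, ← hx, ← map_sub]
      exact h (x m - x n)
    have hc : CauchySeq fun n => (x n : Hilb) := by
      have := hy₀.cauchySeq
      rw [Metric.cauchySeq_iff] at this ⊢
      intro δ hδ
      obtain ⟨N, hN⟩ := this (ε * δ) (mul_pos hε hδ)
      exact ⟨N, fun m hm n hn => lt_of_mul_lt_mul_left ((hdist m n).trans_lt (hN m hm n hn)) hε.le⟩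
    obtain ⟨x₀, hx₀⟩ := cauchySeq_tendsto_of_complete hc
    have hAx : Tendsto (fun n => A (x n)) atTop (𝓝 (y₀ + z • x₀)) := by
      refine (hy₀.add (hx₀.const_smul z)).congr fun n => ?_
      rw [← hx, hsub]
      simp
    obtain ⟨w, hw1, hw2⟩ := exists_map_eq_of_tendsto hA hx₀ hAx
    exact ⟨w, by rw [hsub, hw1, hw2]; simp⟩
  have htop : LinearMap.range (A.subScalar z) = ⊤ := by
    rw [← hclosed.submodule_topologicalClosure_eq]
    exact (Submodule.topologicalClosure_eq_top_iff).2 hperp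
  have hinj : Function.Injective (A.subScalar z) := by
    rw [← LinearMap.ker_eq_bot, LinearMap.ker_eq_bot']
    intro x hx
    have := h x
    rw [← hsub, hx, norm_zero] at this
    exact Subtype.ext (norm_le_zero_iff.1 (by nlinarith [norm_nonneg (x : Hilb)]))
  let e := LinearEquiv.ofBijective (A.subScalar z) ⟨hinj, LinearMap.range_eq_top.1 htop⟩
  let R : Hilb →L[ℂ] Hilb := (A.domain.subtype ∘ₗ e.symm.toLinearMap).mkContinuous ε⁻¹ fun y => by
    have := h (e.symm y)
    rw [← hsub] at this
    have h2 : A.subScalar z (e.symm y) = y := e.apply_symm_apply y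
    rw [h2] at this
    rw [inv_mul_eq_div, le_div_iff₀' hε]
    exact this
  have hR : ∀ y, R y = (e.symm y : Hilb) := fun y => rfl
  refine fun hz => hz ⟨R, fun y => ⟨(e.symm y).2, ?_⟩, fun x => ?_⟩
  · exact e.apply_symm_apply y
  · rw [hR, ← hsub]
    exact congrArg Subtype.val (e.symm_apply_apply x)

theorem notMem_spectrum_of_le_real (hA : IsSelfAdjoint A) {c ε : ℝ} (hε : 0 < ε)
    (h : ∀ x : A.domain, ε * ‖(x : Hilb)‖ ≤ ‖A x - (c : ℂ) • (x : Hilb)‖) :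
    (c : ℂ) ∉ A.spectrum := by
  refine notMem_spectrum_of_le hA hε h fun x hx => ?_
  have := h x
  rw [hx, Complex.conj_ofReal, sub_self, norm_zero] at this
  exact norm_le_zero_iff.1 (by nlinarith [norm_nonneg (x : Hilb)])

/-- The imaginary part of `⟨x, (A - w) x⟩` is `-Im w ‖x‖²`, which bounds `A - w` from below; this is
used for `w = z` and `w = conj z`. -/
theorem im_eq_zero_of_mem_spectrum (hA : IsSelfAdjoint A) {z : ℂ} (hz : z ∈ A.spectrum) :
    z.im = 0 := by
  by_contra hne
  have key : ∀ w : ℂ, ∀ x : A.domain, |w.im| * ‖(x : Hilb)‖ ≤ ‖A x - w • (x : Hilb)‖ := by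
    intro w x
    have h1 : inner ℂ (x : Hilb) (A x - w • (x : Hilb)) =
        (A.form x : ℂ) - w * ((‖(x : Hilb)‖ ^ 2 : ℝ) : ℂ) := by
      rw [inner_sub_right, inner_map_self hA, inner_smul_right, inner_self_eq_norm_sq_to_K]
      simp
    have h2 : |w.im| * ‖(x : Hilb)‖ ^ 2 ≤ ‖(x : Hilb)‖ * ‖A x - w • (x : Hilb)‖ := by
      refine le_trans ?_ (norm_inner_le_norm (𝕜 := ℂ) _ _)
      refine le_trans ?_ (Complex.abs_im_le_norm _)
      rw [h1, Complex.sub_im, Complex.ofReal_im, Complex.im_mul_ofReal, zero_sub, abs_neg, abs_mul,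
        abs_of_nonneg (sq_nonneg ‖(x : Hilb)‖)]
    rcases (norm_nonneg (x : Hilb)).eq_or_lt with h0 | h0
    · rw [← h0, mul_zero]
      exact norm_nonneg _
    · refine le_of_mul_le_mul_left ?_ h0
      linarith
  refine notMem_spectrum_of_le hA (abs_pos.2 hne) (key z) (fun x hx => ?_) hz
  have := key (conj z) x
  rw [hx, sub_self, norm_zero, Complex.conj_im, abs_neg] at this
  exact norm_le_zero_iff.1 (by nlinarith [norm_nonneg (x : Hilb), abs_pos.2 hne])

theorem exists_resolvent {z : ℂ} (hz : z ∉ A.spectrum) : ∃ R : Hilb →L[ℂ] Hilb,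
    (∀ y, ∃ x : A.domain, (x : Hilb) = R y ∧ A x - z • (x : Hilb) = y) ∧
    ∀ x : A.domain, R (A x - z • (x : Hilb)) = x := by
  rw [spectrum, Set.notMem_compl_iff] at hz
  obtain ⟨R, h1, h2⟩ := hz
  exact ⟨R, fun y => let ⟨h, h'⟩ := h1 y; ⟨⟨R y, h⟩, rfl, h'⟩, h2⟩

theorem isSelfAdjoint_resolvent (hA : IsSelfAdjoint A) {c : ℝ} {R : Hilb →L[ℂ] Hilb}
    (hR : ∀ y, ∃ x : A.domain, (x : Hilb) = R y ∧ A x - (c : ℂ) • (x : Hilb) = y) :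
    IsSelfAdjoint R := by
  rw [ContinuousLinearMap.isSelfAdjoint_iff_isSymmetric]
  intro y y'
  obtain ⟨x, h1, h2⟩ := hR y
  obtain ⟨x', h1', h2'⟩ := hR y'
  change inner ℂ (R y) y' = inner ℂ y (R y')
  rw [← h1, ← h1']
  nth_rewrite 1 [← h2']
  rw [← h2, inner_sub_left, inner_sub_right, inner_map_eq hA, inner_smul_left, inner_smul_right]
  simp

/-- If the interval `(c - d, c + d)` does not meet the spectrum, then `‖(A - c) x‖ ≥ d ‖x‖`. -/
theorem le_norm_map_sub (hA : IsSelfAdjoint A) {c d : ℝ} (hd : 0 < d)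
    (h : ∀ t : ℝ, |t - c| < d → (t : ℂ) ∉ A.spectrum) (x : A.domain) :
    d * ‖(x : Hilb)‖ ≤ ‖A x - (c : ℂ) • (x : Hilb)‖ := by
  obtain ⟨R, hR1, hR2⟩ := exists_resolvent (h c (by simpa using hd))
  have hsa := isSelfAdjoint_resolvent hA hR1
  have hnorm : ‖R‖ ≤ d⁻¹ := by
    -- A spectral value `m` of `R = (A - c)⁻¹` with `|m| > d⁻¹` would correspond to the point `c +
    -- m⁻¹` at distance less than `d` from `c`, where `A` has a resolvent `S`.
    have h1 : spectralRadius ℂ R ≤ ENNReal.ofReal d⁻¹ := by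
      refine iSup₂_le fun μ hμ => ?_
      rw [← enorm_eq_nnnorm, ← ofReal_norm]
      refine ENNReal.ofReal_le_ofReal ?_
      by_contra! hlt
      obtain ⟨m, rfl⟩ : ∃ m : ℝ, μ = m := ⟨μ.re, hsa.mem_spectrum_eq_re hμ⟩
      rw [Complex.norm_real, Real.norm_eq_abs] at hlt
      have hm : 0 < |m| := (inv_pos.2 hd).trans hlt
      have hm0 : m ≠ 0 := abs_pos.1 hm
      have hmc : (m : ℂ) ≠ 0 := Complex.ofReal_ne_zero.2 hm0
      obtain ⟨S, hS1, hS2⟩ := exists_resolvent (h (c + m⁻¹) (by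
        rw [add_sub_cancel_left, abs_inv]
        exact inv_lt_of_inv_lt₀ hd hlt))
      refine hμ ?_
      -- With `T = A - c`, the inverse of `m - T⁻¹` is `m⁻¹ T (T - m⁻¹)⁻¹ = m⁻¹ (1 + m⁻¹ S)`.
      let V : Hilb →L[ℂ] Hilb := (m : ℂ)⁻¹ • (ContinuousLinearMap.id ℂ Hilb + (m : ℂ)⁻¹ • S)
      have hV : ∀ y, V y = (m : ℂ)⁻¹ • (y + (m : ℂ)⁻¹ • S y) := fun y => rfl
      have hM : ∀ y, (algebraMap ℂ (Hilb →L[ℂ] Hilb) (m : ℂ) - R) y = (m : ℂ) • y - R y :=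
        fun y => rfl
      refine ⟨⟨algebraMap ℂ (Hilb →L[ℂ] Hilb) (m : ℂ) - R, V, ?_, ?_⟩, rfl⟩
      · ext1 y
        change (algebraMap ℂ (Hilb →L[ℂ] Hilb) (m : ℂ) - R) (V y) = y
        obtain ⟨x, hx1, hx2⟩ := hS1 y
        have h3 : y + (m : ℂ)⁻¹ • (x : Hilb) = A x - (c : ℂ) • (x : Hilb) := by
          rw [← hx2]
          push_cast
          module
        rw [hM, hV, ← hx1, map_smul, h3, hR2, ← h3, smul_smul, mul_inv_cancel₀ hmc]
        module
      · ext1 y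
        change V ((algebraMap ℂ (Hilb →L[ℂ] Hilb) (m : ℂ) - R) y) = y
        obtain ⟨x, hx1, hx2⟩ := hR1 y
        have h3 : (m : ℂ) • y - (x : Hilb) =
            (m : ℂ) • (A x - ((c + m⁻¹ : ℝ) : ℂ) • (x : Hilb)) := by
          have h4 : A x - ((c + m⁻¹ : ℝ) : ℂ) • (x : Hilb) = y - (m : ℂ)⁻¹ • (x : Hilb) := by
            rw [← hx2]
            push_cast
            module
          rw [h4, smul_sub, smul_smul, mul_inv_cancel₀ hmc, one_smul]
        have h5 : S ((m : ℂ) • y - (x : Hilb)) = (m : ℂ) • (x : Hilb) := by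
          rw [h3, map_smul, hS2]
        rw [hM, hV, ← hx1, h5, smul_smul, inv_mul_cancel₀ hmc, one_smul, sub_add_cancel, smul_smul,
          inv_mul_cancel₀ hmc, one_smul]
    rw [hsa.spectralRadius_eq_nnnorm] at h1
    have h2 : ENNReal.ofReal ‖R‖ ≤ ENNReal.ofReal d⁻¹ := by
      rwa [ofReal_norm, enorm_eq_nnnorm]
    exact (ENNReal.ofReal_le_ofReal_iff (inv_pos.2 hd).le).1 h2
  have h1 := R.le_opNorm (A x - (c : ℂ) • (x : Hilb))
  rw [hR2] at h1
  have h2 : ‖(x : Hilb)‖ ≤ d⁻¹ * ‖A x - (c : ℂ) • (x : Hilb)‖ :=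
    h1.trans (mul_le_mul_of_nonneg_right hnorm (norm_nonneg _))
  rw [inv_mul_eq_div, le_div_iff₀' hd] at h2
  exact h2

/-- Converse to `le_norm_map_sub`, by the triangle inequality. -/
theorem notMem_spectrum_of_abs_sub_lt (hA : IsSelfAdjoint A) {c d : ℝ}
    (h : ∀ x : A.domain, d * ‖(x : Hilb)‖ ≤ ‖A x - (c : ℂ) • (x : Hilb)‖) {t : ℝ}
    (ht : |t - c| < d) : (t : ℂ) ∉ A.spectrum := by
  refine notMem_spectrum_of_le_real hA (sub_pos.2 ht) fun x => ?_
  have h1 : A x - (c : ℂ) • (x : Hilb) = (A x - (t : ℂ) • (x : Hilb)) + ((t - c : ℝ) : ℂ) • (x : Hilb) := by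
    push_cast
    module
  have h2 := norm_add_le (A x - (t : ℂ) • (x : Hilb)) (((t - c : ℝ) : ℂ) • (x : Hilb))
  rw [← h1, norm_smul, Complex.norm_real, Real.norm_eq_abs] at h2
  linarith [h x]

/-- The real points of the spectrum. -/
def realSpectrum (A : Op) : Set ℝ := {x | (x : ℂ) ∈ A.spectrum}

theorem exists_le_norm_map_sub {c : ℝ} (hc : c ∉ A.realSpectrum) :
    ∃ d > 0, ∀ x : A.domain, d * ‖(x : Hilb)‖ ≤ ‖A x - (c : ℂ) • (x : Hilb)‖ := by
  obtain ⟨R, -, hR⟩ := exists_resolvent hc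
  have hpos : 0 < ‖R‖ + 1 := by positivity
  refine ⟨(‖R‖ + 1)⁻¹, inv_pos.2 hpos, fun x => ?_⟩
  rw [inv_mul_eq_div, div_le_iff₀' hpos]
  nth_rewrite 1 [← hR x]
  exact (R.le_opNorm _).trans (mul_le_mul_of_nonneg_right (by linarith) (norm_nonneg _))

theorem isClosed_realSpectrum (hA : IsSelfAdjoint A) : IsClosed A.realSpectrum := by
  rw [← isOpen_compl_iff, Metric.isOpen_iff]
  intro c hc
  obtain ⟨d, hd, h⟩ := exists_le_norm_map_sub hc
  exact ⟨d, hd, fun t ht => notMem_spectrum_of_abs_sub_lt hA h ht⟩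

theorem le_of_mem_realSpectrum (hA : IsSelfAdjoint A) {q : ℝ}
    (h : ∀ x : A.domain, q * ‖(x : Hilb)‖ ^ 2 ≤ A.form x) {t : ℝ} (ht : t ∈ A.realSpectrum) :
    q ≤ t := by
  by_contra! hlt
  refine notMem_spectrum_of_le_real hA (sub_pos.2 hlt) (fun x => ?_) ht
  have h1 : (q - t) * ‖(x : Hilb)‖ ^ 2 ≤ ‖(x : Hilb)‖ * ‖A x - (t : ℂ) • (x : Hilb)‖ := by
    refine le_trans ?_ (norm_inner_le_norm (𝕜 := ℂ) _ _)
    refine le_trans ?_ (Complex.re_le_norm _)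
    have h2 : inner ℂ (x : Hilb) (A x - (t : ℂ) • (x : Hilb)) =
        ((A.form x - t * ‖(x : Hilb)‖ ^ 2 : ℝ) : ℂ) := by
      rw [inner_sub_right, inner_map_self hA, inner_smul_right, inner_self_eq_norm_sq_to_K]
      simp
    rw [h2, Complex.ofReal_re]
    linarith [h x]
  rcases (norm_nonneg (x : Hilb)).eq_or_lt with h0 | h0
  · rw [← h0, mul_zero]
    exact norm_nonneg _
  · refine le_of_mul_le_mul_left ?_ h0
    linarith

/-- For every `d > 0` the point `q - d` has distance at least `d` from the spectrum. Squaring `d ‖x‖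
≤ ‖(A - q + d) x‖`, the terms `d² ‖x‖²` cancel and an inequality affine in `d` remains; letting `d`
be large fixes the sign of its slope. -/
theorem le_form (hA : IsSelfAdjoint A) {q : ℝ} (h : ∀ t ∈ A.realSpectrum, q ≤ t) (x : A.domain) :
    q * ‖(x : Hilb)‖ ^ 2 ≤ A.form x := by
  have key : ∀ d > 0, 0 ≤ ‖A x - (q : ℂ) • (x : Hilb)‖ ^ 2 +
      2 * d * (A.form x - q * ‖(x : Hilb)‖ ^ 2) := by
    intro d hd
    have h1 := le_norm_map_sub hA (c := q - d) hd (fun t ht hm => by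
      have := h t hm
      rw [abs_lt] at ht
      linarith [ht.2]) x
    have h2 := pow_le_pow_left₀ (by positivity) h1 2
    rw [normSq_map_sub] at h2 ⊢
    nlinarith
  by_contra! hlt
  set g := q * ‖(x : Hilb)‖ ^ 2 - A.form x with hg
  have hgpos : 0 < g := by linarith
  set m := ‖A x - (q : ℂ) • (x : Hilb)‖ ^ 2 with hm
  have hm0 : 0 ≤ m := sq_nonneg _
  have := key ((m + 1) / g) (by positivity)
  have h3 : 2 * ((m + 1) / g) * (A.form x - q * ‖(x : Hilb)‖ ^ 2) = -2 * (m + 1) := by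
    have : A.form x - q * ‖(x : Hilb)‖ ^ 2 = -g := by rw [hg]; ring
    rw [this]
    field_simp
  linarith

/-- With empty spectrum, `le_norm_map_sub` would hold for every `d`, so the dense domain would
consist of `0` only. -/
theorem nonempty_realSpectrum (hA : IsSelfAdjoint A) : A.realSpectrum.Nonempty := by
  by_contra hne
  rw [Set.not_nonempty_iff_eq_empty] at hne
  have hzero : ∀ x : A.domain, (x : Hilb) = 0 := by
    intro x
    by_contra hx
    have hx' : 0 < ‖(x : Hilb)‖ := norm_pos_iff.2 hx
    have h1 := le_norm_map_sub hA (c := 0) (d := (‖A x‖ + 1) / ‖(x : Hilb)‖) (by positivity)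
      (fun t _ (ht : t ∈ A.realSpectrum) => by simp [hne] at ht) x
    rw [div_mul_cancel₀ _ hx'.ne'] at h1
    simp at h1
    linarith
  have h2 : A.domain = ⊥ := (Submodule.eq_bot_iff _).2 fun x hx => hzero ⟨x, hx⟩
  have h3 := hA.dense_domain
  rw [h2] at h3
  have h4 : e 0 ∈ closure ((⊥ : Submodule ℂ Hilb) : Set Hilb) := h3 (e 0)
  simp only [Submodule.bot_coe, closure_singleton, Set.mem_singleton_iff] at h4
  have h5 : ‖e 0‖ = 1 := by
    rw [e, lp.norm_single (by norm_num)]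
    simp
  rw [h4, norm_zero] at h5
  norm_num at h5

theorem IsAdmissible.isLeast_bottom (hA : A.IsAdmissible) : IsLeast A.realSpectrum A.bottom := by
  obtain ⟨m, hm⟩ := hA.boundedBelow
  have hbdd : BddBelow A.realSpectrum := ⟨m, fun t ht => le_of_mem_realSpectrum hA.selfAdjoint hm ht⟩
  exact ⟨(isClosed_realSpectrum hA.selfAdjoint).csInf_mem (nonempty_realSpectrum hA.selfAdjoint) hbdd,
    fun t ht => csInf_le hbdd ht⟩

/-- The variational principle: an upper bound on the bottom is witnessed by a single vector, hence
semi-decidable from the matrix. -/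
theorem IsAdmissible.bottom_lt_iff (hA : A.IsAdmissible) (q : ℝ) :
    A.bottom < q ↔ ∃ x : A.domain, A.form x < q * ‖(x : Hilb)‖ ^ 2 := by
  constructor
  · intro h
    by_contra! hn
    exact absurd (le_of_mem_realSpectrum hA.selfAdjoint hn hA.isLeast_bottom.1) (not_le.2 h)
  · rintro ⟨x, hx⟩
    by_contra! hn
    exact absurd (le_form hA.selfAdjoint (fun t ht => hn.trans (hA.isLeast_bottom.2 ht)) x)
      (not_le.2 hx)

theorem form_sub (hA : IsSelfAdjoint A) (x y : A.domain) :
    A.form (x - y) = A.form x - 2 * (inner ℂ (A x) (y : Hilb)).re + A.form y := by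
  have h1 : inner ℂ ((x - y : A.domain) : Hilb) (A (x - y)) = inner ℂ (x : Hilb) (A x) -
      inner ℂ (x : Hilb) (A y) - inner ℂ (y : Hilb) (A x) + inner ℂ (y : Hilb) (A y) := by
    rw [LinearPMap.map_sub, Submodule.coe_sub, inner_sub_left, inner_sub_right, inner_sub_right]
    ring
  have h2 : (inner ℂ (y : Hilb) (A x)).re = (inner ℂ (A x) (y : Hilb)).re := by
    rw [← inner_conj_symm, Complex.conj_re]
  rw [form, h1, ← inner_map_eq hA x y]
  simp only [Complex.add_re, Complex.sub_re, h2, form]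
  ring

theorem tendsto_form {x : ℕ → A.domain} {x₀ : A.domain}
    (h : Tendsto (fun n => (x n : Hilb)) atTop (𝓝 (x₀ : Hilb)))
    (h' : Tendsto (fun n => A (x n)) atTop (𝓝 (A x₀))) :
    Tendsto (fun n => A.form (x n)) atTop (𝓝 (A.form x₀)) :=
  (Complex.continuous_re.tendsto _).comp (h.inner h')

/-- If there is no spectrum between the bottom `a` and `q`, then the form is at least `q` on the
orthogonal complement of `ker (A - a)`. -/
theorem IsAdmissible.le_form_of_gap (hA : A.IsAdmissible) {q : ℝ} (hq : A.bottom < q)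
    (hgap : ∀ t ∈ A.realSpectrum, t < q → t = A.bottom) {v : A.domain}
    (hv : ∀ n : A.domain, A n = (A.bottom : ℂ) • (n : Hilb) → inner ℂ (n : Hilb) (v : Hilb) = 0) :
    q * ‖(v : Hilb)‖ ^ 2 ≤ A.form v := by
  have hs := hA.selfAdjoint
  set a := A.bottom with ha
  set g := q - a with hg
  have hg0 : 0 < g := sub_pos.2 hq
  have hform : ∀ x : A.domain, a * ‖(x : Hilb)‖ ^ 2 ≤ A.form x :=
    le_form hs fun t ht => hA.isLeast_bottom.2 ht
  -- The open interval with endpoints `a` and `q` is free of spectrum. The norm bound at its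
  -- midpoint expands to `(A - a)(A - q) ≥ 0`, that is, `(A - a)² ≥ g (A - a)`.
  have hsq : ∀ x : A.domain, g * (A.form x - a * ‖(x : Hilb)‖ ^ 2) ≤
      ‖A x - (a : ℂ) • (x : Hilb)‖ ^ 2 := by
    intro x
    have h1 := le_norm_map_sub hs (c := (a + q) / 2) (d := (q - a) / 2) (by linarith) (fun t ht hm => by
      rw [abs_lt] at ht
      have := hgap t hm (by linarith [ht.2])
      rw [this] at ht
      linarith [ht.1]) x
    have h2 := pow_le_pow_left₀ (by positivity) h1 2
    rw [normSq_map_sub] at h2 ⊢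
    nlinarith
  -- On the range of `A - a`: for `v = (A - a) w`, positivity of `A - a` at `g⁻¹ v - w` combined
  -- with `hsq` for `w` gives the bound, without square roots of operators.
  have hrange : ∀ w v : A.domain, (v : Hilb) = A w - (a : ℂ) • (w : Hilb) →
      q * ‖(v : Hilb)‖ ^ 2 ≤ A.form v := by
    intro w v hvw
    have h1 := hsq w
    rw [← hvw] at h1
    have h2 := hform (((g⁻¹ : ℝ) : ℂ) • v - w)
    have h3 : A.form (((g⁻¹ : ℝ) : ℂ) • v - w) = g⁻¹ ^ 2 * A.form v -
        2 * g⁻¹ * (inner ℂ (v : Hilb) (A w)).re + A.form w := by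
      rw [form_sub hs, inner_map_eq hs, form, LinearPMap.map_smul, Submodule.coe_smul,
        inner_smul_left, inner_smul_right, inner_smul_left, Complex.conj_ofReal,
        Complex.re_ofReal_mul, Complex.re_ofReal_mul, Complex.re_ofReal_mul]
      simp only [form]
      ring
    have h4 : ‖((((g⁻¹ : ℝ) : ℂ) • v - w : A.domain) : Hilb)‖ ^ 2 = g⁻¹ ^ 2 * ‖(v : Hilb)‖ ^ 2 -
        2 * g⁻¹ * (inner ℂ (v : Hilb) (w : Hilb)).re + ‖(w : Hilb)‖ ^ 2 := by
      rw [Submodule.coe_sub, Submodule.coe_smul, norm_sub_sq (𝕜 := ℂ), inner_smul_left,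
        Complex.conj_ofReal, norm_smul, Complex.norm_real, mul_pow, Real.norm_eq_abs, sq_abs]
      simp only [RCLike.re_to_complex, Complex.re_ofReal_mul]
      ring
    have h5 : (inner ℂ (v : Hilb) (A w)).re =
        ‖(v : Hilb)‖ ^ 2 + a * (inner ℂ (v : Hilb) (w : Hilb)).re := by
      have : A w = (v : Hilb) + (a : ℂ) • (w : Hilb) := by rw [hvw]; simp
      rw [this, inner_add_right, inner_smul_right, Complex.add_re, Complex.re_ofReal_mul,
        inner_self_eq_norm_sq_to_K]
      congr 1
      norm_cast
    rw [h3, h4, h5] at h2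
    have h6 : g * g⁻¹ = 1 := mul_inv_cancel₀ hg0.ne'
    have h7 : A.form w - a * ‖(w : Hilb)‖ ^ 2 ≤ g⁻¹ * ‖(v : Hilb)‖ ^ 2 := by
      rw [inv_mul_eq_div, le_div_iff₀' hg0]
      exact h1
    have h8 : 0 ≤ g⁻¹ ^ 2 * (A.form v - a * ‖(v : Hilb)‖ ^ 2) - g⁻¹ * ‖(v : Hilb)‖ ^ 2 := by
      linarith
    have h9 : 0 ≤ g ^ 2 * (g⁻¹ ^ 2 * (A.form v - a * ‖(v : Hilb)‖ ^ 2) - g⁻¹ * ‖(v : Hilb)‖ ^ 2) :=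
      mul_nonneg (sq_nonneg _) h8
    have h10 : g ^ 2 * (g⁻¹ ^ 2 * (A.form v - a * ‖(v : Hilb)‖ ^ 2) - g⁻¹ * ‖(v : Hilb)‖ ^ 2) =
        A.form v - a * ‖(v : Hilb)‖ ^ 2 - g * ‖(v : Hilb)‖ ^ 2 := by
      field_simp
    rw [h10, hg] at h9
    linarith
  -- The resolvent at `z = a - 1` turns convergence in norm of the vectors `(A - z) vₖ` into
  -- convergence of `vₖ` together with `A vₖ`, and so extends the bound from the range to its
  -- closure.
  have hz : ((a - 1 : ℝ) : ℂ) ∉ A.spectrum := fun hm => by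
    have : a ≤ a - 1 := hA.isLeast_bottom.2 hm
    linarith
  obtain ⟨R, hR1, hR2⟩ := exists_resolvent hz
  set z : ℂ := ((a - 1 : ℝ) : ℂ) with hzdef
  set y := A v - z • (v : Hilb) with hy
  have hyv : R y = v := hR2 v
  -- The orthogonal complement of the range of `A - a` is `ker (A - a)`, to which `y = (A - z) v` is
  -- orthogonal along with `v`.
  have hcl : y ∈ closure ((LinearMap.range (A.subScalar a) : Submodule ℂ Hilb) : Set Hilb) := by
    rw [← Submodule.topologicalClosure_coe, SetLike.mem_coe,
      ← Submodule.orthogonal_orthogonal_eq_closure, Submodule.mem_orthogonal]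
    intro u hu
    obtain ⟨n, rfl, hn⟩ := exists_map_eq hs (v := u) (w := (a : ℂ) • u) fun x => by
      have := Submodule.inner_left_of_mem_orthogonal
        (LinearMap.mem_range_self (A.subScalar a) x) hu
      change inner ℂ u (A x - (a : ℂ) • (x : Hilb)) = 0 at this
      rw [inner_sub_right, inner_smul_right, sub_eq_zero] at this
      rw [inner_smul_left, this]
      simp
    rw [hy, inner_sub_right, ← inner_map_eq hs, hn, inner_smul_left, inner_smul_right, hv n hn]
    simp
  obtain ⟨yk, hyk, hlim⟩ := mem_closure_iff_seq_limit.1 hcl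
  choose wk hwk using hyk
  choose vk hvk1 hvk2 using fun k => hR1 (yk k)
  have hvlim : Tendsto (fun k => (vk k : Hilb)) atTop (𝓝 (v : Hilb)) := by
    simp only [hvk1]
    rw [← hyv]
    exact (R.continuous.tendsto y).comp hlim
  have hAvlim : Tendsto (fun k => A (vk k)) atTop (𝓝 (A v)) := by
    have h1 : A v = y + z • (v : Hilb) := by rw [hy]; simp
    rw [h1]
    refine (hlim.add (hvlim.const_smul z)).congr fun k => ?_
    nth_rewrite 1 [← hvk2 k]
    simp
  refine le_of_tendsto_of_tendsto' ((hvlim.norm.pow 2).const_mul q) (tendsto_form hvlim hAvlim)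
    fun k => ?_
  -- The resolvent commutes with `A - a`, so `vₖ = R (A - a) wₖ = (A - a) R wₖ` is again in the
  -- range.
  obtain ⟨w, hw1, hw2⟩ := hR1 (wk k : Hilb)
  refine hrange w _ ?_
  have h1 : yk k = (A (wk k) - z • (wk k : Hilb)) + (z - a) • (wk k : Hilb) := by
    rw [← hwk k]
    change A (wk k) - (a : ℂ) • (wk k : Hilb) = _
    module
  have h2 : A w - (a : ℂ) • (w : Hilb) = (A w - z • (w : Hilb)) + (z - a) • (w : Hilb) := by module
  rw [hvk1, h1, map_add, hR2, map_smul, h2, hw2, hw1]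

theorem isIsolated_bottom_iff (hA : A.IsAdmissible) :
    A.IsIsolated (A.bottom : ℂ) ↔ ∃ q > A.bottom, ∀ t ∈ A.realSpectrum, t < q → t = A.bottom := by
  constructor
  · rintro ⟨-, ε, hε, h⟩
    refine ⟨A.bottom + ε, by linarith, fun t ht htq => ?_⟩
    refine Complex.ofReal_injective (h t ht ?_)
    rw [Complex.dist_eq, ← Complex.ofReal_sub, Complex.norm_real, Real.norm_eq_abs, abs_lt]
    have := hA.isLeast_bottom.2 ht
    constructor <;> linarith
  · rintro ⟨q, hq, h⟩
    refine ⟨hA.isLeast_bottom.1, q - A.bottom, by linarith, fun w hw hd => ?_⟩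
    obtain ⟨t, rfl⟩ : ∃ t : ℝ, w = t :=
      ⟨w.re, Complex.ext rfl (im_eq_zero_of_mem_spectrum hA.selfAdjoint hw)⟩
    rw [Complex.dist_eq, ← Complex.ofReal_sub, Complex.norm_real, Real.norm_eq_abs, abs_lt] at hd
    rw [h t hw (by linarith [hd.2])]

theorem mem_eigenspace_iff {z : ℂ} {x : A.domain} :
    x ∈ A.eigenspace z ↔ A x = z • (x : Hilb) := by
  rw [eigenspace, LinearMap.mem_ker]
  exact sub_eq_zero

/-- With trivial kernel, `le_form_of_gap` would apply to every vector and lift the bottom to `q`. -/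
theorem eigenspace_bottom_ne_bot (hA : A.IsAdmissible) (h : A.IsIsolated (A.bottom : ℂ)) :
    A.eigenspace (A.bottom : ℂ) ≠ ⊥ := by
  intro hbot
  obtain ⟨q, hq, hgap⟩ := (isIsolated_bottom_iff hA).1 h
  obtain ⟨x, hx⟩ := (hA.bottom_lt_iff q).1 hq
  refine absurd (hA.le_form_of_gap hq hgap (v := x) fun n hn => ?_) (not_le.2 hx)
  have : n ∈ A.eigenspace (A.bottom : ℂ) := mem_eigenspace_iff.2 hn
  rw [hbot, Submodule.mem_bot] at this
  simp [this]

/-- The kind is handled through its thresholds `≤ 1, 2, 3`, which involve only isolation and the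
dimension of the eigenspace; the Fredholm condition disappears. -/
theorem bottomKind_le_one_iff : (A.bottomKind : ℕ) ≤ 1 ↔ A.IsGapped := by
  have h : A.IsGapped ↔ (A.bottom : ℂ) ∈ A.discreteSpectrum ∧
      Module.finrank ℂ (A.eigenspace (A.bottom : ℂ)) = 1 := by
    constructor
    · rintro ⟨h1, h2⟩
      have : FiniteDimensional ℂ (A.eigenspace (A.bottom : ℂ)) :=
        Module.finite_of_finrank_eq_succ h2
      refine ⟨⟨h1, fun hbot => ?_, this⟩, h2⟩
      rw [hbot, finrank_bot] at h2
      norm_num at h2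
    · rintro ⟨h1, h2⟩
      exact ⟨h1.1, h2⟩
  rw [h, bottomKind]
  split_ifs <;> simp_all

theorem bottomKind_le_two_iff (hA : A.IsAdmissible) : (A.bottomKind : ℕ) ≤ 2 ↔
    A.IsIsolated (A.bottom : ℂ) ∧ FiniteDimensional ℂ (A.eigenspace (A.bottom : ℂ)) := by
  constructor
  · rw [bottomKind]
    split_ifs with h1 h2 h3
    · exact fun _ => ⟨h1.1.1, h1.1.2.2⟩
    · exact fun _ => ⟨h2.1.1, h2.1.2.2⟩
    · simp
    · simp
  · rintro ⟨h1, h2⟩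
    have hne := eigenspace_bottom_ne_bot hA h1
    have hd : (A.bottom : ℂ) ∈ A.discreteSpectrum := ⟨h1, hne, h2⟩
    have : Nontrivial (A.eigenspace (A.bottom : ℂ)) := Submodule.nontrivial_iff_ne_bot.2 hne
    have hpos : 0 < Module.finrank ℂ (A.eigenspace (A.bottom : ℂ)) := Module.finrank_pos
    have hlt : ¬ Module.finrank ℂ (A.eigenspace (A.bottom : ℂ)) = 1 →
        1 < Module.finrank ℂ (A.eigenspace (A.bottom : ℂ)) := fun h => by omega
    rw [bottomKind]
    split_ifs with h3 h4 h5
    · simp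
    · simp
    · exact absurd ⟨hd, hlt fun h => h3 ⟨hd, h⟩⟩ h4
    · exact absurd ⟨hd, hlt fun h => h3 ⟨hd, h⟩⟩ h4

/-- An isolated bottom with infinite-dimensional eigenspace is not a Fredholm point, so the last
case never occurs for an isolated bottom. -/
theorem bottomKind_le_three_iff (hA : A.IsAdmissible) :
    (A.bottomKind : ℕ) ≤ 3 ↔ A.IsIsolated (A.bottom : ℂ) := by
  constructor
  · rw [bottomKind]
    split_ifs with h1 h2 h3
    · exact fun _ => h1.1.1
    · exact fun _ => h2.1.1
    · exact fun _ => h3.2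
    · simp
  · intro h
    by_cases hfin : FiniteDimensional ℂ (A.eigenspace (A.bottom : ℂ))
    · exact ((bottomKind_le_two_iff hA).2 ⟨h, hfin⟩).trans (by norm_num)
    · have hess : (A.bottom : ℂ) ∈ A.essentialSpectrum := fun hF => hfin hF.1
      rw [bottomKind]
      split_ifs with h1 h2 h3
      · simp
      · simp
      · simp
      · exact absurd ⟨hess, h⟩ h3

end Op

end SCI

end

/-! ### Finite-rank criteria for an isolated bottom -/

noncomputable section

namespace SCI

open Filter Topology

namespace Op

open ComplexConjugate

variable {A : Op}

theorem exists_norm_map_sub_lt (hA : IsSelfAdjoint A) {t ε : ℝ} (ht : t ∈ A.realSpectrum)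
    (hε : 0 < ε) : ∃ x : A.domain, ‖(x : Hilb)‖ = 1 ∧ ‖A x - (t : ℂ) • (x : Hilb)‖ < ε := by
  by_contra! hn
  refine notMem_spectrum_of_le_real hA hε (fun x => ?_) ht
  rcases (norm_nonneg (x : Hilb)).eq_or_lt with h0 | h0
  · rw [← h0, mul_zero]
    exact norm_nonneg _
  · set s : ℂ := ((‖(x : Hilb)‖⁻¹ : ℝ) : ℂ) with hs
    have hns : ‖s‖ = ‖(x : Hilb)‖⁻¹ := by
      rw [hs, Complex.norm_real, Real.norm_eq_abs, abs_of_pos (inv_pos.2 h0)]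
    have h1 := hn (s • x) (by
      rw [Submodule.coe_smul, norm_smul, hns, inv_mul_cancel₀ h0.ne'])
    rw [LinearPMap.map_smul, Submodule.coe_smul, smul_comm, ← smul_sub, norm_smul, hns,
      inv_mul_eq_div, le_div_iff₀ h0] at h1
    exact h1

/-- If `A` is bounded below by `q` up to a form of finite rank, then the part of its spectrum below
`q` starts with an isolated point of finite multiplicity. -/
theorem IsAdmissible.isIsolated_of_finiteRank (hA : A.IsAdmissible) {V : Type*}
    [NormedAddCommGroup V] [NormedSpace ℂ V] [FiniteDimensional ℂ V] (F : Hilb →L[ℂ] V) {q K : ℝ}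
    (hq : A.bottom < q)
    (h : ∀ x : A.domain, q * ‖(x : Hilb)‖ ^ 2 ≤ A.form x + K * ‖F x‖ ^ 2) :
    A.IsIsolated (A.bottom : ℂ) := by
  have hs := hA.selfAdjoint
  set a := A.bottom with ha
  rw [isIsolated_bottom_iff hA]
  by_contra! hn
  have hpos : ∀ k : ℕ, (0 : ℝ) < 1 / (k + 1) := fun k => Nat.one_div_pos_of_nat
  choose t ht1 ht2 ht3 using fun k : ℕ => hn (a + 1 / (k + 1)) (by linarith [hpos k])
  have hta : ∀ k, 0 < t k - a := fun k =>
    sub_pos.2 ((hA.isLeast_bottom.2 (ht1 k)).lt_of_ne (ht3 k).symm)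
  -- The error of the approximate eigenvector is smaller than the distance of `t k` from `a` by a
  -- factor tending to `0`. Thus `x k` is asymptotically orthogonal to every eigenvector at `a`, as
  -- `hinner` makes precise below.
  choose x hx1 hx2 using fun k : ℕ => exists_norm_map_sub_lt hs (ht1 k)
    (mul_pos (hta k) (hpos k))
  have : ProperSpace V := FiniteDimensional.proper ℂ V
  -- Finite dimension of `V` enters here: along a subsequence `F (x k)` converges.
  obtain ⟨w, -, φ, hφ, hw⟩ := tendsto_subseq_of_bounded (x := fun k => F (x k))
    (Metric.isBounded_closedBall (x := 0) (r := ‖F‖)) fun k => by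
      rw [mem_closedBall_zero_iff]
      simpa [hx1 k] using F.le_opNorm (x k)
  have hone : Tendsto (fun k : ℕ => (1 : ℝ) / (k + 1)) atTop (𝓝 0) :=
    tendsto_one_div_add_atTop_nhds_zero_nat
  have hy : Tendsto (fun k => A (x k) - (a : ℂ) • (x k : Hilb)) atTop (𝓝 0) := by
    refine squeeze_zero_norm (a := fun k : ℕ => 1 / ((k : ℝ) + 1) * (1 / ((k : ℝ) + 1)) +
      1 / ((k : ℝ) + 1)) (fun k => ?_) ?_
    · have h1 : A (x k) - (a : ℂ) • (x k : Hilb) = (A (x k) - (t k : ℂ) • (x k : Hilb)) +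
          ((t k - a : ℝ) : ℂ) • (x k : Hilb) := by
        push_cast
        module
      have h2 := norm_add_le (A (x k) - (t k : ℂ) • (x k : Hilb))
        (((t k - a : ℝ) : ℂ) • (x k : Hilb))
      rw [← h1, norm_smul, Complex.norm_real, Real.norm_eq_abs, abs_of_pos (hta k), hx1,
        mul_one] at h2
      have h3 := hx2 k
      have h4 := ht2 k
      have h5 : (t k - a) * (1 / ((k : ℝ) + 1)) ≤ 1 / ((k : ℝ) + 1) * (1 / ((k : ℝ) + 1)) :=
        mul_le_mul_of_nonneg_right (by linarith) (hpos k).le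
      linarith
    · simpa using (hone.mul hone).add hone
  have hyφ := hy.comp hφ.tendsto_atTop
  -- For differences of the `x k`, the hypothesis bounds `(q - a) ‖z‖²` by contributions of `(A - a)
  -- z` and `F z`, which both tend to `0`. The limit is a unit eigenvector at `a`, and it
  -- contradicts the asymptotic orthogonality.
  have hcauchy : CauchySeq fun k => (x (φ k) : Hilb) := by
    rw [cauchySeq_iff_tendsto_dist_atTop_0]
    have h1 := cauchySeq_iff_tendsto_dist_atTop_0.1 hyφ.cauchySeq
    have h2 := cauchySeq_iff_tendsto_dist_atTop_0.1 hw.cauchySeq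
    have h3 : Tendsto (fun n : ℕ × ℕ => dist (x (φ n.1) : Hilb) (x (φ n.2)) ^ 2) atTop (𝓝 0) := by
      have h4 := ((h1.const_mul 2).add ((h2.pow 2).const_mul K)).div_const (q - a)
      simp only [mul_zero, ne_eq, OfNat.ofNat_ne_zero, not_false_eq_true, zero_pow, add_zero,
        zero_div] at h4
      refine squeeze_zero (fun n => sq_nonneg _) (fun n => ?_) h4
      rw [le_div_iff₀ (sub_pos.2 hq)]
      obtain ⟨k, l⟩ := n
      simp only [dist_eq_norm, Function.comp]
      set z : A.domain := x (φ k) - x (φ l) with hz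
      have h5 := h z
      have h6 : A z = (A (x (φ k)) - (a : ℂ) • (x (φ k) : Hilb) -
          (A (x (φ l)) - (a : ℂ) • (x (φ l) : Hilb))) + (a : ℂ) • (z : Hilb) := by
        rw [hz, LinearPMap.map_sub, Submodule.coe_sub]
        module
      set d := A (x (φ k)) - (a : ℂ) • (x (φ k) : Hilb) -
          (A (x (φ l)) - (a : ℂ) • (x (φ l) : Hilb))
      have h7 : A.form z ≤ 2 * ‖d‖ + a * ‖(z : Hilb)‖ ^ 2 := by
        have h8 : A.form z = (inner ℂ (z : Hilb) d).re + a * ‖(z : Hilb)‖ ^ 2 := by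
          rw [form, h6, inner_add_right, inner_smul_right, Complex.add_re, Complex.re_ofReal_mul,
            inner_self_eq_norm_sq_to_K]
          congr 1
          norm_cast
        have h9 : (inner ℂ (z : Hilb) d).re ≤ ‖(z : Hilb)‖ * ‖d‖ :=
          (Complex.re_le_norm _).trans (norm_inner_le_norm _ _)
        have h10 : ‖(z : Hilb)‖ ≤ 2 := by
          have := norm_sub_le (x (φ k) : Hilb) (x (φ l) : Hilb)
          rw [hx1, hx1] at this
          rw [hz, Submodule.coe_sub]
          linarith
        nlinarith [norm_nonneg d]
      have h11 : F z = F (x (φ k)) - F (x (φ l)) := by rw [hz, Submodule.coe_sub, map_sub]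
      rw [h11] at h5
      rw [← Submodule.coe_sub, ← hz]
      linarith
    have h4 := h3.sqrt
    simpa [Real.sqrt_sq dist_nonneg] using h4
  obtain ⟨x₀, hx₀⟩ := cauchySeq_tendsto_of_complete hcauchy
  have hAx : Tendsto (fun k => A (x (φ k))) atTop (𝓝 ((a : ℂ) • x₀)) := by
    have := hyφ.add (hx₀.const_smul (a : ℂ))
    rw [zero_add] at this
    exact this.congr fun k => by simp
  obtain ⟨u, rfl, hu⟩ := exists_map_eq_of_tendsto hs hx₀ hAx
  have hnorm : ‖(u : Hilb)‖ = 1 :=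
    tendsto_nhds_unique hx₀.norm (tendsto_const_nhds.congr fun k => (hx1 _).symm)
  have hinner : ∀ k, ‖inner ℂ (x k : Hilb) (u : Hilb)‖ ≤ 1 / ((k : ℝ) + 1) := by
    intro k
    have h1 : ((t k - a : ℝ) : ℂ) * inner ℂ (x k : Hilb) (u : Hilb) =
        - inner ℂ (A (x k) - (t k : ℂ) • (x k : Hilb)) (u : Hilb) := by
      rw [inner_sub_left, inner_map_eq hs, hu, inner_smul_right, inner_smul_left,
        Complex.conj_ofReal]
      push_cast
      ring
    have h2 := congrArg norm h1
    rw [norm_mul, norm_neg, Complex.norm_real, Real.norm_eq_abs, abs_of_pos (hta k)] at h2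
    have h3 := norm_inner_le_norm (𝕜 := ℂ) (A (x k) - (t k : ℂ) • (x k : Hilb)) (u : Hilb)
    rw [hnorm, mul_one, ← h2] at h3
    exact le_of_mul_le_mul_left (h3.trans (hx2 k).le) (hta k)
  have h1 : Tendsto (fun k => ‖inner ℂ (x (φ k) : Hilb) (u : Hilb)‖) atTop (𝓝 1) := by
    have h2 := (hx₀.inner (𝕜 := ℂ) (tendsto_const_nhds (x := (u : Hilb)))).norm
    rw [inner_self_eq_norm_sq_to_K, hnorm] at h2
    simpa using h2
  have h2 : Tendsto (fun k => ‖inner ℂ (x (φ k) : Hilb) (u : Hilb)‖) atTop (𝓝 0) :=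
    squeeze_zero (fun k => norm_nonneg _) (fun k => hinner (φ k)) (hone.comp hφ.tendsto_atTop)
  exact one_ne_zero (tendsto_nhds_unique h1 h2)

theorem form_of_eigenvector {a : ℝ} {x : A.domain} (hx : A x = (a : ℂ) • (x : Hilb)) :
    A.form x = a * ‖(x : Hilb)‖ ^ 2 := by
  rw [form, hx, inner_smul_right, Complex.re_ofReal_mul, inner_self_eq_norm_sq_to_K]
  congr 1
  norm_cast

/-- The finite-rank form `F` detects the eigenvectors at the bottom. -/
theorem injective_of_finiteRank {V : Type*}
    [NormedAddCommGroup V] [NormedSpace ℂ V] (F : Hilb →L[ℂ] V) {q K : ℝ}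
    (hq : A.bottom < q)
    (h : ∀ x : A.domain, q * ‖(x : Hilb)‖ ^ 2 ≤ A.form x + K * ‖F x‖ ^ 2) :
    Function.Injective ((F : Hilb →ₗ[ℂ] V) ∘ₗ A.domain.subtype ∘ₗ
      (A.eigenspace (A.bottom : ℂ)).subtype) := by
  rw [← LinearMap.ker_eq_bot, LinearMap.ker_eq_bot']
  intro x hx
  have h1 := h x
  have h2 : F ((x : A.domain) : Hilb) = 0 := hx
  rw [h2, form_of_eigenvector (mem_eigenspace_iff.1 x.2), norm_zero] at h1
  have h3 : ‖((x : A.domain) : Hilb)‖ ^ 2 = 0 := by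
    nlinarith [sq_nonneg ‖((x : A.domain) : Hilb)‖]
  exact Subtype.ext (Subtype.ext (norm_eq_zero.1 (pow_eq_zero_iff two_ne_zero |>.1 h3)))

/-- The eigenspace at the bottom as a subspace of the Hilbert space. -/
def groundSpace (A : Op) : Submodule ℂ Hilb :=
  (A.eigenspace (A.bottom : ℂ)).map A.domain.subtype

theorem mem_groundSpace {v : Hilb} :
    v ∈ A.groundSpace ↔ ∃ x : A.domain, (x : Hilb) = v ∧ A x = (A.bottom : ℂ) • (x : Hilb) := by
  simp only [groundSpace, Submodule.mem_map, mem_eigenspace_iff, Submodule.subtype_apply]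
  exact exists_congr fun x => and_comm

instance [FiniteDimensional ℂ (A.eigenspace (A.bottom : ℂ))] :
    FiniteDimensional ℂ A.groundSpace := by
  unfold groundSpace
  infer_instance

theorem finrank_groundSpace (A : Op) :
    Module.finrank ℂ A.groundSpace = Module.finrank ℂ (A.eigenspace (A.bottom : ℂ)) :=
  ((Submodule.equivMapOfInjective A.domain.subtype (Submodule.injective_subtype _)
    (A.eigenspace (A.bottom : ℂ))).finrank_eq).symm

/-- Split `x` into its ground component `p` and `x - p`. There are no cross terms; `p` contributes
`a ‖p‖²`, and `le_form_of_gap` applies to `x - p`. -/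
theorem IsAdmissible.le_form_add_projection (hA : A.IsAdmissible) {q : ℝ} (hq : A.bottom < q)
    (hgap : ∀ t ∈ A.realSpectrum, t < q → t = A.bottom)
    [FiniteDimensional ℂ (A.eigenspace (A.bottom : ℂ))] (x : A.domain) :
    q * ‖(x : Hilb)‖ ^ 2 ≤
      A.form x + (q - A.bottom) * ‖A.groundSpace.starProjection (x : Hilb)‖ ^ 2 := by
  set P := A.groundSpace.starProjection (x : Hilb) with hP
  obtain ⟨p, hp1, hp2⟩ := mem_groundSpace.1
    (Submodule.starProjection_apply_mem A.groundSpace (x : Hilb))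
  rw [← hP] at hp1
  have horth : ∀ n ∈ A.groundSpace, inner ℂ n ((x - p : A.domain) : Hilb) = 0 := by
    intro n hn
    rw [Submodule.coe_sub, hp1]
    exact Submodule.inner_right_of_mem_orthogonal hn
      (A.groundSpace.sub_starProjection_mem_orthogonal _)
  have hpg : (p : Hilb) ∈ A.groundSpace := mem_groundSpace.2 ⟨p, rfl, hp2⟩
  have h1 := hA.le_form_of_gap hq hgap (v := x - p) fun n hn => horth n (mem_groundSpace.2 ⟨n, rfl, hn⟩)
  have hxp : inner ℂ (p : Hilb) (x : Hilb) = ((‖(p : Hilb)‖ ^ 2 : ℝ) : ℂ) := by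
    have := horth p hpg
    rw [Submodule.coe_sub, inner_sub_right, inner_self_eq_norm_sq_to_K, sub_eq_zero] at this
    rw [this]
    norm_cast
  have h2 : A.form (x - p) = A.form x - A.bottom * ‖(p : Hilb)‖ ^ 2 := by
    rw [form_sub hA.selfAdjoint, inner_map_eq hA.selfAdjoint, hp2, inner_smul_right,
      ← inner_conj_symm, hxp, form_of_eigenvector hp2, Complex.conj_ofReal, Complex.re_ofReal_mul,
      Complex.ofReal_re]
    ring
  have h3 : ‖((x - p : A.domain) : Hilb)‖ ^ 2 = ‖(x : Hilb)‖ ^ 2 - ‖(p : Hilb)‖ ^ 2 := by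
    rw [Submodule.coe_sub, norm_sub_sq (𝕜 := ℂ), ← inner_conj_symm, hxp]
    simp only [Complex.conj_ofReal, RCLike.re_to_complex, Complex.ofReal_re]
    ring
  rw [h2, h3] at h1
  rw [← hp1]
  linarith

end Op

/-! ### Coordinate projections -/

namespace Op

open ComplexConjugate

theorem inner_e (j : ℕ) (x : Hilb) : inner ℂ (e j) x = x j := by
  simp [e, lp.inner_single_left]

theorem norm_e (j : ℕ) : ‖e j‖ = 1 := by
  rw [e, lp.norm_single (by norm_num)]
  simp

theorem e_apply (i j : ℕ) : (e i : Hilb) j = if j = i then 1 else 0 := by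
  rw [e, lp.single_apply, Pi.single_apply]

theorem proj_apply (n : ℕ) (x : Hilb) : proj n x = ∑ j ∈ Finset.range n, (x j) • e j := by
  rw [proj, sum_apply]
  refine Finset.sum_congr rfl fun j _ => ?_
  rw [ContinuousLinearMap.smulRight_apply, innerSL_apply_apply, inner_e]

theorem sum_smul_e_apply (n : ℕ) (w : ℕ → ℂ) (i : ℕ) :
    (∑ j ∈ Finset.range n, w j • e j : Hilb) i = if i < n then w i else 0 := by
  rw [lp.coeFn_sum, Finset.sum_apply]
  simp only [lp.coeFn_smul, Pi.smul_apply, e_apply, smul_eq_mul, mul_ite, mul_one, mul_zero]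
  rw [Finset.sum_ite_eq]
  simp

theorem norm_sum_smul_e (n : ℕ) (w : ℕ → ℂ) :
    ‖(∑ j ∈ Finset.range n, w j • e j : Hilb)‖ ^ 2 = ∑ j ∈ Finset.range n, Complex.normSq (w j) := by
  have h := lp.norm_sum_single (E := fun _ : ℕ => ℂ) (p := 2) (by norm_num) w (Finset.range n)
  simp only [ENNReal.toReal_ofNat, Real.rpow_ofNat] at h
  have h2 : (∑ j ∈ Finset.range n, w j • e j : Hilb) =
      ∑ j ∈ Finset.range n, lp.single 2 j (w j) := by
    refine Finset.sum_congr rfl fun j _ => ?_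
    rw [e, ← lp.single_smul, smul_eq_mul, mul_one]
  rw [h2, h]
  simp only [Complex.normSq_eq_norm_sq]

theorem norm_proj_sq (n : ℕ) (x : Hilb) :
    ‖proj n x‖ ^ 2 = ∑ j ∈ Finset.range n, Complex.normSq (x j) := by
  rw [proj_apply, norm_sum_smul_e]

theorem tendsto_proj (x : Hilb) : Tendsto (fun n => proj n x) atTop (𝓝 x) := by
  have h := (lp.hasSum_single (E := fun _ : ℕ => ℂ) (p := 2) (by norm_num) x).tendsto_sum_nat
  refine h.congr fun n => ?_
  rw [proj_apply]
  refine Finset.sum_congr rfl fun j _ => ?_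
  rw [e, ← lp.single_smul, smul_eq_mul, mul_one]

theorem inner_proj_left (n : ℕ) (x y : Hilb) :
    inner ℂ (proj n x) y = inner ℂ x (proj n y) := by
  rw [proj_apply, proj_apply, sum_inner, inner_sum]
  refine Finset.sum_congr rfl fun j _ => ?_
  rw [inner_smul_left, inner_smul_right, inner_e, ← inner_conj_symm x, inner_e, mul_comm]

theorem proj_proj (n : ℕ) (x : Hilb) : proj n (proj n x) = proj n x := by
  rw [proj_apply n (proj n x)]
  nth_rewrite 2 [proj_apply]
  refine Finset.sum_congr rfl fun j hj => ?_
  rw [proj_apply, sum_smul_e_apply, if_pos (Finset.mem_range.1 hj)]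

theorem norm_sq_eq_proj (n : ℕ) (x : Hilb) : ‖x‖ ^ 2 = ‖proj n x‖ ^ 2 + ‖x - proj n x‖ ^ 2 := by
  have h1 : inner ℂ (proj n x) (x - proj n x) = 0 := by
    rw [inner_proj_left, map_sub, proj_proj, sub_self, inner_zero_right]
  have h2 := norm_add_sq (𝕜 := ℂ) (proj n x) (x - proj n x)
  rw [h1, add_sub_cancel] at h2
  simpa using h2

theorem sum_normSq_le (n : ℕ) (x : Hilb) :
    ∑ j ∈ Finset.range n, Complex.normSq (x j) ≤ ‖x‖ ^ 2 := by
  rw [← norm_proj_sq, norm_sq_eq_proj n x]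
  nlinarith [sq_nonneg ‖x - proj n x‖]

/-- A finite-dimensional projection is almost carried by finitely many coordinates. -/
theorem exists_norm_starProjection_le (E : Submodule ℂ Hilb) [FiniteDimensional ℂ E] {η : ℝ}
    (hη : 0 < η) : ∃ n, ∀ v : Hilb, ‖E.starProjection v‖ ≤ ‖proj n v‖ + η * ‖v‖ := by
  let b := stdOrthonormalBasis ℂ E
  have hlim : Tendsto (fun n => ∑ i, ‖(b i : Hilb) - proj n (b i)‖) atTop (𝓝 0) := by
    have : Tendsto (fun n => ∑ i, ‖(b i : Hilb) - proj n (b i)‖) atTop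
        (𝓝 (∑ i, ‖(b i : Hilb) - b i‖)) :=
      tendsto_finsetSum _ fun i _ => ((tendsto_const_nhds.sub (tendsto_proj (b i : Hilb))).norm)
    simpa using this
  -- Moving `1 - P_n` onto the finitely many basis vectors of `E` makes the estimate uniform in `v`.
  obtain ⟨n, hn⟩ := (hlim.eventually_lt_const hη).exists
  refine ⟨n, fun v => ?_⟩
  have h1 : ‖E.starProjection (v - proj n v)‖ ≤ η * ‖v‖ := by
    have h2 : E.starProjection (v - proj n v) =
        ∑ i, inner ℂ (b i : Hilb) (v - proj n v) • (b i : Hilb) := by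
      have h3 := b.sum_repr' (E.orthogonalProjectionOnto (v - proj n v))
      have h4 := congrArg (fun u : E => (u : Hilb)) h3
      simp only [Submodule.coe_sum, Submodule.coe_smul] at h4
      rw [Submodule.starProjection_apply, ← h4]
      refine Finset.sum_congr rfl fun i _ => ?_
      rw [Submodule.coe_inner, ← Submodule.starProjection_apply,
        ← Submodule.inner_starProjection_left_eq_right,
        Submodule.starProjection_eq_self_iff.2 (b i).2]
    rw [h2]
    refine (norm_sum_le _ _).trans ?_
    refine le_trans ?_ (mul_le_mul_of_nonneg_right hn.le (norm_nonneg v))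
    rw [Finset.sum_mul]
    refine Finset.sum_le_sum fun i _ => ?_
    have h5 : ‖(b i : Hilb)‖ = 1 := b.orthonormal.1 i
    have h6 : inner ℂ (b i : Hilb) (v - proj n v) = inner ℂ ((b i : Hilb) - proj n (b i)) v := by
      rw [inner_sub_right, inner_sub_left, inner_proj_left]
    rw [norm_smul, h5, mul_one, h6]
    exact norm_inner_le_norm _ _
  have h7 : E.starProjection v = E.starProjection (proj n v) + E.starProjection (v - proj n v) := by
    rw [← map_add, add_sub_cancel]
  rw [h7]
  refine (norm_add_le _ _).trans (add_le_add ?_ h1)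
  exact E.norm_starProjection_apply_le _

end Op

end SCI

end

/-! ### Finite vectors, codes, and quantifier forms of the three thresholds -/

noncomputable section

namespace SCI

open Filter Topology

namespace Op

open ComplexConjugate

variable {A : Op}

/-- The vector with the coordinates `w₀, …, w_{N-1}`. -/
def vec (N : ℕ) (w : ℕ → ℂ) : Hilb := ∑ j ∈ Finset.range N, w j • e j

/-- The image of `vec N w` under `A`. -/
def vecImage (A : Op) (N : ℕ) (w : ℕ → ℂ) : Hilb := ∑ j ∈ Finset.range N, w j • A.applyBasis j

/-- The values of `w` are Gaussian integers. -/
def IsGaussianInt (w : ℕ → ℂ) : Prop := ∀ i, ∃ m n : ℤ, w i = m + n * Complex.I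

theorem IsAdmissible.exists_vec (hA : A.IsAdmissible) (N : ℕ) (w : ℕ → ℂ) :
    ∃ x : A.domain, (x : Hilb) = vec N w ∧ A x = A.vecImage N w := by
  have he : ∀ j, e j ∈ A.domain := fun j => hA.core.le_domain (Submodule.subset_span ⟨j, rfl⟩)
  refine ⟨∑ j ∈ Finset.range N, w j • ⟨e j, he j⟩, ?_, ?_⟩
  · simp [vec]
  · rw [← LinearPMap.toFun_eq_coe, map_sum, vecImage]
    refine Finset.sum_congr rfl fun j _ => ?_
    rw [map_smul, LinearPMap.toFun_eq_coe, applyBasis, dif_pos (he j)]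

theorem vec_apply (N : ℕ) (w : ℕ → ℂ) (i : ℕ) : vec N w i = if i < N then w i else 0 :=
  sum_smul_e_apply N w i

theorem norm_vec_sq (N : ℕ) (w : ℕ → ℂ) :
    ‖vec N w‖ ^ 2 = ∑ j ∈ Finset.range N, Complex.normSq (w j) :=
  norm_sum_smul_e N w

theorem vecImage_apply (A : Op) (N : ℕ) (w : ℕ → ℂ) (i : ℕ) :
    A.vecImage N w i = ∑ j ∈ Finset.range N, A.entry i j * w j := by
  rw [vecImage, lp.coeFn_sum, Finset.sum_apply]
  refine Finset.sum_congr rfl fun j _ => ?_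
  rw [lp.coeFn_smul, Pi.smul_apply, smul_eq_mul, entry, inner_e, mul_comm]

theorem inner_vec (N : ℕ) (w : ℕ → ℂ) (y : Hilb) :
    inner ℂ (vec N w) y = ∑ i ∈ Finset.range N, conj (w i) * y i := by
  rw [vec, sum_inner]
  refine Finset.sum_congr rfl fun i _ => ?_
  rw [inner_smul_left, inner_e]

theorem vec_congr {N : ℕ} {w w' : ℕ → ℂ} (h : ∀ i < N, w i = w' i) : vec N w = vec N w' :=
  Finset.sum_congr rfl fun j hj => by rw [h j (Finset.mem_range.1 hj)]

theorem vecImage_congr {N : ℕ} {w w' : ℕ → ℂ} (h : ∀ i < N, w i = w' i) :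
    A.vecImage N w = A.vecImage N w' :=
  Finset.sum_congr rfl fun j hj => by rw [h j (Finset.mem_range.1 hj)]

/-- Padding by zeros allows two vectors of one code to share a length, and that length to be taken
large. -/
theorem vec_extend {N M : ℕ} (h : N ≤ M) (w : ℕ → ℂ) :
    vec M (fun i => if i < N then w i else 0) = vec N w := by
  unfold vec
  rw [← Finset.sum_subset (Finset.range_mono h) fun j _ hj => by
    rw [Finset.mem_range] at hj; simp [hj]]
  exact Finset.sum_congr rfl fun j hj => by simp [Finset.mem_range.1 hj]

theorem vecImage_extend {N M : ℕ} (h : N ≤ M) (w : ℕ → ℂ) :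
    A.vecImage M (fun i => if i < N then w i else 0) = A.vecImage N w := by
  unfold vecImage
  rw [← Finset.sum_subset (Finset.range_mono h) fun j _ hj => by
    rw [Finset.mem_range] at hj; simp [hj]]
  exact Finset.sum_congr rfl fun j hj => by simp [Finset.mem_range.1 hj]

theorem IsGaussianInt.extend {w : ℕ → ℂ} (hw : IsGaussianInt w) (N : ℕ) :
    IsGaussianInt fun i => if i < N then w i else 0 := by
  intro i
  by_cases h : i < N
  · simpa [h] using hw i
  · exact ⟨0, 0, by simp [h]⟩

theorem tendsto_int_floor_div (c : ℝ) :
    Tendsto (fun D : ℕ => (⌊((D : ℝ) + 1) * c⌋ : ℝ) / ((D : ℝ) + 1)) atTop (𝓝 c) := by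
  have hpos : ∀ D : ℕ, (0 : ℝ) < (D : ℝ) + 1 := fun D => by positivity
  have h1 : Tendsto (fun D : ℕ => c - 1 / ((D : ℝ) + 1)) atTop (𝓝 c) := by
    simpa using tendsto_const_nhds.sub (tendsto_one_div_add_atTop_nhds_zero_nat (𝕜 := ℝ))
  refine tendsto_of_tendsto_of_tendsto_of_le_of_le h1 tendsto_const_nhds (fun D => ?_) fun D => ?_
  · change c - 1 / ((D : ℝ) + 1) ≤ (⌊((D : ℝ) + 1) * c⌋ : ℝ) / ((D : ℝ) + 1)
    rw [le_div_iff₀ (hpos D), sub_mul, div_mul_cancel₀ _ (hpos D).ne']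
    linarith [Int.sub_one_lt_floor (((D : ℝ) + 1) * c)]
  · change (⌊((D : ℝ) + 1) * c⌋ : ℝ) / ((D : ℝ) + 1) ≤ c
    rw [div_le_iff₀ (hpos D)]
    linarith [Int.floor_le (((D : ℝ) + 1) * c)]

/-- Multiples of finite vectors with Gaussian integer coordinates are dense in the domain with
respect to the graph norm. -/
theorem IsAdmissible.exists_gaussianInt_mem (hA : A.IsAdmissible) (x : A.domain)
    {U : Set (Hilb × Hilb)} (hU : U ∈ 𝓝 ((x : Hilb), A x)) :
    ∃ (N : ℕ) (w : ℕ → ℂ) (D : ℕ), IsGaussianInt w ∧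
      ((((D : ℝ) + 1)⁻¹ : ℝ) : ℂ) • (vec N w, A.vecImage N w) ∈ U := by
  obtain ⟨V, hVU, hV, hxV⟩ := mem_nhds_iff.1 hU
  have hclos : (A.domRestrict (Submodule.span ℂ (Set.range e))).IsClosable :=
    hA.selfAdjoint.isClosed.isClosable.leIsClosable LinearPMap.domRestrict_le
  -- This is the core hypothesis: finite vectors are dense in the graph.
  have hx : ((x : Hilb), A x) ∈ closure
      ((A.domRestrict (Submodule.span ℂ (Set.range e))).graph : Set (Hilb × Hilb)) := by
    rw [← Submodule.topologicalClosure_coe, hclos.graph_closure_eq_closure_graph, hA.core.closure_eq]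
    exact LinearPMap.mem_graph A x
  obtain ⟨⟨y, y'⟩, hyV, hy⟩ := mem_closure_iff.1 hx V hV hxV
  obtain ⟨z, hz1, hz2⟩ := (LinearPMap.mem_graph_iff _).1 hy
  change (z : Hilb) = y at hz1
  change _ = y' at hz2
  obtain ⟨c, hc⟩ := Finsupp.mem_span_range_iff_exists_finsupp.1 z.2.1
  obtain ⟨N, hN⟩ := c.support.exists_nat_subset_range
  have hcv : vec N c = (z : Hilb) := by
    rw [← hc, Finsupp.sum_of_support_subset c hN _ (by simp)]
    rfl
  obtain ⟨u, hu1, hu2⟩ := hA.exists_vec N c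
  have hAz : A.vecImage N c = y' := by
    rw [← hu2, ← hz2]
    exact (LinearPMap.domRestrict_apply (by rw [hu1, hcv])).symm
  -- Rounding `(D + 1) c i` down gives Gaussian integers that, divided by the common denominator `D
  -- + 1`, converge to `c i`.
  let w : ℕ → ℕ → ℂ := fun D i => (⌊((D : ℝ) + 1) * (c i).re⌋ : ℂ) +
    (⌊((D : ℝ) + 1) * (c i).im⌋ : ℂ) * Complex.I
  have hw : ∀ i, Tendsto (fun D : ℕ => ((((D : ℝ) + 1)⁻¹ : ℝ) : ℂ) * w D i) atTop (𝓝 (c i)) := by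
    intro i
    have h1 := (Complex.continuous_ofReal.tendsto _).comp (tendsto_int_floor_div (c i).re)
    have h2 := (Complex.continuous_ofReal.tendsto _).comp (tendsto_int_floor_div (c i).im)
    have h3 := h1.add (h2.mul_const Complex.I)
    rw [Complex.re_add_im] at h3
    refine h3.congr fun D => ?_
    simp only [Function.comp, w]
    push_cast
    ring
  have hlim : ∀ g : ℕ → Hilb, Tendsto (fun D : ℕ => ((((D : ℝ) + 1)⁻¹ : ℝ) : ℂ) •
      ∑ j ∈ Finset.range N, w D j • g j) atTop (𝓝 (∑ j ∈ Finset.range N, c j • g j)) := by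
    intro g
    simp only [Finset.smul_sum, smul_smul]
    exact tendsto_finsetSum _ fun j _ => (hw j).smul_const (g j)
  have hpair : Tendsto (fun D : ℕ => ((((D : ℝ) + 1)⁻¹ : ℝ) : ℂ) • (vec N (w D), A.vecImage N (w D)))
      atTop (𝓝 (y, y')) := by
    have h1 : y = vec N c := by rw [hcv, hz1]
    rw [h1, ← hAz]
    exact (hlim e).prodMk_nhds (hlim A.applyBasis)
  obtain ⟨D, hD⟩ := (hpair.eventually_mem (hV.mem_nhds hyV)).exists
  exact ⟨N, w D, D, fun i => ⟨_, _, rfl⟩, hVU hD⟩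

/-- A strict inequality is stable under small changes in the graph norm, and homogeneity of degree
two removes the common denominator. -/
theorem IsAdmissible.exists_gaussianInt_lt_zero (hA : A.IsAdmissible) {Φ : Hilb × Hilb → ℝ}
    (hΦ : Continuous Φ) (hom : ∀ (t : ℝ) z, Φ ((t : ℂ) • z) = t ^ 2 * Φ z) {x : A.domain}
    (hx : Φ (x, A x) < 0) : ∃ N w, IsGaussianInt w ∧ Φ (vec N w, A.vecImage N w) < 0 := by
  obtain ⟨N, w, D, hw, hD⟩ := hA.exists_gaussianInt_mem x
    ((isOpen_lt hΦ continuous_const).mem_nhds hx)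
  refine ⟨N, w, hw, ?_⟩
  rw [Set.mem_ofPred_eq, hom] at hD
  by_contra! hn
  exact absurd hD (not_lt.2 (mul_nonneg (sq_nonneg _) hn))

/-! ### Codes for the data of the tests -/

/-- The sequence of natural numbers coded by a pair (Gödel's beta function). -/
def decode (m₁ m₂ i : ℕ) : ℕ := m₁ % ((i + 1) * m₂ + 1)

theorem exists_decode_eq (p : ℕ → ℕ) (L : ℕ) : ∃ m₁ m₂, ∀ i < L, decode m₁ m₂ i = p i := by
  let l : List ℕ := (List.range L).map p
  refine ⟨(Nat.unbeta l).unpair.1, (Nat.unbeta l).unpair.2, fun i hi => ?_⟩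
  have hl : i < l.length := by simpa [l] using hi
  have := Nat.beta_unbeta_coe l ⟨i, hl⟩
  have h2 : l[i] = p i := by simp [l]
  exact this.trans h2

/-- The rational number in a code. -/
def codeRat (p : ℕ → ℕ) : ℝ := ((p 0 : ℝ) - p 1) / (p 2 + 1)

/-- The coordinates of the vectors (`s = 0, 1`) in a code. -/
def codeCoord (p : ℕ → ℕ) (s i : ℕ) : ℂ :=
  if i < p 5 then ⟨(p (8 + 4 * i + 2 * s) : ℝ) - p 6, (p (9 + 4 * i + 2 * s) : ℝ) - p 6⟩ else 0

/-- Cells `0, 1, 2` hold the positive and negative parts of the numerator and the denominator minus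
one, cells `3, 4, 5` the numbers `K, n, N`. Cell `6` holds a shift `h`, the sum of all absolute
values, which makes the integer coordinates non-negative. From cell `8` on, each index takes a block
of four: real and imaginary parts of `w₀` and `w₁`. Cell `7` is not read. -/
theorem exists_code (q : ℚ) (K n N : ℕ) {w₀ w₁ : ℕ → ℂ} (h₀ : IsGaussianInt w₀)
    (h₁ : IsGaussianInt w₁) : ∃ m₁ m₂, codeRat (decode m₁ m₂) = q ∧ decode m₁ m₂ 3 = K ∧
      decode m₁ m₂ 4 = n ∧ decode m₁ m₂ 5 = N ∧
      (∀ i < N, codeCoord (decode m₁ m₂) 0 i = w₀ i) ∧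
      ∀ i < N, codeCoord (decode m₁ m₂) 1 i = w₁ i := by
  choose a b hab using h₀
  choose c d hcd using h₁
  let h : ℕ := ∑ i ∈ Finset.range N, ((a i).natAbs + (b i).natAbs + (c i).natAbs + (d i).natAbs)
  have hh : ∀ i < N, 0 ≤ a i + h ∧ 0 ≤ b i + h ∧ 0 ≤ c i + h ∧ 0 ≤ d i + h := by
    intro i hi
    have : (a i).natAbs + (b i).natAbs + (c i).natAbs + (d i).natAbs ≤ h :=
      Finset.single_le_sum (f := fun i => (a i).natAbs + (b i).natAbs + (c i).natAbs + (d i).natAbs)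
        (fun _ _ => Nat.zero_le _) (Finset.mem_range.2 hi)
    omega
  let p : ℕ → ℕ := fun l =>
    if l = 0 then q.num.toNat else if l = 1 then (-q.num).toNat else if l = 2 then q.den - 1
    else if l = 3 then K else if l = 4 then n else if l = 5 then N else if l = 6 then h
    else if l % 4 = 0 then (a ((l - 8) / 4) + h).toNat
    else if l % 4 = 1 then (b ((l - 8) / 4) + h).toNat
    else if l % 4 = 2 then (c ((l - 8) / 4) + h).toNat
    else (d ((l - 8) / 4) + h).toNat
  obtain ⟨m₁, m₂, hm⟩ := exists_decode_eq p (8 + 4 * N)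
  have p0 : decode m₁ m₂ 0 = q.num.toNat := hm 0 (by omega)
  have p1 : decode m₁ m₂ 1 = (-q.num).toNat := hm 1 (by omega)
  have p2 : decode m₁ m₂ 2 = q.den - 1 := hm 2 (by omega)
  have p3 : decode m₁ m₂ 3 = K := hm 3 (by omega)
  have p4 : decode m₁ m₂ 4 = n := hm 4 (by omega)
  have p5 : decode m₁ m₂ 5 = N := hm 5 (by omega)
  have p6 : decode m₁ m₂ 6 = h := hm 6 (by omega)
  have pl : ∀ l i r, i < N → l = 8 + 4 * i + r → r < 4 → decode m₁ m₂ l =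
      if r = 0 then (a i + h).toNat else if r = 1 then (b i + h).toNat
      else if r = 2 then (c i + h).toNat else (d i + h).toNat := by
    intro l i r hi hl hr
    rw [hm l (by omega)]
    have e1 : (l - 8) / 4 = i := by omega
    have e2 : l % 4 = r := by omega
    simp only [p, e1, e2]
    rw [if_neg (by omega), if_neg (by omega), if_neg (by omega), if_neg (by omega),
      if_neg (by omega), if_neg (by omega), if_neg (by omega)]
  have cast : ∀ z : ℤ, 0 ≤ z + h → (((z + h).toNat : ℕ) : ℝ) - h = z := by
    intro z hz
    have : (((z + h).toNat : ℤ) : ℝ) = ((z + h : ℤ) : ℝ) := by rw [Int.toNat_of_nonneg hz]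
    push_cast at this
    linarith
  refine ⟨m₁, m₂, ?_, p3, p4, p5, fun i hi => ?_, fun i hi => ?_⟩
  · rw [codeRat, p0, p1, p2]
    have e1 : ((q.num.toNat : ℕ) : ℝ) - ((-q.num).toNat : ℕ) = q.num := by
      have := Int.toNat_sub_toNat_neg q.num
      exact_mod_cast this
    have e2 : ((q.den - 1 : ℕ) : ℝ) + 1 = q.den := by
      rw [Nat.cast_sub q.den_pos]
      simp
    rw [e1, e2]
    exact (Rat.cast_def q).symm
  · rw [codeCoord, p5, if_pos hi, p6, pl _ i 0 hi (by omega) (by omega),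
      pl _ i 1 hi (by omega) (by omega), hab]
    obtain ⟨e1, e2, -⟩ := hh i hi
    apply Complex.ext <;> simp [cast _ e1, cast _ e2]
  · rw [codeCoord, p5, if_pos hi, p6, pl _ i 2 hi (by omega) (by omega),
      pl _ i 3 hi (by omega) (by omega), hcd]
    obtain ⟨-, -, e1, e2⟩ := hh i hi
    apply Complex.ext <;> simp [cast _ e1, cast _ e2]

/-- The vectors in a code. -/
def codeVec (p : ℕ → ℕ) (s : ℕ) : Hilb := vec (p 5) (codeCoord p s)

theorem codeVec_apply (p : ℕ → ℕ) (s i : ℕ) : codeVec p s i = codeCoord p s i := by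
  rw [codeVec, vec_apply, codeCoord]
  split_ifs <;> rfl

/-- `⟨(a - q) x, x⟩` for a matrix `a` and the vector `x` with number `s` in the code `p`. -/
def energy (a : ℕ → ℕ → ℂ) (p : ℕ → ℕ) (s : ℕ) (q : ℝ) : ℝ :=
  (∑ i ∈ Finset.range (p 5), ∑ j ∈ Finset.range (p 5),
    conj (codeCoord p s i) * codeCoord p s j * a i j).re -
    q * ∑ i ∈ Finset.range (p 5), Complex.normSq (codeCoord p s i)

theorem inner_vec_vecImage (A : Op) (N : ℕ) (w : ℕ → ℂ) : inner ℂ (vec N w) (A.vecImage N w) =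
    ∑ i ∈ Finset.range N, ∑ j ∈ Finset.range N, conj (w i) * w j * A.entry i j := by
  rw [inner_vec]
  refine Finset.sum_congr rfl fun i _ => ?_
  rw [vecImage_apply, Finset.mul_sum]
  exact Finset.sum_congr rfl fun j _ => by ring

theorem energy_eq (A : Op) (p : ℕ → ℕ) (s : ℕ) (q : ℝ) : energy A.entry p s q =
    (inner ℂ (codeVec p s) (A.vecImage (p 5) (codeCoord p s))).re - q * ‖codeVec p s‖ ^ 2 := by
  rw [energy, codeVec, inner_vec_vecImage, norm_vec_sq]

/-- The test that `a` has a direction below `q`, and none that is orthogonal to the vector in `p`,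
where `q` is the number in `p`. -/
def SimpleTest (a : ℕ → ℕ → ℂ) (p k : ℕ → ℕ) : Prop :=
  energy a p 0 (codeRat p) < 0 ∧ 0 ≤ energy a k 0 (codeRat p) +
    p 3 * Complex.normSq (∑ i ∈ Finset.range (k 5), conj (codeCoord p 0 i) * codeCoord k 0 i)

/-- The test that `a` has a direction below `q`, and none that is orthogonal to the first
coordinates. -/
def FiniteTest (a : ℕ → ℕ → ℂ) (p k : ℕ → ℕ) : Prop :=
  energy a p 0 (codeRat p) < 0 ∧ 0 ≤ energy a k 0 (codeRat p) +
    p 3 * ∑ i ∈ Finset.range (p 4), Complex.normSq (codeCoord k 0 i)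

/-- The test that the bottom of the spectrum is below `q`, and that the code `k` does not witness a
point of the spectrum between the bottom and `q`. -/
def GapTest (a : ℕ → ℕ → ℂ) (c : ℕ → ℝ) (f : ℕ → ℕ) (p k : ℕ → ℕ) : Prop :=
  energy a p 0 (codeRat p) < 0 ∧ ¬ (codeRat k < codeRat p ∧ energy a k 0 (codeRat k) < 0 ∧
    ∑ i ∈ Finset.range (f (k 5)), Complex.normSq (∑ j ∈ Finset.range (k 5),
        a i j * codeCoord k 1 j - ((codeRat p + codeRat k) / 2 : ℝ) * codeCoord k 1 i) +
      c (k 5) ^ 2 * ∑ i ∈ Finset.range (k 5), Complex.normSq (codeCoord k 1 i) <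
    ((codeRat p - codeRat k) / 2) ^ 2 * ∑ i ∈ Finset.range (k 5), Complex.normSq (codeCoord k 1 i))

theorem IsAdmissible.bottom_lt_of_energy (hA : A.IsAdmissible) {p : ℕ → ℕ} {s : ℕ} {q : ℝ}
    (h : energy A.entry p s q < 0) : A.bottom < q := by
  rw [energy_eq] at h
  obtain ⟨x, hx1, hx2⟩ := hA.exists_vec (p 5) (codeCoord p s)
  refine (hA.bottom_lt_iff q).2 ⟨x, ?_⟩
  rw [← hx2, codeVec, ← hx1] at h
  exact sub_neg.1 h

theorem continuous_energy (q : ℝ) :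
    Continuous fun z : Hilb × Hilb => (inner ℂ z.1 z.2).re - q * ‖z.1‖ ^ 2 :=
  (Complex.continuous_re.comp (continuous_fst.inner continuous_snd)).sub
    (continuous_const.mul (continuous_fst.norm.pow 2))

theorem energy_smul (q t : ℝ) (z : Hilb × Hilb) :
    (inner ℂ ((t : ℂ) • z).1 ((t : ℂ) • z).2).re - q * ‖((t : ℂ) • z).1‖ ^ 2 =
      t ^ 2 * ((inner ℂ z.1 z.2).re - q * ‖z.1‖ ^ 2) := by
  rw [Prod.smul_fst, Prod.smul_snd, inner_smul_left, inner_smul_right, norm_smul,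
    Complex.conj_ofReal, Complex.re_ofReal_mul, Complex.re_ofReal_mul, Complex.norm_real, mul_pow,
    Real.norm_eq_abs, sq_abs]
  ring

/-- If a form inequality holds for all coded vectors, then it holds on the whole domain. -/
theorem IsAdmissible.le_form_of_code (hA : A.IsAdmissible) {q K : ℝ} {G : Hilb → ℝ}
    (hG : Continuous G) (hom : ∀ (t : ℝ) z, G ((t : ℂ) • z) = t ^ 2 * G z)
    (h : ∀ k₁ k₂, 0 ≤ energy A.entry (decode k₁ k₂) 0 q + K * G (codeVec (decode k₁ k₂) 0))
    (x : A.domain) : q * ‖(x : Hilb)‖ ^ 2 ≤ A.form x + K * G x := by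
  by_contra! hlt
  obtain ⟨N, w, hw, hneg⟩ := hA.exists_gaussianInt_lt_zero
    (Φ := fun z => ((inner ℂ z.1 z.2).re - q * ‖z.1‖ ^ 2) + K * G z.1)
    ((continuous_energy q).add (continuous_const.mul (hG.comp continuous_fst)))
    (fun t z => by rw [energy_smul, Prod.smul_fst, hom]; ring) (x := x) (by
      change A.form x - q * ‖(x : Hilb)‖ ^ 2 + K * G x < 0
      linarith)
  obtain ⟨k₁, k₂, -, -, -, h5, h0, -⟩ := exists_code 0 0 0 N hw hw
  have := h k₁ k₂
  rw [energy_eq, codeVec, h5, vec_congr h0, vecImage_congr h0] at this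
  exact absurd hneg (not_lt.2 this)

theorem simpleTest_inner (p k : ℕ → ℕ) : ∑ i ∈ Finset.range (k 5),
    conj (codeCoord p 0 i) * codeCoord k 0 i = inner ℂ (codeVec p 0) (codeVec k 0) := by
  rw [← inner_conj_symm, codeVec, inner_vec, map_sum]
  refine Finset.sum_congr rfl fun i _ => ?_
  rw [map_mul, Complex.conj_conj, codeVec_apply, mul_comm]

theorem norm_sq_le_of_norm_le {a b c : ℝ} (ha : 0 ≤ a) (h : a ≤ b + c) :
    a ^ 2 ≤ 2 * b ^ 2 + 2 * c ^ 2 := by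
  nlinarith [sq_nonneg (b - c)]

/-- In the gapped case `A ≥ q - (q - a) |⟨ψ, ·⟩|²` for the unit ground state `ψ`. Passing to a
rational `q₁ < q` leaves room to replace `ψ` by a finite Gaussian integer vector and the coefficient
by an integer. Conversely the test is a rank-one form bound, which gives isolation and multiplicity
at most one. -/
theorem IsAdmissible.bottomKind_le_one_iff (hA : A.IsAdmissible) : (A.bottomKind : ℕ) ≤ 1 ↔
    ∃ m₁ m₂, ∀ k₁ k₂, SimpleTest A.entry (decode m₁ m₂) (decode k₁ k₂) := by
  rw [Op.bottomKind_le_one_iff]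
  constructor
  · rintro ⟨hiso, hrank⟩
    have : FiniteDimensional ℂ (A.eigenspace (A.bottom : ℂ)) := Module.finite_of_finrank_eq_succ hrank
    obtain ⟨q, hq, hgap⟩ := (isIsolated_bottom_iff hA).1 hiso
    obtain ⟨q₁, haq₁, hq₁⟩ := exists_rat_btwn hq
    -- The factor `2` comes from `norm_sq_le_of_norm_le`, applied when `ψ` is replaced by its
    -- approximation.
    obtain ⟨K, hK⟩ := exists_nat_ge (2 * (q - A.bottom))
    obtain ⟨⟨ψ₀, hψ₀⟩, hψne⟩ := Module.finrank_pos_iff_exists_ne_zero.1 (by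
      rw [finrank_groundSpace, hrank]; norm_num : 0 < Module.finrank ℂ A.groundSpace)
    have hψ₀ne : ψ₀ ≠ 0 := fun h => hψne (Subtype.ext h)
    set s : ℂ := ((‖ψ₀‖⁻¹ : ℝ) : ℂ) with hs
    have hnorm : ‖s • ψ₀‖ = 1 := by
      rw [norm_smul, hs, Complex.norm_real, norm_inv, norm_norm,
        inv_mul_cancel₀ (norm_ne_zero_iff.2 hψ₀ne)]
    obtain ⟨ψ, hψ1, hψ2⟩ := mem_groundSpace.1 (A.groundSpace.smul_mem s hψ₀)
    rw [← hψ1] at hnorm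
    have hspan : A.groundSpace = ℂ ∙ (ψ : Hilb) := by
      refine ((finrank_eq_one_iff_of_nonzero' (V := A.groundSpace) ⟨ψ₀, hψ₀⟩ hψne).1
        (by rw [finrank_groundSpace, hrank]) |> fun h => le_antisymm (fun v hv => ?_) ?_)
      · obtain ⟨c, hc⟩ := h ⟨v, hv⟩
        have hc' : c • ψ₀ = v := congrArg Subtype.val hc
        rw [Submodule.mem_span_singleton]
        refine ⟨c * s⁻¹, ?_⟩
        have hs0 : s ≠ 0 := by
          rw [hs]
          exact Complex.ofReal_ne_zero.2 (inv_ne_zero (norm_ne_zero_iff.2 hψ₀ne))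
        rw [hψ1, smul_smul, inv_mul_cancel_right₀ hs0, hc']
      · rw [Submodule.span_singleton_le_iff_mem, hψ1]
        exact A.groundSpace.smul_mem s hψ₀
    have hproj : ∀ v : Hilb, ‖A.groundSpace.starProjection v‖ = ‖inner ℂ (ψ : Hilb) v‖ := by
      intro v
      have h1 : A.groundSpace.starProjection v = inner ℂ (ψ : Hilb) v • (ψ : Hilb) := by
        refine Submodule.eq_starProjection_of_mem_orthogonal (hspan ▸
          Submodule.smul_mem _ _ (Submodule.mem_span_singleton_self _)) ?_
        rw [Submodule.mem_orthogonal]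
        intro u hu
        rw [hspan, Submodule.mem_span_singleton] at hu
        obtain ⟨c, rfl⟩ := hu
        rw [inner_smul_left, inner_sub_right, inner_smul_right, inner_self_eq_norm_sq_to_K, hnorm]
        simp
      rw [h1, norm_smul, hnorm, mul_one]
    -- An error `η` in `ψ` costs at most `2 (q - a) η² ‖x‖²`, to be absorbed by `q - q₁`.
    obtain ⟨η, hη0, hη⟩ : ∃ η : ℝ, 0 < η ∧ 2 * (q - A.bottom) * η ^ 2 ≤ q - q₁ := by
      have h0 : 0 < q - A.bottom := sub_pos.2 hq
      refine ⟨min 1 ((q - q₁) / (2 * (q - A.bottom))), lt_min one_pos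
        (div_pos (sub_pos.2 hq₁) (by linarith)), ?_⟩
      set m := min 1 ((q - q₁) / (2 * (q - A.bottom)))
      have hm1 : m ≤ 1 := min_le_left _ _
      have hm2 : m ≤ (q - q₁) / (2 * (q - A.bottom)) := min_le_right _ _
      have hm0 : 0 < m := lt_min one_pos (div_pos (sub_pos.2 hq₁) (by linarith))
      rw [le_div_iff₀ (by linarith)] at hm2
      nlinarith
    -- One vector plays both roles: close to `ψ` for the form bound, and of energy below `q₁` as a
    -- witness for `a < q₁`.
    obtain ⟨N, w, D, hw, hD⟩ := hA.exists_gaussianInt_mem ψ (U := {z | ‖z.1 - ψ‖ < η} ∩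
        {z | (inner ℂ z.1 z.2).re - q₁ * ‖z.1‖ ^ 2 < 0}) (by
      refine Filter.inter_mem ?_ ?_
      · refine (isOpen_lt (by fun_prop) continuous_const).mem_nhds ?_
        simpa using hη0
      · refine (isOpen_lt (continuous_energy q₁) continuous_const).mem_nhds ?_
        change A.form ψ - q₁ * ‖(ψ : Hilb)‖ ^ 2 < 0
        rw [form_of_eigenvector (by rw [hψ2]), hnorm]
        linarith)
    obtain ⟨hD1, hD2⟩ := hD
    rw [Set.mem_ofPred_eq] at hD1 hD2
    rw [energy_smul] at hD2
    obtain ⟨m₁, m₂, hrat, h3, -, h5, h0, -⟩ := exists_code q₁ K 0 N hw hw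
    have hvec : codeVec (decode m₁ m₂) 0 = vec N w := by rw [codeVec, h5, vec_congr h0]
    refine ⟨m₁, m₂, fun k₁ k₂ => ⟨?_, ?_⟩⟩
    · rw [energy_eq, hvec, h5, vecImage_congr h0, hrat]
      by_contra! hn
      exact absurd hD2 (not_lt.2 (mul_nonneg (sq_nonneg _) hn))
    · obtain ⟨x, hx1, hx2⟩ := hA.exists_vec (decode k₁ k₂ 5) (codeCoord (decode k₁ k₂) 0)
      rw [simpleTest_inner, energy_eq, hvec, hrat, h3, ← hx2, codeVec, ← hx1]
      change 0 ≤ A.form x - q₁ * ‖(x : Hilb)‖ ^ 2 +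
        K * Complex.normSq (inner ℂ (vec N w) (x : Hilb))
      have h6 := hA.le_form_add_projection hq hgap x
      rw [hproj] at h6
      have h7 : ‖inner ℂ (ψ : Hilb) (x : Hilb)‖ ≤ ‖inner ℂ (vec N w) (x : Hilb)‖ +
          η * ‖(x : Hilb)‖ := by
        set u : Hilb := ((((D : ℝ) + 1)⁻¹ : ℝ) : ℂ) • vec N w with hu
        have h8 : inner ℂ (ψ : Hilb) (x : Hilb) =
            inner ℂ u (x : Hilb) - inner ℂ (u - ψ) (x : Hilb) := by
          rw [inner_sub_left]; ring
        have h9 : ‖inner ℂ (u - ψ) (x : Hilb)‖ ≤ η * ‖(x : Hilb)‖ :=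
          (norm_inner_le_norm _ _).trans (mul_le_mul_of_nonneg_right hD1.le (norm_nonneg _))
        -- As `(D + 1)⁻¹ ≤ 1`, dropping the denominator only enlarges the correction term.
        have h10 : ‖inner ℂ u (x : Hilb)‖ ≤ ‖inner ℂ (vec N w) (x : Hilb)‖ := by
          rw [hu, inner_smul_left, norm_mul, RCLike.norm_conj, Complex.norm_real, norm_inv,
            Real.norm_eq_abs, abs_of_pos (by positivity : (0 : ℝ) < (D : ℝ) + 1)]
          refine mul_le_of_le_one_left (norm_nonneg _) (inv_le_one_of_one_le₀ ?_)
          have : (0 : ℝ) ≤ D := Nat.cast_nonneg D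
          linarith
        rw [h8]
        exact (norm_sub_le _ _).trans (add_le_add h10 h9)
      have h8 := norm_sq_le_of_norm_le (norm_nonneg _) h7
      rw [Complex.normSq_eq_norm_sq]
      have h9 : 0 < q - A.bottom := sub_pos.2 hq
      have h10 := mul_le_mul_of_nonneg_left h8 h9.le
      have h11 := mul_le_mul_of_nonneg_right hη (sq_nonneg ‖(x : Hilb)‖)
      have h12 := mul_le_mul_of_nonneg_right hK (sq_nonneg ‖inner ℂ (vec N w) (x : Hilb)‖)
      linear_combination h6 + h10 + h11 + h12
  · rintro ⟨m₁, m₂, h⟩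
    set p := decode m₁ m₂
    have hq := hA.bottom_lt_of_energy (h 0 0).1
    let F : Hilb →L[ℂ] ℂ := innerSL ℂ (codeVec p 0)
    have hform := hA.le_form_of_code (q := codeRat p) (K := p 3) (G := fun x => ‖F x‖ ^ 2)
      (by fun_prop) (fun t z => by
        rw [map_smul, norm_smul, Complex.norm_real, mul_pow, Real.norm_eq_abs, sq_abs])
      (fun k₁ k₂ => by
        have := (h k₁ k₂).2
        rwa [simpleTest_inner, Complex.normSq_eq_norm_sq] at this)
    have hiso := hA.isIsolated_of_finiteRank F hq hform
    have hinj := injective_of_finiteRank F hq hform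
    have hfin : FiniteDimensional ℂ (A.eigenspace (A.bottom : ℂ)) :=
      FiniteDimensional.of_injective _ hinj
    refine ⟨hiso, le_antisymm ?_ ?_⟩
    · simpa using LinearMap.finrank_le_finrank_of_injective hinj
    · have : Nontrivial (A.eigenspace (A.bottom : ℂ)) :=
        Submodule.nontrivial_iff_ne_bot.2 (eigenspace_bottom_ne_bot hA hiso)
      exact Module.finrank_pos

theorem finiteTest_sum (p : ℕ → ℕ) (n : ℕ) :
    ∑ i ∈ Finset.range n, Complex.normSq (codeCoord p 0 i) = ‖proj n (codeVec p 0)‖ ^ 2 := by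
  rw [norm_proj_sq]
  exact Finset.sum_congr rfl fun i _ => by rw [codeVec_apply]

/-- The first `n` coordinates. -/
def coordMap (n : ℕ) : Hilb →L[ℂ] EuclideanSpace ℂ (Fin n) :=
  (EuclideanSpace.equiv (Fin n) ℂ).symm.toContinuousLinearMap ∘L
    ContinuousLinearMap.pi fun i => innerSL ℂ (e i)

/-- `coordMap n` stands in for `proj n` because `isIsolated_of_finiteRank` asks for a
finite-dimensional codomain. -/
theorem norm_coordMap_sq (n : ℕ) (x : Hilb) : ‖coordMap n x‖ ^ 2 = ‖proj n x‖ ^ 2 := by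
  rw [EuclideanSpace.norm_sq_eq, norm_proj_sq, Finset.sum_range]
  refine Finset.sum_congr rfl fun i _ => ?_
  have : coordMap n x i = x i := inner_e i x
  rw [this, Complex.normSq_eq_norm_sq]

theorem IsAdmissible.exists_gaussianInt_energy (hA : A.IsAdmissible) {q : ℝ} (hq : A.bottom < q) :
    ∃ N w, IsGaussianInt w ∧ (inner ℂ (vec N w) (A.vecImage N w)).re - q * ‖vec N w‖ ^ 2 < 0 := by
  obtain ⟨x, hx⟩ := (hA.bottom_lt_iff q).1 hq
  exact hA.exists_gaussianInt_lt_zero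
    (Φ := fun z => (inner ℂ z.1 z.2).re - q * ‖z.1‖ ^ 2)
    (continuous_energy q) (energy_smul q) (x := x) (sub_neg.2 hx)

/-- As for simple eigenvalues, but the ground projection is dominated by the first `n` coordinates
up to `η ‖x‖`, so the correction needs no knowledge of the eigenvectors. -/
theorem IsAdmissible.bottomKind_le_two_iff (hA : A.IsAdmissible) : (A.bottomKind : ℕ) ≤ 2 ↔
    ∃ m₁ m₂, ∀ k₁ k₂, FiniteTest A.entry (decode m₁ m₂) (decode k₁ k₂) := by
  rw [Op.bottomKind_le_two_iff hA]
  constructor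
  · rintro ⟨hiso, hfin⟩
    obtain ⟨q, hq, hgap⟩ := (isIsolated_bottom_iff hA).1 hiso
    obtain ⟨q₁, haq₁, hq₁⟩ := exists_rat_btwn hq
    obtain ⟨K, hK⟩ := exists_nat_ge (2 * (q - A.bottom))
    obtain ⟨N, w, hw, hneg⟩ := hA.exists_gaussianInt_energy haq₁
    obtain ⟨η, hη0, hη⟩ : ∃ η : ℝ, 0 < η ∧ 2 * (q - A.bottom) * η ^ 2 ≤ q - q₁ := by
      have h0 : 0 < q - A.bottom := sub_pos.2 hq
      refine ⟨√((q - q₁) / (2 * (q - A.bottom))), Real.sqrt_pos.2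
        (div_pos (sub_pos.2 hq₁) (by linarith)), ?_⟩
      rw [Real.sq_sqrt (div_pos (sub_pos.2 hq₁) (by linarith)).le,
        mul_div_cancel₀ _ (by linarith)]
    obtain ⟨n, hn⟩ := exists_norm_starProjection_le A.groundSpace hη0
    obtain ⟨m₁, m₂, hrat, h3, h4, h5, h0, -⟩ := exists_code q₁ K n N hw hw
    refine ⟨m₁, m₂, fun k₁ k₂ => ⟨?_, ?_⟩⟩
    · rwa [energy_eq, codeVec, h5, vec_congr h0, vecImage_congr h0, hrat]
    · obtain ⟨x, hx1, hx2⟩ := hA.exists_vec (decode k₁ k₂ 5) (codeCoord (decode k₁ k₂) 0)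
      rw [finiteTest_sum, energy_eq, hrat, h3, h4, ← hx2, codeVec, ← hx1]
      change 0 ≤ A.form x - q₁ * ‖(x : Hilb)‖ ^ 2 + K * ‖proj n x‖ ^ 2
      have h6 := hA.le_form_add_projection hq hgap x
      have h8 := norm_sq_le_of_norm_le (norm_nonneg _) (hn x)
      have h9 : 0 < q - A.bottom := sub_pos.2 hq
      have h10 := mul_le_mul_of_nonneg_left h8 h9.le
      have h11 := mul_le_mul_of_nonneg_right hη (sq_nonneg ‖(x : Hilb)‖)
      have h12 := mul_le_mul_of_nonneg_right hK (sq_nonneg ‖proj n (x : Hilb)‖)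
      linear_combination h6 + h10 + h11 + h12
  · rintro ⟨m₁, m₂, h⟩
    set p := decode m₁ m₂
    have hq := hA.bottom_lt_of_energy (h 0 0).1
    have hform := hA.le_form_of_code (q := codeRat p) (K := p 3)
      (G := fun x => ‖coordMap (p 4) x‖ ^ 2)
      (by fun_prop) (fun t z => by
        rw [map_smul, norm_smul, Complex.norm_real, mul_pow, Real.norm_eq_abs, sq_abs])
      (fun k₁ k₂ => by
        have := (h k₁ k₂).2
        rwa [finiteTest_sum, ← norm_coordMap_sq] at this)
    exact ⟨hA.isIsolated_of_finiteRank _ hq hform,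
      FiniteDimensional.of_injective _ (injective_of_finiteRank _ hq hform)⟩

theorem gapTest_sum (A : Op) (k : ℕ → ℕ) (M : ℕ) (c : ℝ) : ∑ i ∈ Finset.range M,
    Complex.normSq (∑ j ∈ Finset.range (k 5), A.entry i j * codeCoord k 1 j -
      (c : ℂ) * codeCoord k 1 i) =
    ‖proj M (A.vecImage (k 5) (codeCoord k 1) - (c : ℂ) • codeVec k 1)‖ ^ 2 := by
  rw [norm_proj_sq]
  refine Finset.sum_congr rfl fun i _ => ?_
  rw [lp.coeFn_sub, Pi.sub_apply, vecImage_apply, lp.coeFn_smul, Pi.smul_apply, codeVec_apply,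
    smul_eq_mul]

theorem proj_vec {N M : ℕ} (h : N ≤ M) (w : ℕ → ℂ) : proj M (vec N w) = vec N w := by
  rw [proj_apply, ← vec_extend h w]
  refine Finset.sum_congr rfl fun j _ => ?_
  rw [vec_extend h, vec_apply]

theorem mulProj_vec (A : Op) (N : ℕ) (w : ℕ → ℂ) : A.mulProj N (vec N w) = A.vecImage N w := by
  rw [mulProj, sum_apply, vecImage]
  refine Finset.sum_congr rfl fun j hj => ?_
  rw [ContinuousLinearMap.smulRight_apply, innerSL_apply_apply, inner_e, vec_apply,
    if_pos (Finset.mem_range.1 hj)]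

/-- Bounds the part of `A x` beyond the first `f N` coordinates, which a finite computation does not
read. -/
theorem norm_sub_proj_le_dispersion (A : Op) (f : ℕ → ℕ) (N : ℕ) (w : ℕ → ℂ) :
    ‖A.vecImage N w - proj (f N) (A.vecImage N w)‖ ≤ A.dispersion f N * ‖vec N w‖ := by
  have h1 := ((ContinuousLinearMap.id ℂ Hilb - proj (f N)) ∘L A.mulProj N).le_opNorm (vec N w)
  rw [ContinuousLinearMap.comp_apply, mulProj_vec, sub_apply,
    ContinuousLinearMap.id_apply] at h1
  exact h1.trans (mul_le_mul_of_nonneg_right (le_max_left _ _) (norm_nonneg _))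

/-- A code `k` offers a number `r` with `a < r < q` and a vector violating the bound `‖(A - (q +
r)/2) x‖ ≥ (q - r)/2 ‖x‖` that holds when the open interval from `r` to `q` is free of spectrum. The
test overestimates the left side by the dispersion bound, so a detected violation is genuine; as `c`
tends to `0`, every genuine one is detected. -/
theorem IsAdmissible.bottomKind_le_three_iff (hA : A.IsAdmissible) {f : ℕ → ℕ} {c : ℕ → ℝ}
    (hf : ∀ n, n ≤ f n) (hc : Tendsto c atTop (𝓝 0)) (hd : ∀ n, A.dispersion f n ≤ c n) :
    (A.bottomKind : ℕ) ≤ 3 ↔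
    ∃ m₁ m₂, ∀ k₁ k₂, GapTest A.entry c f (decode m₁ m₂) (decode k₁ k₂) := by
  have hs := hA.selfAdjoint
  rw [Op.bottomKind_le_three_iff hA, isIsolated_bottom_iff hA]
  constructor
  · rintro ⟨q, hq, hgap⟩
    obtain ⟨q₁, haq₁, hq₁⟩ := exists_rat_btwn hq
    obtain ⟨N, w, hw, hneg⟩ := hA.exists_gaussianInt_energy haq₁
    obtain ⟨m₁, m₂, hrat, -, -, h5, h0, -⟩ := exists_code q₁ 0 0 N hw hw
    refine ⟨m₁, m₂, fun k₁ k₂ => ⟨?_, ?_⟩⟩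
    · rwa [energy_eq, codeVec, h5, vec_congr h0, vecImage_congr h0, hrat]
    · rintro ⟨hlt, hen, hsum⟩
      set k := decode k₁ k₂
      rw [hrat] at hlt hsum
      set r := codeRat k
      have har := hA.bottom_lt_of_energy hen
      obtain ⟨x, hx1, hx2⟩ := hA.exists_vec (k 5) (codeCoord k 1)
      have h1 := le_norm_map_sub hs (c := (q₁ + r) / 2) (d := (q₁ - r) / 2) (by linarith)
        (fun t ht hm => by
          rw [abs_lt] at ht
          have := hgap t hm (by linarith [ht.2])
          linarith [ht.1]) x
      have h2 := pow_le_pow_left₀ (mul_nonneg (by linarith) (norm_nonneg _)) h1 2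
      have hvec : codeVec k 1 = vec (k 5) (codeCoord k 1) := rfl
      rw [gapTest_sum, ← norm_vec_sq, ← hvec] at hsum
      rw [mul_pow, hx2, hx1, ← hvec, norm_sq_eq_proj (f (k 5)) (A.vecImage (k 5) _ - _)] at h2
      -- Since `N ≤ f N`, the projection fixes the vector itself, and only `A x` has an unread part.
      have h3 : A.vecImage (k 5) (codeCoord k 1) - (((q₁ + r) / 2 : ℝ) : ℂ) • codeVec k 1 -
          proj (f (k 5)) (A.vecImage (k 5) (codeCoord k 1) -
            (((q₁ + r) / 2 : ℝ) : ℂ) • codeVec k 1) =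
          A.vecImage (k 5) (codeCoord k 1) - proj (f (k 5)) (A.vecImage (k 5) (codeCoord k 1)) := by
        rw [map_sub, map_smul, hvec, proj_vec (hf _)]
        abel
      rw [h3] at h2
      have h4 : ‖A.vecImage (k 5) (codeCoord k 1) -
          proj (f (k 5)) (A.vecImage (k 5) (codeCoord k 1))‖ ≤ c (k 5) * ‖codeVec k 1‖ :=
        (norm_sub_proj_le_dispersion A f _ _).trans
          (mul_le_mul_of_nonneg_right (hd _) (norm_nonneg _))
      have h5 := pow_le_pow_left₀ (norm_nonneg _) h4 2
      rw [mul_pow] at h5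
      linarith
  · rintro ⟨m₁, m₂, h⟩
    set p := decode m₁ m₂
    refine ⟨codeRat p, hA.bottom_lt_of_energy (h 0 0).1, fun t ht htq => ?_⟩
    by_contra hne
    have hat : A.bottom < t := (hA.isLeast_bottom.2 ht).lt_of_ne (Ne.symm hne)
    -- A spectral point `t` with `a < t < q` is separated from `a` by a rational `r`; then `t` is
    -- closer than `(q - r)/2` to the midpoint of `r` and `q`.
    obtain ⟨r, har, hrt⟩ := exists_rat_btwn hat
    set q := codeRat p
    obtain ⟨x, hx⟩ : ∃ x : A.domain, ‖A x - (((q + r) / 2 : ℝ) : ℂ) • (x : Hilb)‖ <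
        (q - r) / 2 * ‖(x : Hilb)‖ := by
      by_contra! hn
      exact notMem_spectrum_of_abs_sub_lt hs hn (t := t) (by rw [abs_lt]; constructor <;> linarith) ht
    have hx' : ‖A x - (((q + r) / 2 : ℝ) : ℂ) • (x : Hilb)‖ ^ 2 -
        ((q - r) / 2) ^ 2 * ‖(x : Hilb)‖ ^ 2 < 0 := by
      rw [← mul_pow, sub_neg]
      exact pow_lt_pow_left₀ hx (norm_nonneg _) two_ne_zero
    obtain ⟨N₁, w₁, hw₁, hneg₁⟩ := hA.exists_gaussianInt_lt_zero
      (Φ := fun z => ‖z.2 - (((q + r) / 2 : ℝ) : ℂ) • z.1‖ ^ 2 - ((q - r) / 2) ^ 2 * ‖z.1‖ ^ 2)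
      (by fun_prop) (fun t z => by
        rw [Prod.smul_fst, Prod.smul_snd, smul_comm, ← smul_sub, norm_smul, norm_smul,
          Complex.norm_real, mul_pow, mul_pow, Real.norm_eq_abs, sq_abs]
        ring) hx'
    obtain ⟨N₀, w₀, hw₀, hneg₀⟩ := hA.exists_gaussianInt_energy har
    -- Padding to length `N` changes neither the vector nor its image, while the error `c N` tends
    -- to `0`; the strict inequality survives for large `N`.
    have hlim : Tendsto (fun N => ‖A.vecImage N₁ w₁ - (((q + r) / 2 : ℝ) : ℂ) • vec N₁ w₁‖ ^ 2 +
        c N ^ 2 * ‖vec N₁ w₁‖ ^ 2) atTop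
        (𝓝 (‖A.vecImage N₁ w₁ - (((q + r) / 2 : ℝ) : ℂ) • vec N₁ w₁‖ ^ 2 +
          0 ^ 2 * ‖vec N₁ w₁‖ ^ 2)) :=
      tendsto_const_nhds.add ((hc.pow 2).mul_const _)
    obtain ⟨N, hN, hN₀, hN₁⟩ := ((hlim.eventually_lt_const (u := ((q - r) / 2) ^ 2 *
      ‖vec N₁ w₁‖ ^ 2) (by simpa using hneg₁)).and
      ((eventually_ge_atTop N₀).and (eventually_ge_atTop N₁))).exists
    obtain ⟨k₁, k₂, hrat, -, -, h5, h0, h1⟩ := exists_code r 0 0 N (hw₀.extend N₀) (hw₁.extend N₁)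
    refine (h k₁ k₂).2 ⟨?_, ?_, ?_⟩
    · rw [hrat]
      linarith
    · rwa [energy_eq, codeVec, h5, vec_congr h0, vecImage_congr h0, vec_extend hN₀,
        vecImage_extend hN₀, hrat]
    · rw [gapTest_sum, ← norm_vec_sq, codeVec, h5, hrat, vec_congr h1, vecImage_congr h1,
        vec_extend hN₁, vecImage_extend hN₁]
      refine lt_of_le_of_lt (add_le_add_left ?_ _) hN
      rw [norm_proj_sq]
      exact sum_normSq_le _ _

end Op

end SCI

end

/-! ### The tests as expressions, and the upper bounds -/

noncomputable section

namespace SCI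

open Filter Topology

/-- Complex-valued expressions. -/
structure CExpr where
  /-- real part -/
  re : Expr
  /-- imaginary part -/
  im : Expr

namespace CExpr

/-- The value of a complex expression. -/
def eval (o : ℕ → ℂ) (a : CExpr) (v : ℕ → ℝ) : ℂ := ⟨a.re.eval o v, a.im.eval o v⟩

instance : Sub CExpr := ⟨fun a b => ⟨a.re - b.re, a.im - b.im⟩⟩
instance : Mul CExpr := ⟨fun a b => ⟨a.re * b.re - a.im * b.im, a.re * b.im + a.im * b.re⟩⟩

/-- Complex conjugate. -/
def conj (a : CExpr) : CExpr := ⟨a.re, 0 - a.im⟩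

/-- Multiplication by a real number. -/
def smul (c : Expr) (a : CExpr) : CExpr := ⟨c * a.re, c * a.im⟩

/-- The square of the absolute value. -/
def normSq (a : CExpr) : Expr := a.re * a.re + a.im * a.im

/-- Bounded sum. -/
def sum (i : ℕ) (b : Expr) (a : CExpr) : CExpr := ⟨.sum i b a.re, .sum i b a.im⟩

/-- The oracle's value. -/
def query (a : Expr) : CExpr := ⟨.re a, .im a⟩

variable (o : ℕ → ℂ) (v : ℕ → ℝ)

theorem eval_sub (a b : CExpr) : (a - b).eval o v = a.eval o v - b.eval o v := rfl

theorem eval_mul (a b : CExpr) : (a * b).eval o v = a.eval o v * b.eval o v := rfl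

theorem eval_conj (a : CExpr) : a.conj.eval o v = (starRingEnd ℂ) (a.eval o v) := by
  apply Complex.ext <;> simp [eval, conj]

theorem eval_smul (c : Expr) (a : CExpr) :
    (smul c a).eval o v = (c.eval o v : ℂ) * a.eval o v := by
  apply Complex.ext <;> simp [eval, smul]

theorem eval_normSq (a : CExpr) : a.normSq.eval o v = Complex.normSq (a.eval o v) := rfl

theorem re_eval (a : CExpr) : a.re.eval o v = (a.eval o v).re := rfl

theorem eval_sum (i : ℕ) (b : Expr) (a : CExpr) {n : ℕ} (hb : b.eval o v = n) :
    (sum i b a).eval o v = ∑ k ∈ Finset.range n, a.eval o (Function.update v i k) := by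
  apply Complex.ext
  · rw [Complex.re_sum]
    exact Expr.eval_sum o v i b a.re hb
  · rw [Complex.im_sum]
    exact Expr.eval_sum o v i b a.im hb

theorem eval_query {a : Expr} {n : ℕ} (h : a.eval o v = n) : (query a).eval o v = o n := by
  simp [query, eval, Expr.eval, h, Machine.addr]

end CExpr

namespace Expr

variable {o : ℕ → ℂ} {v : ℕ → ℝ}

/-- Remainder. -/
def mod (a b : Expr) : Expr := a - b * floor (a / b)

theorem eval_mod {a b : Expr} {m n : ℕ} (ha : a.eval o v = m) (hb : b.eval o v = n) :
    (mod a b).eval o v = (m % n : ℕ) := by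
  simp only [mod, eval_sub, eval_mul, eval_floor, eval_div, ha, hb, Nat.floor_div_eq_div]
  rw [sub_eq_iff_eq_add]
  exact_mod_cast (Nat.mod_add_div m n).symm

/-- The number with index `i` in the code that is given by the variables `a` and `a + 1`. -/
def decode (a : ℕ) (i : Expr) : Expr := mod (var a) ((i + 1) * var (a + 1) + 1)

/-- The variables `a` and `a + 1` have the values `m₁` and `m₂`. -/
def HasCode (v : ℕ → ℝ) (a m₁ m₂ : ℕ) : Prop := v a = m₁ ∧ v (a + 1) = m₂

theorem HasCode.update {a m₁ m₂ : ℕ} (h : HasCode v a m₁ m₂) {i : ℕ} (hi : a + 1 < i) (x : ℝ) :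
    HasCode (Function.update v i x) a m₁ m₂ := by
  constructor
  · rw [Function.update_of_ne (by omega), h.1]
  · rw [Function.update_of_ne (by omega), h.2]

variable {a m₁ m₂ : ℕ}

theorem eval_decode (h : HasCode v a m₁ m₂) {i : Expr} {n : ℕ} (hi : i.eval o v = n) :
    (decode a i).eval o v = Op.decode m₁ m₂ n := by
  refine eval_mod h.1 ?_
  simp [hi, h.2]

/-- The rational number in a code. -/
def codeRat (a : ℕ) : Expr := (decode a 0 - decode a 1) / (decode a 2 + 1)

theorem eval_codeRat (h : HasCode v a m₁ m₂) :
    (codeRat a).eval o v = Op.codeRat (Op.decode m₁ m₂) := by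
  simp only [codeRat, eval_div, eval_sub, eval_add, eval_one, eval_decode h (i := 0) (n := 0)
    (by simp), eval_decode h (i := 1) (n := 1) (by simp), eval_decode h (i := 2) (n := 2) (by simp)]
  rfl

/-- The number of coordinates in a code. -/
def codeLength (a : ℕ) : Expr := decode a 5

theorem eval_codeLength (h : HasCode v a m₁ m₂) :
    (codeLength a).eval o v = Op.decode m₁ m₂ 5 := eval_decode h (by simp)

theorem Decides.ite {c : Expr} {p : Prop} [Decidable p] (h : c.Decides o v p) (d : Expr) :
    (c * d).eval o v = if p then d.eval o v else 0 := by
  unfold Decides at h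
  by_cases hp : p <;> simp [h, hp]

/-- The coordinates of the vector with number `s` in a code. -/
def codeCoord (a : ℕ) (s : ℕ) (i : Expr) : CExpr :=
  ⟨le (i + 1) (codeLength a) * (decode a (8 + 4 * i + 2 * const s) - decode a 6),
    le (i + 1) (codeLength a) * (decode a (9 + 4 * i + 2 * const s) - decode a 6)⟩

theorem eval_codeCoord (h : HasCode v a m₁ m₂) (s : ℕ) {i : Expr} {n : ℕ} (hi : i.eval o v = n) :
    (codeCoord a s i).eval o v = Op.codeCoord (Op.decode m₁ m₂) s n := by
  have h1 : (le (i + 1) (codeLength a)).Decides o v (n < Op.decode m₁ m₂ 5) := by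
    have := decides_le (o := o) (v := v) (i + 1) (codeLength a)
    rw [eval_codeLength h, eval_add, hi, eval_one] at this
    have h2 : (n : ℝ) + 1 ≤ Op.decode m₁ m₂ 5 ↔ n < Op.decode m₁ m₂ 5 := by
      rw [← Nat.cast_succ, Nat.cast_le]
      exact Nat.succ_le_iff
    rwa [h2] at this
  have hs : (const s : Expr).eval o v = s := by simp [eval]
  rw [Op.codeCoord]
  apply Complex.ext
  · rw [← CExpr.re_eval, codeCoord, h1.ite, eval_sub,
      eval_decode h (n := 8 + 4 * n + 2 * s) (by simp [hi, hs]), eval_decode h (n := 6) (by simp)]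
    split_ifs <;> rfl
  · change (codeCoord a s i).im.eval o v = _
    rw [codeCoord, h1.ite, eval_sub,
      eval_decode h (n := 9 + 4 * n + 2 * s) (by simp [hi, hs]), eval_decode h (n := 6) (by simp)]
    split_ifs <;> rfl

/-- The matrix expression `mat` evaluates to the matrix `A`. -/
def IsMatrix (o : ℕ → ℂ) (mat : Expr → Expr → CExpr) (A : ℕ → ℕ → ℂ) : Prop :=
  ∀ (v : ℕ → ℝ) (i j : Expr) (m n : ℕ), i.eval o v = (m : ℝ) → j.eval o v = (n : ℝ) → (mat i j).eval o v = A m n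

variable {mat : Expr → Expr → CExpr} {A : ℕ → ℕ → ℂ}

/-- The sum of the squares of the first coordinates. -/
def codeNormSq (a s : ℕ) (b : Expr) : Expr := sum 6 b (codeCoord a s (var 6)).normSq

/-- The bounded sums use the variables `6` and `7`, beyond the variables `2` to `5` that hold the
codes; `ha` ensures that the code survives the updates. -/
theorem eval_codeNormSq (ha : a + 1 < 6) (h : HasCode v a m₁ m₂) (s : ℕ) {b : Expr} {n : ℕ}
    (hb : b.eval o v = n) : (codeNormSq a s b).eval o v =
      ∑ i ∈ Finset.range n, Complex.normSq (Op.codeCoord (Op.decode m₁ m₂) s i) := by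
  rw [codeNormSq, eval_sum o v 6 _ _ hb]
  refine Finset.sum_congr rfl fun k _ => ?_
  rw [CExpr.eval_normSq, eval_codeCoord (h.update ha k) s (n := k) (by simp)]

/-- The energy `⟨(A - q) x, x⟩` of the vector with number `s` in a code. -/
def energy (mat : Expr → Expr → CExpr) (a s : ℕ) (q : Expr) : Expr :=
  (CExpr.sum 6 (codeLength a) (CExpr.sum 7 (codeLength a)
    ((codeCoord a s (var 6)).conj * codeCoord a s (var 7) * mat (var 6) (var 7)))).re -
  q * codeNormSq a s (codeLength a)

theorem eval_energy (hm : IsMatrix o mat A) (ha : a + 1 < 6) (h : HasCode v a m₁ m₂) (s : ℕ)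
    (q : Expr) : (energy mat a s q).eval o v =
      Op.energy A (Op.decode m₁ m₂) s (q.eval o v) := by
  rw [energy, eval_sub, eval_mul, eval_codeNormSq ha h s (eval_codeLength h), CExpr.re_eval,
    CExpr.eval_sum o v 6 _ _ (eval_codeLength h), Op.energy]
  congr 2
  refine Finset.sum_congr rfl fun i _ => ?_
  rw [CExpr.eval_sum _ _ 7 _ _ (eval_codeLength (h.update ha i))]
  refine Finset.sum_congr rfl fun j _ => ?_
  have h' := (h.update ha i).update (i := 7) (by omega) j
  rw [CExpr.eval_mul, CExpr.eval_mul, CExpr.eval_conj, eval_codeCoord h' s (n := i) (by simp),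
    eval_codeCoord h' s (n := j) (by simp), hm _ _ _ i j (by simp) (by simp)]

variable {k₁ k₂ : ℕ}

/-- The expression for `Op.SimpleTest`. -/
def simpleTest (mat : Expr → Expr → CExpr) : Expr :=
  not (le 0 (energy mat 2 0 (codeRat 2))) * le 0 (energy mat 4 0 (codeRat 2) + decode 2 3 *
    (CExpr.sum 6 (codeLength 4) ((codeCoord 2 0 (var 6)).conj * codeCoord 4 0 (var 6))).normSq)

theorem decides_simpleTest (hm : IsMatrix o mat A) (h : HasCode v 2 m₁ m₂) (h' : HasCode v 4 k₁ k₂) :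
    (simpleTest mat).Decides o v (Op.SimpleTest A (Op.decode m₁ m₂) (Op.decode k₁ k₂)) := by
  have h1 := decides_lt (o := o) (v := v) (energy mat 2 0 (codeRat 2)) 0
  have h2 := decides_le (o := o) (v := v) 0 (energy mat 4 0 (codeRat 2) + decode 2 3 *
    (CExpr.sum 6 (codeLength 4) ((codeCoord 2 0 (var 6)).conj * codeCoord 4 0 (var 6))).normSq)
  rw [eval_energy hm (by norm_num) h, eval_codeRat h, eval_zero] at h1
  rw [eval_add, eval_mul, eval_energy hm (by norm_num) h', eval_codeRat h, eval_zero,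
    eval_decode h (n := 3) (by simp), CExpr.eval_normSq,
    CExpr.eval_sum _ _ 6 _ _ (eval_codeLength h')] at h2
  have h3 : ∀ i : ℕ, ((codeCoord 2 0 (var 6)).conj * codeCoord 4 0 (var 6)).eval o
      (Function.update v 6 i) = (starRingEnd ℂ) (Op.codeCoord (Op.decode m₁ m₂) 0 i) *
        Op.codeCoord (Op.decode k₁ k₂) 0 i := by
    intro i
    rw [CExpr.eval_mul, CExpr.eval_conj, eval_codeCoord (h.update (by norm_num) _) 0 (n := i) (by simp),
      eval_codeCoord (h'.update (by norm_num) _) 0 (n := i) (by simp)]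
  simp only [h3] at h2
  exact h1.and h2

/-- The expression for `Op.FiniteTest`. -/
def finiteTest (mat : Expr → Expr → CExpr) : Expr :=
  not (le 0 (energy mat 2 0 (codeRat 2))) * le 0 (energy mat 4 0 (codeRat 2) + decode 2 3 *
    codeNormSq 4 0 (decode 2 4))

theorem decides_finiteTest (hm : IsMatrix o mat A) (h : HasCode v 2 m₁ m₂) (h' : HasCode v 4 k₁ k₂) :
    (finiteTest mat).Decides o v (Op.FiniteTest A (Op.decode m₁ m₂) (Op.decode k₁ k₂)) := by
  have h1 := decides_lt (o := o) (v := v) (energy mat 2 0 (codeRat 2)) 0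
  have h2 := decides_le (o := o) (v := v) 0 (energy mat 4 0 (codeRat 2) + decode 2 3 *
    codeNormSq 4 0 (decode 2 4))
  rw [eval_energy hm (by norm_num) h, eval_codeRat h, eval_zero] at h1
  rw [eval_add, eval_mul, eval_energy hm (by norm_num) h', eval_codeRat h, eval_zero,
    eval_decode h (n := 3) (by simp),
    eval_codeNormSq (by norm_num) h' 0 (eval_decode h (n := 4) (by simp))] at h2
  exact h1.and h2

/-- The expression for `Op.GapTest`. -/
def gapTest (mat : Expr → Expr → CExpr) (bound size : Expr → Expr) : Expr :=
  not (le 0 (energy mat 2 0 (codeRat 2))) * not (not (le (codeRat 2) (codeRat 4)) *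
    (not (le 0 (energy mat 4 0 (codeRat 4))) * not (le
      ((codeRat 2 - codeRat 4) / 2 * ((codeRat 2 - codeRat 4) / 2) *
        codeNormSq 4 1 (codeLength 4))
      (sum 6 (size (codeLength 4)) (CExpr.sum 7 (codeLength 4)
          (mat (var 6) (var 7) * codeCoord 4 1 (var 7)) -
          CExpr.smul ((codeRat 2 + codeRat 4) / 2) (codeCoord 4 1 (var 6))).normSq +
        bound (codeLength 4) * bound (codeLength 4) * codeNormSq 4 1 (codeLength 4)))))

theorem decides_gapTest (hm : IsMatrix o mat A) {bound size : Expr → Expr} {c : ℕ → ℝ} {f : ℕ → ℕ}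
    (hc : ∀ (v : ℕ → ℝ) (i : Expr) (n : ℕ), i.eval o v = (n : ℝ) →
      (bound i).eval o v = c n)
    (hf : ∀ (v : ℕ → ℝ) (i : Expr) (n : ℕ), i.eval o v = (n : ℝ) →
      (size i).eval o v = f n)
    (h : HasCode v 2 m₁ m₂) (h' : HasCode v 4 k₁ k₂) :
    (gapTest mat bound size).Decides o v
      (Op.GapTest A c f (Op.decode m₁ m₂) (Op.decode k₁ k₂)) := by
  have h1 := decides_lt (o := o) (v := v) (energy mat 2 0 (codeRat 2)) 0
  have h2 := decides_lt (o := o) (v := v) (codeRat 4) (codeRat 2)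
  have h3 := decides_lt (o := o) (v := v) (energy mat 4 0 (codeRat 4)) 0
  have h4 := decides_lt (o := o) (v := v)
    (sum 6 (size (codeLength 4)) (CExpr.sum 7 (codeLength 4)
          (mat (var 6) (var 7) * codeCoord 4 1 (var 7)) -
          CExpr.smul ((codeRat 2 + codeRat 4) / 2) (codeCoord 4 1 (var 6))).normSq +
        bound (codeLength 4) * bound (codeLength 4) * codeNormSq 4 1 (codeLength 4))
    ((codeRat 2 - codeRat 4) / 2 * ((codeRat 2 - codeRat 4) / 2) *
        codeNormSq 4 1 (codeLength 4))
  rw [eval_energy hm (by norm_num) h, eval_codeRat h, eval_zero] at h1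
  rw [eval_codeRat h, eval_codeRat h'] at h2
  rw [eval_energy hm (by norm_num) h', eval_codeRat h', eval_zero] at h3
  have hsum : ∀ i : ℕ, (CExpr.sum 7 (codeLength 4) (mat (var 6) (var 7) * codeCoord 4 1 (var 7)) -
      CExpr.smul ((codeRat 2 + codeRat 4) / 2) (codeCoord 4 1 (var 6))).eval o
      (Function.update v 6 i) = ∑ j ∈ Finset.range (Op.decode k₁ k₂ 5),
        A i j * Op.codeCoord (Op.decode k₁ k₂) 1 j -
        ((Op.codeRat (Op.decode m₁ m₂) + Op.codeRat (Op.decode k₁ k₂)) / 2 : ℝ) *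
          Op.codeCoord (Op.decode k₁ k₂) 1 i := by
    intro i
    have g := h.update (i := 6) (by norm_num) (i : ℝ)
    have g' := h'.update (i := 6) (by norm_num) (i : ℝ)
    rw [CExpr.eval_sub, CExpr.eval_smul, CExpr.eval_sum _ _ 7 _ _ (eval_codeLength g'),
      eval_codeCoord g' 1 (n := i) (by simp), eval_div, eval_add, eval_codeRat g, eval_codeRat g',
      eval_ofNat]
    congr 1
    refine Finset.sum_congr rfl fun j _ => ?_
    have g2 := g'.update (i := 7) (by norm_num) (j : ℝ)
    rw [CExpr.eval_mul, eval_codeCoord g2 1 (n := j) (by simp),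
      hm _ _ _ i j (by simp) (by simp)]
  rw [eval_add, eval_mul, eval_mul, eval_mul, eval_mul, eval_div, eval_sub, eval_codeRat h,
    eval_codeRat h', eval_ofNat, hc _ _ _ (eval_codeLength h'),
    eval_codeNormSq (by norm_num) h' 1 (eval_codeLength h'),
    eval_sum _ _ 6 _ _ (hf _ _ _ (eval_codeLength h'))] at h4
  simp only [CExpr.eval_normSq, hsum, ← sq] at h4
  exact h1.and (h2.and (h3.and h4)).not

/-- The pairing function. -/
def pair (i j : Expr) : Expr :=
  le (i + 1) j * (j * j + i) + not (le (i + 1) j) * (i * i + i + j)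

theorem eval_pair {i j : Expr} {m n : ℕ} (hi : i.eval o v = m) (hj : j.eval o v = n) :
    (pair i j).eval o v = Nat.pair m n := by
  have h1 : (le (i + 1) j).Decides o v (m < n) := by
    have := decides_le (o := o) (v := v) (i + 1) j
    rw [eval_add, hi, hj, eval_one] at this
    have h2 : (m : ℝ) + 1 ≤ n ↔ m < n := by
      rw [← Nat.cast_succ, Nat.cast_le]
      exact Nat.succ_le_iff
    rwa [h2] at this
  rw [pair, eval_add, h1.ite, h1.not.ite, Nat.pair]
  by_cases h : m < n <;> simp [h, hi, hj]

end Expr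

open SCI.Expr

theorem inputs_hasValues (m n : ℕ) : (fun i => (([m, n].getD i 0 : ℕ) : ℝ)) 0 = m ∧
    (fun i => (([m, n].getD i 0 : ℕ) : ℝ)) 1 = n := by
  simp

open Classical in
/-- The truth value of a single proposition. -/
def truthValue (p : Unit → Prop) : Bool := decide (p ())

theorem truthValue_eq_true {p : Unit → Prop} : truthValue p = true ↔ p () := by
  simp [truthValue]

/-- The spectral gap problem is in `Σ₂`. -/
theorem gapProblem_inSigma (S : Set Op) (hS : ∀ A ∈ S, A.IsAdmissible) :
    (gapProblem S hS).InSigma .A 2 := by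
  let P := gapProblem S hS
  let mat : Expr → Expr → CExpr := fun i j => CExpr.query (pair i j)
  have hm : ∀ A, IsMatrix (fun i => P.eval i A) mat A.1.entry := fun A v i j m n hi hj => by
    rw [CExpr.eval_query _ _ (eval_pair hi hj)]
    change A.1.entry (Nat.pair m n).unpair.1 (Nat.pair m n).unpair.2 = _
    rw [Nat.unpair_pair]
  let R : Unit → S → ℕ → ℕ → ℕ → ℕ → Prop := fun _ A m₁ m₂ k₁ k₂ =>
    Op.SimpleTest A.1.entry (Op.decode m₁ m₂) (Op.decode k₁ k₂)
  have hP : ∀ A, P.problem A = truthValue fun j => ∃ m₁ m₂, ∀ k₁ k₂, R j A m₁ m₂ k₁ k₂ := by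
    intro A
    have h : P.problem A = true ↔ A.1.IsGapped := by simp [P, gapProblem]
    rw [Bool.eq_iff_iff, h, truthValue_eq_true, ← Op.bottomKind_le_one_iff, (hS A.1 A.2).bottomKind_le_one_iff]
  obtain ⟨Γ, hΓ, hval⟩ := P.exists_tower truthValue R hP
    (Expr.bounded (simpleTest mat)) (fun A m n => by
      have h := Decides.bounded (o := fun i => P.eval i A)
        (v := fun i => (([m, n].getD i 0 : ℕ) : ℝ)) (a := simpleTest mat)
        (p := fun m₁ m₂ k₁ k₂ => R () A m₁ m₂ k₁ k₂)
        (fun v m₁ m₂ k₁ k₂ h2 h3 h4 h5 => decides_simpleTest (hm A) ⟨h2, h3⟩ ⟨h4, h5⟩)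
        (inputs_hasValues m n).1 (inputs_hasValues m n).2
      rw [h]
      exact @if_congr _ _ _ (_) (_) _ _ _ _ (truthValue_eq_true
        (p := fun j => ∃ m₁ ≤ m, ∃ m₂ ≤ m, ∀ k₁ ≤ n, ∀ k₂ ≤ n, R j A m₁ m₂ k₁ k₂)).symm rfl rfl)
  refine ⟨⟨2, by norm_num, by norm_num, Γ, hΓ⟩, Γ, hΓ, fun n A => ?_⟩
  -- A witness below the bound `n` is a witness, so a premature answer `true` is never wrong.
  rw [hval, hP, Bool.le_iff_imp, truthValue_eq_true, truthValue_eq_true]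
  rintro ⟨m₁, -, m₂, -, h⟩
  exact ⟨m₁, m₂, h⟩

open Classical in
/-- The kind of the bottom that is given by the truth values of `kind ≤ 1, 2, 3`. -/
def kindOf (p : Fin 3 → Prop) : Set.Icc (1 : ℕ) 4 :=
  if p 0 then ⟨1, by simp⟩ else if p 1 then ⟨2, by simp⟩ else if p 2 then ⟨3, by simp⟩
  else ⟨4, by simp⟩

/-- More valid thresholds mean a smaller kind. Bounded existential quantifiers validate fewer
thresholds, whence convergence from above. -/
theorem kindOf_anti {p p' : Fin 3 → Prop} (h : ∀ j, p j → p' j) : kindOf p' ≤ kindOf p := by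
  have h0 := h 0
  have h1 := h 1
  have h2 := h 2
  rw [← Subtype.coe_le_coe]
  unfold kindOf
  split_ifs <;> tauto

theorem kindOf_eq (k : Set.Icc (1 : ℕ) 4) : kindOf (fun j => (k : ℕ) ≤ (j : ℕ) + 1) = k := by
  obtain ⟨k, h1, h4⟩ := k
  interval_cases k <;> simp [kindOf]

/-- The classification problem is in `Π₂`. -/
theorem classProblem_inPi (f : ℕ → ℕ) (hf : ∀ n, n ≤ f n) (C : Set (ℕ → ℚ))
    (S : Set (Op × (ℕ → ℚ))) (hS : ∀ p ∈ S, p.1.IsAdmissible) (hSC : S ⊆ dispersionClass f C) :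
    (classProblem f S hS).InPi .A 2 := by
  classical
  let P := classProblem f S hS
  let mat : Expr → Expr → CExpr := fun i j => CExpr.query (3 * pair i j)
  let bound : Expr → Expr := fun i => .re (3 * i + 1)
  let size : Expr → Expr := fun i => .re (3 * i + 2)
  have hm : ∀ A, IsMatrix (fun i => P.eval i A) mat A.1.1.entry := fun A v i j m n hi hj => by
    rw [CExpr.eval_query _ _ (n := 3 * Nat.pair m n) (by simp [eval_pair hi hj])]
    have h1 : 3 * Nat.pair m n % 3 = 0 := by omega
    have h2 : 3 * Nat.pair m n / 3 = Nat.pair m n := by omega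
    simp [P, classProblem, h1, h2]
  have hb : ∀ A : S, ∀ (v : ℕ → ℝ) (i : Expr) (n : ℕ),
      i.eval (fun i => P.eval i A) v = (n : ℝ) →
      (bound i).eval (fun i => P.eval i A) v = (A.1.2 n : ℝ) := fun A v i n hi => by
    have h0 : (3 * i + 1 : Expr).eval (fun i => P.eval i A) v = ((3 * n + 1 : ℕ) : ℝ) := by
      simp [hi]
    have h1 : (3 * n + 1) % 3 = 1 := by omega
    have h2 : (3 * n + 1) / 3 = n := by omega
    change (P.eval (Machine.addr ((3 * i + 1 : Expr).eval _ v)) A).re = _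
    rw [h0, Machine.addr, Nat.floor_natCast]
    simp [P, classProblem, h1, h2]
  have hs : ∀ A : S, ∀ (v : ℕ → ℝ) (i : Expr) (n : ℕ),
      i.eval (fun i => P.eval i A) v = (n : ℝ) →
      (size i).eval (fun i => P.eval i A) v = f n := fun A v i n hi => by
    have h0 : (3 * i + 2 : Expr).eval (fun i => P.eval i A) v = ((3 * n + 2 : ℕ) : ℝ) := by
      simp [hi]
    have h1 : (3 * n + 2) % 3 = 2 := by omega
    have h2 : (3 * n + 2) / 3 = n := by omega
    change (P.eval (Machine.addr ((3 * i + 2 : Expr).eval _ v)) A).re = _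
    rw [h0, Machine.addr, Nat.floor_natCast]
    simp [P, classProblem, h1, h2]
  let R : Fin 3 → S → ℕ → ℕ → ℕ → ℕ → Prop := fun j A m₁ m₂ k₁ k₂ =>
    (![Op.SimpleTest A.1.1.entry, Op.FiniteTest A.1.1.entry,
      Op.GapTest A.1.1.entry (fun n => (A.1.2 n : ℝ)) f] j) (Op.decode m₁ m₂) (Op.decode k₁ k₂)
  have hP : ∀ A, P.problem A = kindOf fun j => ∃ m₁ m₂, ∀ k₁ k₂, R j A m₁ m₂ k₁ k₂ := by
    intro A
    have hA := hS A.1 A.2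
    obtain ⟨-, -, hc, hd⟩ := hSC A.2
    refine (kindOf_eq A.1.1.bottomKind).symm.trans ?_
    congr 1
    funext j
    refine propext ?_
    fin_cases j
    · exact hA.bottomKind_le_one_iff
    · exact hA.bottomKind_le_two_iff
    · exact hA.bottomKind_le_three_iff hf hc hd
  let g₁ := Expr.bounded (simpleTest mat)
  let g₂ := Expr.bounded (finiteTest mat)
  let g₃ := Expr.bounded (gapTest mat bound size)
  -- The expression counts from `1` and adds one for each failing threshold as long as all earlier
  -- ones fail, like the nested cases of `kindOf`.
  obtain ⟨Γ, hΓ, hval⟩ := P.exists_tower kindOf R hP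
    (1 + g₁.not * (1 + g₂.not * (1 + g₃.not))) (fun A m n => by
      have h₁ := (Decides.bounded (o := fun i => P.eval i A)
        (v := fun i => (([m, n].getD i 0 : ℕ) : ℝ)) (a := simpleTest mat)
        (p := fun m₁ m₂ k₁ k₂ => R 0 A m₁ m₂ k₁ k₂)
        (fun v m₁ m₂ k₁ k₂ h2 h3 h4 h5 => decides_simpleTest (hm A) ⟨h2, h3⟩ ⟨h4, h5⟩)
        (inputs_hasValues m n).1 (inputs_hasValues m n).2).not
      have h₂ := (Decides.bounded (o := fun i => P.eval i A)
        (v := fun i => (([m, n].getD i 0 : ℕ) : ℝ)) (a := finiteTest mat)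
        (p := fun m₁ m₂ k₁ k₂ => R 1 A m₁ m₂ k₁ k₂)
        (fun v m₁ m₂ k₁ k₂ h2 h3 h4 h5 => decides_finiteTest (hm A) ⟨h2, h3⟩ ⟨h4, h5⟩)
        (inputs_hasValues m n).1 (inputs_hasValues m n).2).not
      have h₃ := (Decides.bounded (o := fun i => P.eval i A)
        (v := fun i => (([m, n].getD i 0 : ℕ) : ℝ)) (a := gapTest mat bound size)
        (p := fun m₁ m₂ k₁ k₂ => R 2 A m₁ m₂ k₁ k₂)
        (fun v m₁ m₂ k₁ k₂ h2 h3 h4 h5 =>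
          decides_gapTest (hm A) (hb A) (hs A) ⟨h2, h3⟩ ⟨h4, h5⟩)
        (inputs_hasValues m n).1 (inputs_hasValues m n).2).not
      simp only [eval_add, eval_one]
      rw [h₁.ite, eval_add, h₂.ite, eval_add, h₃]
      change _ = (((kindOf _ : Set.Icc (1 : ℕ) 4) : ℕ) : ℝ)
      unfold kindOf
      split_ifs <;> first | tauto | norm_num)
  refine ⟨⟨2, by norm_num, by norm_num, Γ, hΓ⟩, Γ, hΓ, fun n A => ?_⟩
  rw [hval, hP]
  refine kindOf_anti fun j => ?_
  rintro ⟨m₁, -, m₂, -, h⟩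
  exact ⟨m₁, m₂, h⟩

end SCI

end

/-! ### Finite against infinite sets, and diagonal operators -/

noncomputable section

namespace SCI

open Filter Topology

namespace ComputationalProblem

/-- A problem that distinguishes finite from infinite sets of natural numbers, of which every
evaluation reads only finitely many bits, cannot be solved by a single limit. -/
theorem not_inDelta_two {Ω M : Type} [TopologicalSpace M] [DiscreteTopology M]
    (P : ComputationalProblem Ω M) (φ : Set ℕ → Ω)
    (hφ : ∀ k, ∃ m, ∀ K K' : Set ℕ, (∀ i < m, i ∈ K ↔ i ∈ K') → P.eval k (φ K) = P.eval k (φ K'))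
    {y y' : M} (hy : y ≠ y') (hfin : ∀ K : Set ℕ, K.Finite → P.problem (φ K) = y)
    (hinf : ∀ K : Set ℕ, K.Infinite → P.problem (φ K) = y') : ¬ P.InDelta .G 2 := by
  rintro ⟨k, hk1, hk2, Γ, hΓ⟩
  obtain rfl : k = 1 := by omega
  have hlim : ∀ K, ∀ᶠ n in atTop, Γ [n] (φ K) = P.problem (φ K) := fun K => by
    have := hΓ.limit [] (by simp) (φ K)
    rw [hΓ.top, nhds_discrete, tendsto_pure] at this
    exact this
  choose b hb using hφ
  -- Some algorithm with index at least `s` answers `y` on the finite set `F`. It reads only bits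
  -- below some `m`, so it gives the same answer on every set that agrees with `F` below `m`.
  have hstep : ∀ (s : ℕ) (F : Finset ℕ), ∃ n m, s ≤ n ∧ (∀ i ∈ F, i < m) ∧
      ∀ K : Set ℕ, (∀ i < m, i ∈ K ↔ i ∈ F) → Γ [n] (φ K) = y := by
    intro s F
    obtain ⟨n, hn, hsn⟩ := ((hlim F).and (eventually_ge_atTop s)).exists
    obtain ⟨L, -, hL⟩ := hΓ.general [n] rfl
    refine ⟨n, max (F.sup id + 1) ((L (φ F)).sup b), hsn, fun i hi => ?_, fun K hK => ?_⟩
    · exact lt_max_of_lt_left (Nat.lt_succ_of_le (Finset.le_sup (f := id) hi))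
    · rw [← hfin F F.finite_toSet, ← hn]
      refine (hL (φ F) (φ K) fun k hk => hb k K F fun i hi => ?_).1
      exact hK i (lt_max_of_lt_right (hi.trans_le (Finset.le_sup (f := b) hk)))
  choose N m hN hm hval using hstep
  -- Adding the element `m` itself does not disturb the bits below `m`, and makes the union
  -- infinite.
  let F : ℕ → Finset ℕ := fun s => Nat.rec ∅ (fun s F => insert (m s F) F) s
  have hF : ∀ s, F (s + 1) = insert (m s (F s)) (F s) := fun s => rfl
  have hmono : Monotone F := monotone_nat_of_le_succ fun s => by
    rw [hF]
    exact Finset.subset_insert _ _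
  have hlt : ∀ s t, s < t → m s (F s) < m t (F t) := fun s t hst =>
    hm _ _ _ (hmono (Nat.succ_le_of_lt hst) (by rw [Nat.succ_eq_add_one, hF]; simp))
  -- Elements added from stage `s` on are at least `m s (F s)`, so the union agrees with `F s` below
  -- that number.
  have hold : ∀ s t, s ≤ t → ∀ i ∈ F t, i < m s (F s) → i ∈ F s := by
    intro s t hst
    induction t, hst using Nat.le_induction with
    | base => exact fun i hi _ => hi
    | succ t hst ih =>
      intro i hi hlt'
      rw [hF, Finset.mem_insert] at hi
      rcases hi with rfl | hi
      · rcases hst.eq_or_lt with rfl | h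
        · exact absurd hlt' (lt_irrefl _)
        · exact absurd (hlt s t h) hlt'.not_gt
      · exact ih i hi hlt'
  let K : Set ℕ := {i | ∃ s, i ∈ F s}
  have hK : K.Infinite := by
    refine Set.infinite_of_injective_forall_mem (f := fun s => m s (F s))
      (strictMono_nat_of_lt_succ fun s => hlt s _ (Nat.lt_succ_self s)).injective fun s => ?_
    exact ⟨s + 1, by rw [hF]; simp⟩
  have hKy : ∀ s, Γ [N s (F s)] (φ K) = y := fun s => by
    refine hval s (F s) K fun i hi => ⟨?_, fun h => ⟨s, h⟩⟩
    rintro ⟨t, ht⟩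
    rcases le_total s t with h | h
    · exact hold s t h i ht hi
    · exact hmono h ht
  -- On the infinite set `K` the answer `y` recurs at arbitrarily large indices, although the limit
  -- is `y'`.
  obtain ⟨s, hs⟩ := eventually_atTop.1 (hlim K)
  exact hy ((hKy s).symm.trans ((hs _ (hN s (F s))).trans (hinf K hK)))

end ComputationalProblem

/-! ### Diagonal operators -/

/-- The diagonal operator with diagonal entries `a i ∈ [0, 1]` as a bounded operator. -/
def diagCLM (a : ℕ → Set.Icc (0 : ℝ) 1) : Hilb →L[ℂ] Hilb :=
  lp.mapCLM 2 (fun i => (((a i : ℝ) : ℂ) • ContinuousLinearMap.id ℂ ℂ)) zero_le_one fun i => by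
    rw [norm_smul, ContinuousLinearMap.norm_id, mul_one, Complex.norm_real, Real.norm_eq_abs,
      abs_of_nonneg (a i).2.1]
    exact (a i).2.2

theorem diagCLM_apply (a : ℕ → Set.Icc (0 : ℝ) 1) (x : Hilb) (i : ℕ) :
    diagCLM a x i = ((a i : ℝ) : ℂ) * x i := rfl

/-- The diagonal operator with diagonal entries `a i ∈ [0, 1]`. -/
def diag (a : ℕ → Set.Icc (0 : ℝ) 1) : Op := (diagCLM a : Hilb →ₗ[ℂ] Hilb).toPMap ⊤

namespace Op

variable (a : ℕ → Set.Icc (0 : ℝ) 1)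

theorem diagCLM_e (i : ℕ) : diagCLM a (e i) = ((a i : ℝ) : ℂ) • e i := by
  ext j
  rw [diagCLM_apply, lp.coeFn_smul, Pi.smul_apply, e_apply]
  split_ifs with h
  · rw [h, smul_eq_mul]
  · simp

theorem hasSum_form_diag (x : (diag a).domain) :
    HasSum (fun i => (a i : ℝ) * ‖(x : Hilb) i‖ ^ 2) ((diag a).form x) := by
  have h := Complex.hasSum_re (lp.hasSum_inner (x : Hilb) (diagCLM a x))
  have hi : ∀ i, (inner ℂ ((x : Hilb) i) (diagCLM a x i)).re = (a i : ℝ) * ‖(x : Hilb) i‖ ^ 2 :=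
    fun i => by
      rw [diagCLM_apply, ← smul_eq_mul, inner_smul_right, Complex.re_ofReal_mul,
        inner_self_eq_norm_sq_to_K]
      norm_cast
  simp only [hi] at h
  exact h

theorem isSelfAdjoint_diag : IsSelfAdjoint (diag a) := by
  have h : ContinuousLinearMap.adjoint (diagCLM a) = diagCLM a := by
    symm
    rw [ContinuousLinearMap.eq_adjoint_iff]
    intro x y
    refine (lp.hasSum_inner (diagCLM a x) y).unique ?_
    convert lp.hasSum_inner x (diagCLM a y) using 2 with i
    rw [diagCLM_apply, diagCLM_apply]
    simp
    ring
  rw [LinearPMap.isSelfAdjoint_def, diag,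
    ContinuousLinearMap.toPMap_adjoint_eq_adjoint_toPMap_of_dense _ (by simp), h]

/-- The operator is bounded, so `P_n z → z` already implies convergence in the graph. -/
theorem hasCore_diag : (diag a).HasCore (Submodule.span ℂ (Set.range e)) := by
  set S := Submodule.span ℂ (Set.range e)
  have hcl := (isSelfAdjoint_diag a).isClosed
  have hle : (diag a).domRestrict S ≤ diag a := LinearPMap.domRestrict_le
  have hc : ((diag a).domRestrict S).IsClosable := hcl.isClosable.leIsClosable hle
  refine ⟨le_top, LinearPMap.eq_of_eq_graph ?_⟩
  rw [← hc.graph_closure_eq_closure_graph]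
  refine le_antisymm (Submodule.topologicalClosure_minimal _ (LinearPMap.le_graph_of_le hle) hcl) ?_
  rintro ⟨x, y⟩ hxy
  obtain ⟨z, hz, hzy⟩ := (LinearPMap.mem_graph_iff _).1 hxy
  obtain rfl : (z : Hilb) = x := hz
  obtain rfl : diagCLM a z = y := hzy
  refine mem_closure_of_tendsto ((tendsto_proj (z : Hilb)).prodMk_nhds
    (((diagCLM a).continuous.tendsto (z : Hilb)).comp (tendsto_proj (z : Hilb)))) (Eventually.of_forall fun n => ?_)
  have hn : proj n (z : Hilb) ∈ S := by
    rw [proj_apply]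
    exact Submodule.sum_mem _ fun j _ => Submodule.smul_mem _ _ (Submodule.subset_span ⟨j, rfl⟩)
  refine (LinearPMap.mem_graph_iff _).2 ⟨⟨proj n (z : Hilb), hn, trivial⟩, rfl, rfl⟩

theorem isAdmissible_diag : (diag a).IsAdmissible where
  selfAdjoint := isSelfAdjoint_diag a
  boundedBelow := ⟨0, fun x => by
    rw [zero_mul]
    exact (hasSum_form_diag a x).nonneg fun i => mul_nonneg (a i).2.1 (sq_nonneg _)⟩
  core := hasCore_diag a

theorem applyBasis_diag (j : ℕ) : (diag a).applyBasis j = ((a j : ℝ) : ℂ) • e j := by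
  rw [← diagCLM_e]
  exact dif_pos trivial

theorem entry_diag (i j : ℕ) : (diag a).entry i j = if i = j then ((a j : ℝ) : ℂ) else 0 := by
  rw [entry, applyBasis_diag, inner_smul_right, inner_e, e_apply]
  simp

theorem isDiagonal_diag : (diag a).IsDiagonal := fun i j h => by
  rw [entry_diag, if_neg h]

/-- For `j < n ≤ f n`, the image of `e j` is a multiple of `e j`, which `P_{f(n)}` fixes. -/
theorem dispersion_diag {f : ℕ → ℕ} (hf : ∀ n, n ≤ f n) (n : ℕ) : (diag a).dispersion f n = 0 := by
  have h : (ContinuousLinearMap.id ℂ Hilb - proj (f n)) ∘L (diag a).mulProj n = 0 := by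
    have h1 : ∀ j < n, proj (f n) (e j) = e j := fun j hj => by
      ext i
      rw [proj_apply, sum_smul_e_apply, e_apply]
      have := hf n
      split_ifs <;> first | rfl | omega
    ext x : 1
    simp only [mulProj, applyBasis_diag, ContinuousLinearMap.comp_apply, sum_apply, map_sum]
    refine Finset.sum_eq_zero fun j hj => ?_
    simp [h1 j (Finset.mem_range.1 hj)]
  rw [dispersion, LinearPMap.isSelfAdjoint_def.1 (isSelfAdjoint_diag a), h, norm_zero, max_self]

theorem mem_realSpectrum_diag (i : ℕ) : (a i : ℝ) ∈ (diag a).realSpectrum := by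
  rintro ⟨R, -, hR⟩
  have h := hR ⟨e i, trivial⟩
  have h2 : (diag a) ⟨e i, trivial⟩ - ((a i : ℝ) : ℂ) • e i = 0 := sub_eq_zero.2 (diagCLM_e a i)
  rw [h2, map_zero] at h
  have h3 : ‖(0 : Hilb)‖ = ‖e i‖ := congrArg norm h
  rw [norm_zero, norm_e] at h3
  exact zero_ne_one h3

/-- A diagonal operator with strict minimum on the diagonal is gapped. -/
theorem isGapped_diag {i₀ : ℕ} {q : ℝ} (h₀ : (a i₀ : ℝ) < q) (h : ∀ i ≠ i₀, q ≤ a i) :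
    (diag a).IsGapped := by
  have hA := isAdmissible_diag a
  -- The diagonal satisfies, coordinate by coordinate, a rank-one form bound with correction in the
  -- coordinate `i₀` only, so the finite-rank criterion applies.
  have hq : (diag a).bottom < q := (hA.isLeast_bottom.2 (mem_realSpectrum_diag a i₀)).trans_lt h₀
  have hF : ∀ x : (diag a).domain, q * ‖(x : Hilb)‖ ^ 2 ≤
      (diag a).form x + (q - a i₀) * ‖innerSL ℂ (e i₀) (x : Hilb)‖ ^ 2 := by
    intro x
    rw [innerSL_apply_apply, inner_e]
    have h1 := lp.hasSum_norm (p := 2) (by norm_num) (x : Hilb)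
    simp only [ENNReal.toReal_ofNat, Real.rpow_ofNat] at h1
    refine hasSum_le (fun i => ?_) (h1.mul_left q) ((hasSum_form_diag a x).add
      (hasSum_ite_eq i₀ ((q - a i₀) * ‖(x : Hilb) i₀‖ ^ 2)))
    split_ifs with hi
    · rw [hi]
      linarith
    · rw [add_zero]
      exact mul_le_mul_of_nonneg_right (h i hi) (sq_nonneg _)
  have hiso := hA.isIsolated_of_finiteRank _ hq hF
  refine ⟨hiso, le_antisymm ?_ ?_⟩
  · have := LinearMap.finrank_le_finrank_of_injective (injective_of_finiteRank _ hq hF)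
    rwa [Module.finrank_self] at this
  · have hinj := injective_of_finiteRank _ hq hF
    have := Module.Finite.of_injective _ hinj
    have := Submodule.nontrivial_iff_ne_bot.2 (eigenspace_bottom_ne_bot hA hiso)
    exact Module.finrank_pos

/-- A diagonal operator with diagonal entries dense in `[0, 1]` is gapless. -/
theorem isGapless_diag (h : Set.Icc (0 : ℝ) 1 ⊆ closure (Set.range fun i => (a i : ℝ))) :
    (diag a).IsGapless := by
  have hA := isAdmissible_diag a
  have hsub : Set.Icc (0 : ℝ) 1 ⊆ (diag a).realSpectrum := h.trans
    (closure_minimal (Set.range_subset_iff.2 (mem_realSpectrum_diag a))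
      (isClosed_realSpectrum hA.selfAdjoint))
  have h0 : (diag a).bottom = 0 := le_antisymm (hA.isLeast_bottom.2 (hsub (by simp)))
    (le_of_mem_realSpectrum hA.selfAdjoint (fun x => by
      rw [zero_mul]
      exact (hasSum_form_diag a x).nonneg fun i => mul_nonneg (a i).2.1 (sq_nonneg _))
      hA.isLeast_bottom.1)
  refine ⟨1, one_pos, fun x hx => hsub ?_⟩
  rwa [h0, zero_add] at hx

theorem IsGapless.not_isIsolated {A : Op} (h : A.IsGapless) : ¬ A.IsIsolated (A.bottom : ℂ) := by
  rintro ⟨-, ε, hε, hiso⟩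
  obtain ⟨δ, hδ, hgl⟩ := h
  have hm : 0 < min δ (ε / 2) := lt_min hδ (half_pos hε)
  have h1 := hiso _ (hgl (A.bottom + min δ (ε / 2)) ⟨by linarith, by linarith [min_le_left δ (ε / 2)]⟩)
    (by
      rw [Complex.dist_eq, ← Complex.ofReal_sub, Complex.norm_real, Real.norm_eq_abs,
        add_sub_cancel_left, abs_of_pos hm]
      linarith [min_le_right δ (ε / 2)])
  have h2 := Complex.ofReal_injective h1
  linarith

end Op

end SCI

end

/-! ### Coding sets into diagonals, and the lower bounds -/

noncomputable section

namespace SCI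

open Filter Topology

/-- There is an injective sequence in `[0, 1)` that is dense in `[0, 1]`. -/
theorem exists_injective_dense : ∃ d : ℕ → ℝ, Function.Injective d ∧ (∀ k, 0 ≤ d k ∧ d k < 1) ∧
    Set.Icc (0 : ℝ) 1 ⊆ closure (Set.range d) := by
  -- The value `1` is left out because it is the filler off `K`; the minimum must not coincide with
  -- it.
  let Q : Set ℚ := Set.Ico 0 1
  have : Infinite Q := (Set.Ico_infinite zero_lt_one).to_subtype
  obtain ⟨D⟩ := nonempty_denumerable Q
  let u : ℕ ≃ Q := (Denumerable.eqv Q).symm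
  refine ⟨fun k => ((u k : ℚ) : ℝ), fun i j h => u.injective (Subtype.ext (Rat.cast_injective h)),
    fun k => ⟨Rat.cast_nonneg.2 (u k).2.1, (Rat.cast_lt.2 (u k).2.2).trans_eq Rat.cast_one⟩, ?_⟩
  rw [← closure_Ico (zero_ne_one (α := ℝ))]
  refine closure_minimal (fun x hx => Metric.mem_closure_iff.2 fun ε hε => ?_) isClosed_closure
  obtain ⟨q, hq1, hq2⟩ := exists_rat_btwn (lt_min (lt_add_of_pos_right x hε) hx.2)
  have hq : q ∈ Q := ⟨by exact_mod_cast hx.1.trans hq1.le,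
    by exact_mod_cast hq2.trans_le (min_le_right _ _)⟩
  refine ⟨q, ⟨u.symm ⟨q, hq⟩, by simp⟩, ?_⟩
  rw [dist_comm, Real.dist_eq, abs_of_pos (sub_pos.2 hq1)]
  linarith [min_le_left (x + ε) 1]

open Classical in
/-- The sequence that runs through `d` along the set `K` and is `1` off `K`. -/
def spread (d : ℕ → ℝ) (hd : ∀ k, 0 ≤ d k ∧ d k < 1) (K : Set ℕ) (i : ℕ) : Set.Icc (0 : ℝ) 1 :=
  if i ∈ K then ⟨d (Nat.count (· ∈ K) i), (hd _).1, (hd _).2.le⟩ else ⟨1, by simp⟩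

section

variable {d : ℕ → ℝ} {hd : ∀ k, 0 ≤ d k ∧ d k < 1}

open Classical in
theorem spread_of_mem {K : Set ℕ} {i : ℕ} (h : i ∈ K) :
    (spread d hd K i : ℝ) = d (Nat.count (· ∈ K) i) := by
  rw [spread, if_pos h]

theorem spread_of_notMem {K : Set ℕ} {i : ℕ} (h : i ∉ K) : (spread d hd K i : ℝ) = 1 := by
  rw [spread, if_neg h]

/-- The counting index at `i` depends only on membership of numbers below `i`, so each matrix entry
reads finitely many bits of `K`. -/
theorem spread_congr {K K' : Set ℕ} {i : ℕ} (h : ∀ j < i + 1, j ∈ K ↔ j ∈ K') :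
    spread d hd K i = spread d hd K' i := by
  classical
  have h1 : Nat.count (· ∈ K) i = Nat.count (· ∈ K') i := by
    rw [Nat.count_eq_card_filter_range, Nat.count_eq_card_filter_range]
    congr 1
    exact Finset.filter_congr fun j hj => h j ((Finset.mem_range.1 hj).trans (Nat.lt_succ_self i))
  refine Subtype.ext ?_
  by_cases hi : i ∈ K
  · rw [spread_of_mem hi, spread_of_mem ((h i (Nat.lt_succ_self i)).1 hi)]
    convert congrArg d h1
  · rw [spread_of_notMem hi, spread_of_notMem fun h' => hi ((h i (Nat.lt_succ_self i)).2 h')]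

/-- As `d` is injective and `Nat.count` is injective on `K`, the entries along `K` are distinct and
below `1`. For finite non-empty `K` their minimum is attained once and is separated from the
remaining entries, which take finitely many values. -/
theorem isGapped_spread (hinj : Function.Injective d) {K : Set ℕ} (hK : K.Finite)
    (hne : K.Nonempty) : (diag (spread d hd K)).IsGapped := by
  classical
  obtain ⟨i₀, hi₀, hmin⟩ := hK.exists_minimalFor (fun i => (spread d hd K i : ℝ)) K hne
  have hlt : ∀ i ≠ i₀, (spread d hd K i₀ : ℝ) < spread d hd K i := by
    intro i hi
    by_cases hiK : i ∈ K
    · refine lt_of_le_of_ne ?_ fun h => hi ?_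
      · rcases le_total (spread d hd K i₀ : ℝ) (spread d hd K i) with h | h
        · exact h
        · exact hmin hiK h
      · rw [spread_of_mem hi₀, spread_of_mem hiK] at h
        exact (Nat.count_injective hi₀ hiK (hinj h)).symm
    · rw [spread_of_notMem hiK, spread_of_mem hi₀]
      exact (hd _).2
  let T : Finset ℝ := insert 1 ((hK.toFinset.erase i₀).image fun i => (spread d hd K i : ℝ))
  have hT : T.Nonempty := ⟨1, by simp [T]⟩
  refine Op.isGapped_diag _ (i₀ := i₀) (q := T.min' hT) ?_ fun i hi => ?_
  · rw [Finset.lt_min'_iff]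
    intro y hy
    rw [Finset.mem_insert, Finset.mem_image] at hy
    rcases hy with rfl | ⟨i, hi, rfl⟩
    · rw [spread_of_mem hi₀]
      exact (hd _).2
    · exact hlt i (Finset.mem_erase.1 hi).1
  · refine Finset.min'_le _ _ ?_
    by_cases hiK : i ∈ K
    · refine Finset.mem_insert_of_mem (Finset.mem_image_of_mem _ ?_)
      exact Finset.mem_erase.2 ⟨hi, hK.mem_toFinset.2 hiK⟩
    · rw [spread_of_notMem hiK]
      exact Finset.mem_insert_self _ _

/-- Along an infinite `K` the count takes every value, so the diagonal contains the whole dense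
sequence `d`. -/
theorem isGapless_spread (hdense : Set.Icc (0 : ℝ) 1 ⊆ closure (Set.range d)) {K : Set ℕ}
    (hK : K.Infinite) : (diag (spread d hd K)).IsGapless := by
  classical
  refine Op.isGapless_diag _ (hdense.trans (closure_mono ?_))
  rintro - ⟨k, rfl⟩
  refine ⟨Nat.nth (· ∈ K) k, ?_⟩
  change (spread d hd K (Nat.nth (· ∈ K) k) : ℝ) = d k
  have hm : Nat.nth (· ∈ K) k ∈ K := Nat.nth_mem_of_infinite hK k
  rw [spread_of_mem hm]
  congr 1
  exact Nat.count_nth_of_infinite (p := (· ∈ K)) hK k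

theorem exists_entry_spread_congr (i j : ℕ) : ∃ m, ∀ K K' : Set ℕ, (∀ l < m, l ∈ K ↔ l ∈ K') →
    (diag (spread d hd (insert 0 K))).entry i j = (diag (spread d hd (insert 0 K'))).entry i j := by
  refine ⟨j + 1, fun K K' h => ?_⟩
  rw [Op.entry_diag, Op.entry_diag, spread_congr (K' := insert 0 K')]
  intro l hl
  simp only [Set.mem_insert_iff, h l hl]

end

/-- Inserting `0` excludes the empty set, whose operator is the identity and neither gapped nor
gapless. The proof applies to every class that contains the diagonal one. -/
theorem gapProblem_not_inDelta (S : Set Op) (hS : ∀ A ∈ S, A.IsAdmissible)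
    (hsub : gapClassDiag ⊆ S) : ¬ (gapProblem S hS).InDelta .G 2 := by
  obtain ⟨d, hinj, hd, hdense⟩ := exists_injective_dense
  have hfin : ∀ K : Set ℕ, K.Finite → (diag (spread d hd (insert 0 K))).IsGapped := fun K hK =>
    isGapped_spread hinj (hK.insert 0) (Set.insert_nonempty 0 K)
  have hinf : ∀ K : Set ℕ, K.Infinite → (diag (spread d hd (insert 0 K))).IsGapless := fun K hK =>
    isGapless_spread hdense (hK.mono (Set.subset_insert 0 K))
  refine (gapProblem S hS).not_inDelta_two
    (fun K => ⟨diag (spread d hd (insert 0 K)), hsub ⟨⟨Op.isAdmissible_diag _, ?_⟩,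
      Op.isDiagonal_diag _⟩⟩) (fun k => exists_entry_spread_congr _ _)
    (y := true) (y' := false) (by simp) (fun K hK => ?_) fun K hK => ?_
  · rcases K.finite_or_infinite with hK | hK
    · exact Or.inl (hfin K hK)
    · exact Or.inr (hinf K hK)
  · simpa [gapProblem] using hfin K hK
  · have h := (hinf K hK).not_isIsolated
    simpa [gapProblem] using fun hg : Op.IsGapped _ => h hg.1

/-- The same family with one fixed `c` from `C`, admissible because the dispersion vanishes and `c`
is non-negative. The evaluations of `c` and `f` carry no information on `K`, and the two answers are
`1` and `4`. -/
theorem classProblem_not_inDelta (f : ℕ → ℕ) (hf : ∀ n, n ≤ f n) (C : Set (ℕ → ℚ))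
    (hC : C.Nonempty) (hC' : ∀ c ∈ C, Tendsto (fun n => (c n : ℝ)) atTop (𝓝 0) ∧ ∀ n, 0 ≤ c n)
    (S : Set (Op × (ℕ → ℚ))) (hS : ∀ p ∈ S, p.1.IsAdmissible)
    (hsub : dispersionClassDiag f C ⊆ S) : ¬ (classProblem f S hS).InDelta .G 2 := by
  obtain ⟨d, hinj, hd, hdense⟩ := exists_injective_dense
  obtain ⟨c, hc⟩ := hC
  refine (classProblem f S hS).not_inDelta_two
    (fun K => ⟨(diag (spread d hd (insert 0 K)), c), hsub ⟨⟨Op.isAdmissible_diag _, hc,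
      (hC' c hc).1, fun n => ?_⟩, Op.isDiagonal_diag _⟩⟩) (fun k => ?_)
    (y := ⟨1, by simp⟩) (y' := ⟨4, by simp⟩) (by simp) (fun K hK => ?_) fun K hK => ?_
  · rw [Op.dispersion_diag _ hf]
    exact_mod_cast (hC' c hc).2 n
  · obtain ⟨m, hm⟩ := exists_entry_spread_congr (d := d) (hd := hd) (k / 3).unpair.1
      (k / 3).unpair.2
    refine ⟨m, fun K K' h => ?_⟩
    simp only [classProblem, hm K K' h]
  · have h := Op.bottomKind_le_one_iff.2
      (isGapped_spread (hd := hd) hinj (hK.insert 0) (Set.insert_nonempty 0 K))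
    exact Subtype.ext (le_antisymm h (Op.bottomKind _).2.1)
  · have h := (isGapless_spread (hd := hd) hdense
      (hK.mono (Set.subset_insert 0 K))).not_isIsolated
    rw [← Op.bottomKind_le_three_iff (Op.isAdmissible_diag _), not_le] at h
    exact Subtype.ext (le_antisymm (Op.bottomKind _).2.2 h)

end SCI

end

theorem theorem3p10 :
    ((SCI.gapProblem SCI.gapClass fun _ h => h.1).InSigma SCI.Model.A 2 ∧
      ¬ (SCI.gapProblem SCI.gapClass fun _ h => h.1).InDelta SCI.Model.G 2 ∧
      (SCI.gapProblem SCI.gapClassDiag fun _ h => h.1.1).InSigma SCI.Model.A 2 ∧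
      ¬ (SCI.gapProblem SCI.gapClassDiag fun _ h => h.1.1).InDelta SCI.Model.G 2) ∧
    ∀ (f : ℕ → ℕ), (∀ n, n ≤ f n) →
    ∀ (C : Set (ℕ → ℚ)), C.Nonempty →
      (∀ c ∈ C, Filter.Tendsto (fun n => (c n : ℝ)) Filter.atTop (nhds 0) ∧ ∀ n, 0 ≤ c n) →
      (SCI.classProblem f (SCI.dispersionClass f C) fun _ h => h.1).InPi SCI.Model.A 2 ∧
      ¬ (SCI.classProblem f (SCI.dispersionClass f C) fun _ h => h.1).InDelta SCI.Model.G 2 ∧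
      (SCI.classProblem f (SCI.dispersionClassDiag f C) fun _ h => h.1.1).InPi SCI.Model.A 2 ∧
      ¬ (SCI.classProblem f (SCI.dispersionClassDiag f C) fun _ h => h.1.1).InDelta
          SCI.Model.G 2 := by
  refine ⟨⟨SCI.gapProblem_inSigma _ _, SCI.gapProblem_not_inDelta _ _ fun _ h => h.1,
    SCI.gapProblem_inSigma _ _, SCI.gapProblem_not_inDelta _ _ subset_rfl⟩,
    fun f hf C hC hC' => ⟨?_, ?_, ?_, ?_⟩⟩
  · exact SCI.classProblem_inPi f hf C _ _ subset_rfl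
  · exact SCI.classProblem_not_inDelta f hf C hC hC' _ _ fun _ h => h.1
  · exact SCI.classProblem_inPi f hf C _ _ fun _ h => h.1
  · exact SCI.classProblem_not_inDelta f hf C hC hC' _ _ subset_rfl
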